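/- **Setting.** Let $\mathbb X$ be a set with a quasi-metric $\rho$ (a function $\rho:\mathbb X\times\mathbb X\to[0,\infty)$ that is symmetric, vanishes exactly on the diagonal, and satisfies $\rho(x,y)\le\kappa_1(\rho(x,z)+\rho(z,y))$ with $\kappa_1\ge1$), topologized so that the sets $\{y:\rho(x,y)<r\}$ form a basis. Write $\mathbb B(x,r)=\{y:\rho(x,y)\le r\}$. Let $\mu^*$ be a Borel probability measure on $\mathbb X$, let $0=\lambda_0\le\lambda_1\le\cdots\to\infty$, and let $\phi_0\equiv1,\phi_1,\phi_2,\dots$ be real, continuous, bounded functions, orthonormal in $L^2(\mu^*)$. Assume that this is a data-defined space with exponent $q>0$ and constants $\kappa_2,\kappa_3,\kappa_4>0$: all balls $\mathbb B(x,r)$, $r>0$, are compact; $\mu^*(\mathbb B(x,r))\le\kappa_2r^q$ for all $x$ and $r>0$; and for $0<t\le1$ and all $x,y$ the series $K_t(x,y)=\sum_k e^{-\lambda_k^2t}\phi_k(x)\phi_k(y)$ converges and $|K_t(x,y)|\le\kappa_3t^{-q/2}\exp(-\kappa_4\rho(x,y)^2/t)$. Norms $\|\cdot\|_p$ are those of $L^p(\mu^*)$,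 and $\frac1p+\frac1{p'}=1$. Let $\Pi_N=\mathrm{span}\{\phi_j:\lambda_j<N\}$ (real or complex coefficients), and let $X^p$ be the $L^p$ closure of $\bigcup_N\Pi_N$. Put $\hat f(k)=\int f\phi_k\,d\mu^*$. For $f,g\in X^p$ write $g=\Delta^rf$ if $\hat g(k)=(\lambda_k+1)^r\hat f(k)$ for all $k$, and let $W^p_r$ be the set of those $f\in X^p$ for which such a $g$ exists. For $0<\gamma<r$ let $$\omega_r(p;f,\delta)=\inf_{f_1\in W^p_r}\{\|f-f_1\|_p+\delta^r\|\Delta^rf_1\|_p\},\qquad \|f\|_{H^p_\gamma}=\|f\|_p+\sup_{0<\delta\le1}\frac{\omega_r(p;f,\delta)}{\delta^\gamma}.$$ For a finite signed Borel measure $\nu$ with total variation measure $|\nu|$, let $|\!|\!|\nu|\!|\!|_{R,d}$ be the infimum of all $c$ with $|\nu|(\mathbb B(x,d))\le c\,d^q$ for all $x\in\mathbb X$. The measure $\nu$ is a quadrature measure of order $N$ if $\int P\,d\nu=\int P\,d\mu^*$ for all $P\in\Pi_N$. A sequence $(\nu_m)_{m\ge1}$ of such measures is of class $\mathcal A(\gamma,p)$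 if there are finite constants $V,R,A$ with $|\nu_m|(\mathbb X)\le V$, $|\!|\!|\nu_m|\!|\!|_{R,1/m}\le R$ and $$\Big|\int P\,d\mu^*-\int P\,d\nu_m\Big|\le A\,\frac{\|P\|_{H^p_\gamma}}{m^\gamma}\qquad(P\in\Pi_m)$$ for all $m\ge1$; we write $\nu\in\mathcal A(\gamma,p,N)$ if $\nu=\nu_N$ for such a sequence. Let $S>q$ be an integer. A mask of type $\beta$ is an even, $S$ times continuously differentiable $b:\mathbb R\to\mathbb R$ with $b(t)=(1+t)^{-\beta}F(\log t)$ for $t>0$, where $|F^{(k)}|\le c(b)$ on $\mathbb R$ for $0\le k\le S$ and $F\ge c_1(b)>0$ on $\mathbb R$. A kernel of type $\beta$ with mask $b$ is a measurable $G:\mathbb X\times\mathbb X\to\mathbb R$ with formal expansion $\sum_jb(\lambda_j)\phi_j(x)\phi_j(y)$, i.e. for every $x$, $G(x,\cdot)\in L^1(\mu^*)$ and $\int G(x,y)\phi_k(y)\,d\mu^*(y)=b(\lambda_k)\phi_k(x)$ for all $k$. Put $$M_p(\nu)=\Big\|\int G(x,\cdot)\,d\nu(x)-\int G(x,\cdot)\,d\mu^*(x)\Big\|_{p'}.$$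 **Theorem.** Let $1\le p\le\infty$, $\beta>q/p$, let $b$ be a mask of type $\beta$, let $0<\gamma<\beta$, $r>\gamma$, and let $C_1,C_2,C_3$ be constants. There are positive constants $V,R,A$, depending only on $\mathbb X,\rho,\mu^*,q,\kappa_1,\dots,\kappa_4,p,\beta,S,b,\gamma,r,C_1,C_2,C_3$ (and on $\{\lambda_k\},\{\phi_k\}$ only through these), such that the following holds for every kernel $G$ of type $\beta$ with mask $b$. Let $n>0$ be real and let $K$ be any set of finite signed Borel measures (in particular, any compact set of them) with $|\nu|(\mathbb X)\le C_1$ and $|\!|\!|\nu|\!|\!|_{R,2^{-n}}\le C_2$ for all $\nu\in K$, such that $K$ contains a quadrature measure of order $2^n$. If $\nu^\#\in K$ satisfies $M_p(\nu^\#)\le C_3\inf_{\nu\in K}M_p(\nu)$, then $$\Big|\int P\,d\mu^*-\int P\,d\nu^\#\Big|\le A\,\frac{\|P\|_{H^p_\gamma}}{2^{n\gamma}}\qquad\text{for all }P\in\Pi_{2^n},$$ and, whenever $2^n$ is an integer, $\nu^\#\in\mathcal A(\gamma,p,2^n)$, through a sequence of class $\mathcal A(\gamma,p)$ with the constants $V,R,A$.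 -/

import Mathlib

open MeasureTheory Filter Topology
open scoped ENNReal NNReal

noncomputable section

namespace DataDefined

/-- The closed quasi-metric ball `{y | ρ(x,y) ≤ r}`. -/
def cball {X : Type*} (ρ : X → X → ℝ) (x : X) (r : ℝ) : Set X := {y | ρ x y ≤ r}

/-- `ρ` is a quasi-metric with constant `κ₁` in the relaxed triangle inequality. -/
structure IsQuasiMetric {X : Type*} (ρ : X → X → ℝ) (κ₁ : ℝ) : Prop where
  nonneg : ∀ x y, 0 ≤ ρ x y
  eq_zero_iff : ∀ x y, ρ x y = 0 ↔ x = y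
  symm : ∀ x y, ρ x y = ρ y x
  one_le : 1 ≤ κ₁
  triangle : ∀ x y z, ρ x y ≤ κ₁ * (ρ x z + ρ z y)

/-- `(X, ρ, μ, (lam k), (φ k))` is a data-defined space with exponent `q` and constants
`κ₁, κ₂, κ₃, κ₄`. The (formal) heat kernel is
`K_t(x,y) = ∑ₖ exp (-(lam k)² t) φₖ(x) φₖ(y)`.
Absolute convergence of this series for all `x, y` is the same as convergence for all `x, y`: the
terms are nonnegative on the diagonal, and Cauchy-Schwarz applies off it. The functions `φ k` are
integrable because they are bounded and continuous and `μ` is a probability measure. -/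
structure IsDataDefinedSpace {X : Type*} [TopologicalSpace X] [MeasurableSpace X]
    (ρ : X → X → ℝ) (μ : Measure X) (lam : ℕ → ℝ) (φ : ℕ → X → ℝ)
    (q κ₁ κ₂ κ₃ κ₄ : ℝ) : Prop where
  quasiMetric : IsQuasiMetric ρ κ₁
  /-- The open balls are a basis of the topology. -/
  basis : TopologicalSpace.IsTopologicalBasis
    {U : Set X | ∃ (x : X) (r : ℝ), 0 < r ∧ U = {y | ρ x y < r}}
  prob : IsProbabilityMeasure μ
  lam_mono : Monotone lam
  lam_zero : lam 0 = 0
  lam_tendsto : Tendsto lam atTop atTop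
  phi_continuous : ∀ k, Continuous (φ k)
  phi_bounded : ∀ k, ∃ C, ∀ x, |φ k x| ≤ C
  phi_orthonormal : ∀ j k, ∫ x, φ j x * φ k x ∂μ = if j = k then 1 else 0
  phi_zero : ∀ x, φ 0 x = 1
  ball_compact : ∀ (x : X) (r : ℝ), 0 < r → IsCompact (cball ρ x r)
  q_pos : 0 < q
  kappa₂_pos : 0 < κ₂
  ball_measure : ∀ (x : X) (r : ℝ), 0 < r → μ (cball ρ x r) ≤ ENNReal.ofReal (κ₂ * r ^ q)
  kappa₃_pos : 0 < κ₃
  kappa₄_pos : 0 < κ₄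
  heat_summable : ∀ (t : ℝ) (x y : X), 0 < t → t ≤ 1 →
    Summable fun k => Real.exp (-(lam k) ^ 2 * t) * φ k x * φ k y
  heat_gaussian : ∀ (t : ℝ) (x y : X), 0 < t → t ≤ 1 →
    |∑' k, Real.exp (-(lam k) ^ 2 * t) * φ k x * φ k y| ≤
      κ₃ * t ^ (-q / 2) * Real.exp (-κ₄ * ρ x y ^ 2 / t)

/-- `Π_N`: the diffusion polynomials of degree `< N`, with coefficients in `𝕜` (`ℝ` or `ℂ`). -/
def diffusionPoly (𝕜 : Type*) [RCLike 𝕜] {X : Type*} (lam : ℕ → ℝ) (φ : ℕ → X → ℝ) (N : ℝ) :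
    Submodule 𝕜 (X → 𝕜) :=
  Submodule.span 𝕜 {f | ∃ j, lam j < N ∧ f = fun x => (φ j x : 𝕜)}

/-- `X^p`: the `L^p(μ)` closure of the set of all diffusion polynomials. -/
def MemXp {𝕜 : Type*} [RCLike 𝕜] {X : Type*} [MeasurableSpace X] (μ : Measure X)
    (lam : ℕ → ℝ) (φ : ℕ → X → ℝ) (p : ℝ≥0∞) (f : X → 𝕜) : Prop :=
  MemLp f p μ ∧ ∀ ε : ℝ≥0∞, 0 < ε →
    ∃ N : ℝ, ∃ P ∈ diffusionPoly 𝕜 lam φ N, eLpNorm (f - P) p μ ≤ ε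

/-- The Fourier coefficient `⟨f, φₖ⟩ = ∫ f φₖ dμ`. -/
def fourierCoef {𝕜 : Type*} [RCLike 𝕜] {X : Type*} [MeasurableSpace X] (μ : Measure X)
    (φ : ℕ → X → ℝ) (f : X → 𝕜) (k : ℕ) : 𝕜 :=
  ∫ x, f x * (φ k x : 𝕜) ∂μ

/-- `f` lies in the space `W_r^p` and `g = Δ^r f`: both are in `X^p`, and the `k`-th Fourier
coefficient of `g` is `(lam k + 1)^r` times that of `f`. -/
structure IsDeltaPow {𝕜 : Type*} [RCLike 𝕜] {X : Type*} [MeasurableSpace X] (μ : Measure X)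
    (lam : ℕ → ℝ) (φ : ℕ → X → ℝ) (r : ℝ) (p : ℝ≥0∞) (f g : X → 𝕜) : Prop where
  mem_left : MemXp μ lam φ p f
  mem_right : MemXp μ lam φ p g
  coef : ∀ k, fourierCoef μ φ g k = (((lam k + 1) ^ r : ℝ) : 𝕜) * fourierCoef μ φ f k

/-- The `K`-functional
`ω_r(p; f, δ) = inf {‖f - f₁‖_p + δ^r ‖Δ^r f₁‖_p : f₁ ∈ W_r^p}`. -/
def omega {𝕜 : Type*} [RCLike 𝕜] {X : Type*} [MeasurableSpace X] (μ : Measure X)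
    (lam : ℕ → ℝ) (φ : ℕ → X → ℝ) (r : ℝ) (p : ℝ≥0∞) (f : X → 𝕜) (δ : ℝ) : ℝ≥0∞ :=
  ⨅ (f₁ : X → 𝕜) (g : X → 𝕜) (_ : IsDeltaPow μ lam φ r p f₁ g),
    eLpNorm (f - f₁) p μ + ENNReal.ofReal (δ ^ r) * eLpNorm g p μ

/-- The norm of `H^p_γ`, formed with the `K`-functional of order `r > γ`:
`‖f‖_p + sup_{0 < δ ≤ 1} ω_r(p; f, δ) / δ^γ`. -/
def hNorm {𝕜 : Type*} [RCLike 𝕜] {X : Type*} [MeasurableSpace X] (μ : Measure X)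
    (lam : ℕ → ℝ) (φ : ℕ → X → ℝ) (γ r : ℝ) (p : ℝ≥0∞) (f : X → 𝕜) : ℝ≥0∞ :=
  eLpNorm f p μ + ⨆ (δ : ℝ) (_ : 0 < δ ∧ δ ≤ 1),
    omega μ lam φ r p f δ / ENNReal.ofReal (δ ^ γ)

/-- The `d`-regularity norm of `ν`: the infimum of all `c` such that
`|ν|({y | ρ(x,y) ≤ d}) ≤ c d^q` for all `x`. -/
def regNorm {X : Type*} [MeasurableSpace X] (ρ : X → X → ℝ) (q : ℝ) (ν : SignedMeasure X)
    (d : ℝ) : ℝ≥0∞ :=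
  sInf {c : ℝ≥0∞ | ∀ x, ν.variation (cball ρ x d) ≤ c * ENNReal.ofReal (d ^ q)}

/-- `ν` is a quadrature measure of order `N`. -/
def IsQuadrature (𝕜 : Type*) [RCLike 𝕜] {X : Type*} [MeasurableSpace X] (μ : Measure X)
    (lam : ℕ → ℝ) (φ : ℕ → X → ℝ) (N : ℝ) (ν : SignedMeasure X) : Prop :=
  ∀ P ∈ diffusionPoly 𝕜 lam φ N, (∫ᵛ x, P x ∂<•ν) = ∫ x, P x ∂μ

/-- The approximate quadrature bound of order `N` with constant `A`:
`|∫ P dμ - ∫ P dν| ≤ A ‖P‖_{H^p_γ} / N^γ` for all `P ∈ Π_N`. -/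
def ApproxQuadBound (𝕜 : Type*) [RCLike 𝕜] {X : Type*} [MeasurableSpace X] (μ : Measure X)
    (lam : ℕ → ℝ) (φ : ℕ → X → ℝ) (γ r : ℝ) (p : ℝ≥0∞) (A N : ℝ) (ν : SignedMeasure X) : Prop :=
  ∀ P ∈ diffusionPoly 𝕜 lam φ N,
    ‖(∫ x, P x ∂μ) - ∫ᵛ x, P x ∂<•ν‖ₑ ≤
      ENNReal.ofReal A * hNorm μ lam φ γ r p P / ENNReal.ofReal (N ^ γ)

/-- `(ν n)`, `n ≥ 1`, is a sequence of approximate quadrature measures of class `𝒜(γ, p)`, with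
total variations bounded by `V`, regularity norms bounded by `R`, and constant `A` in the
approximate quadrature bounds. (The class itself asks for some finite `V`, `R`, `A`.) -/
structure IsApproxQuadSeq (𝕜 : Type*) [RCLike 𝕜] {X : Type*} [MeasurableSpace X]
    (ρ : X → X → ℝ) (μ : Measure X) (lam : ℕ → ℝ) (φ : ℕ → X → ℝ) (q γ r : ℝ) (p : ℝ≥0∞)
    (V R A : ℝ) (ν : ℕ → SignedMeasure X) : Prop where
  variation_le : ∀ n, 1 ≤ n → (ν n).variation Set.univ ≤ ENNReal.ofReal V
  regNorm_le : ∀ n : ℕ, 1 ≤ n → regNorm ρ q (ν n) (1 / (n : ℝ)) ≤ ENNReal.ofReal R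
  bound : ∀ n : ℕ, 1 ≤ n → ApproxQuadBound 𝕜 μ lam φ γ r p A n (ν n)

/-- `ν ∈ 𝒜(γ, p, N)`: `ν` is the `N`-th member of a sequence of approximate quadrature measures of
class `𝒜(γ, p)`. The constants of that sequence are recorded, so that it makes sense to say that
they are uniform. -/
def MemApproxQuad (𝕜 : Type*) [RCLike 𝕜] {X : Type*} [MeasurableSpace X]
    (ρ : X → X → ℝ) (μ : Measure X) (lam : ℕ → ℝ) (φ : ℕ → X → ℝ) (q γ r : ℝ) (p : ℝ≥0∞)
    (V R A : ℝ) (N : ℕ) (ν : SignedMeasure X) : Prop :=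
  ∃ s : ℕ → SignedMeasure X, IsApproxQuadSeq 𝕜 ρ μ lam φ q γ r p V R A s ∧ s N = ν

/-- `b` is a mask of type `β` and smoothness `S`. The function `F` is `S` times continuously
differentiable since `F u = (1 + exp u)^β * b (exp u)`. -/
structure IsMask (S : ℕ) (β : ℝ) (b : ℝ → ℝ) : Prop where
  even : ∀ t, b (-t) = b t
  contDiff : ContDiff ℝ S b
  exists_factor : ∃ (F : ℝ → ℝ) (c c₁ : ℝ), 0 < c₁ ∧
    (∀ t, 0 < t → b t = (1 + t) ^ (-β) * F (Real.log t)) ∧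
    (∀ k, k ≤ S → ∀ u, |iteratedDeriv k F u| ≤ c) ∧
    ∀ u, c₁ ≤ F u

/-- `G` is a kernel with formal expansion `G(x,y) = ∑ₖ b(lam k) φₖ(x) φₖ(y)`: it is measurable,
and for every `x` the function `G(x,·)` is integrable with Fourier coefficients
`b(lam k) φₖ(x)`. -/
structure IsKernel {X : Type*} [MeasurableSpace X] (μ : Measure X)
    (lam : ℕ → ℝ) (φ : ℕ → X → ℝ) (b : ℝ → ℝ) (G : X → X → ℝ) : Prop where
  measurable : Measurable (Function.uncurry G)
  integrable : ∀ x, Integrable (G x) μ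
  coef : ∀ x k, ∫ y, G x y * φ k y ∂μ = b (lam k) * φ k x

/-- `M_p(ν) = ‖∫ G(x,·) dν(x) - ∫ G(x,·) dμ(x)‖_{p'}` with `1/p + 1/p' = 1`. -/
def kernelError {X : Type*} [MeasurableSpace X] (μ : Measure X) (G : X → X → ℝ) (p : ℝ≥0∞)
    (ν : SignedMeasure X) : ℝ≥0∞ :=
  eLpNorm (fun y => (∫ᵛ x, G x y ∂<•ν) - ∫ x, G x y ∂μ) p.conjExponent μ

end DataDefined

end

open MeasureTheory Filter Topology
open scoped ENNReal NNReal

noncomputable section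

namespace DataDefined

/-! Put `N = 2^n`. A polynomial `P` in `Π_N` equals `∫ G(·,y) D(y) dμ(y)`, where `D` arises from `P`
by dividing the `k`-th Fourier coefficient by `b(λ_k)`. Fubini and Hölder then bound the quadrature
error of `P` under any `ν` by `M_p(ν) ‖D‖_p` (`enorm_quadError_le_kernelError`). Near-minimality
replaces `M_p(ν^#)` by the kernel error of the quadrature measure contained in `K`. What remains is
that this error is `O(N^{-β})` (`exists_kernelError_le`) and that `‖D‖_p` is `O(N^{β-γ}) ‖P‖_H`
(`exists_eLpNorm_expansion_le`); the powers multiply to `N^{-γ}`.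

Both estimates cut a multiplier, `b` or `1/b`, into smooth dyadic pieces. A piece of order `σ` at
frequency `M` has a kernel bounded by `M^σ · M^q (1 + Mρ)^{-S}` (`exists_bump_kernel_le`), with `L¹`
norm `O(M^σ)` because `S > q`. For a quadrature measure the frequencies below `N` drop out. The
piece at `N 2^j` contributes `(N 2^j)^{-β}` in `L¹`, and `2^{jq}` times more in the supremum norm,
since `ν` is regular only down to scale `1/N`. Interpolation gives `N^{-β} 2^{j(q/p-β)}` in
`L^{p'}`, summable because `β > q/p`. For `D`, the dyadic operator at frequency `M` applied to `P`
has norm at most `M^β ω_r(P, 1/M)`, hence at most `M^{β-γ} ‖P‖_H`; summed over dyadic `M ≤ N`, the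
top frequency dominates because `γ < β`.

Localization (`exists_localization`) uses only the Gaussian bound. With `v = exp(-λ²/M²)` a piece
becomes `v g(v)`, where `g` is smooth and supported in `[0,1]`. For a given pair `(x,y)`, with `R =
Mρ(x,y)`, `g` is approximated by an entire function of exponential type a small multiple of `R`,
with error `O(R^{-S})` (`exists_entire_approx`). A power series in `v` is a series of heat kernels
at times `(k+1)/M²`, and their Gaussian decay beats the growth of the Taylor coefficients.

Two further facts are extracted from the heat kernel. Since it has total mass one, small balls have
volume at least `c r^q`; this bounds `ρ` and propagates regularity of a measure to larger scales.
Since it is an approximate identity, Fourier coefficients determine an integrable function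
(`ae_eq_zero_of_coef`), which identifies `G`, known only through its coefficients, with its dyadic
series. -/

/-- `f` and its first `k` successive derivatives exist on `U` and are bounded by `B` there. -/
def DerivBdd (U : Set ℝ) (B : ℝ) : ℕ → (ℝ → ℝ) → Prop
  | 0, f => ∀ v ∈ U, |f v| ≤ B
  | k + 1, f => (∀ v ∈ U, |f v| ≤ B) ∧
      ∃ f' : ℝ → ℝ, (∀ v ∈ U, HasDerivAt f (f' v) v) ∧ DerivBdd U B k f'

/-! ### Calculus of functions with boundedly many bounded derivatives. -/

namespace DerivBdd

variable {U V : Set ℝ} {B B' : ℝ} {k : ℕ} {f g : ℝ → ℝ}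

lemma abs_le (h : DerivBdd U B k f) : ∀ v ∈ U, |f v| ≤ B := by
  cases k with
  | zero => exact h
  | succ k => exact h.1

lemma mono (hV : V ⊆ U) (hB : B ≤ B') (h : DerivBdd U B k f) : DerivBdd V B' k f := by
  induction k generalizing f with
  | zero => exact fun v hv => (h v (hV hv)).trans hB
  | succ k ih =>
    obtain ⟨h1, f', h2, h3⟩ := h
    exact ⟨fun v hv => (h1 v (hV hv)).trans hB, f', fun v hv => h2 v (hV hv), ih h3⟩

lemma of_succ (h : DerivBdd U B (k + 1) f) : DerivBdd U B k f := by
  induction k generalizing f with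
  | zero => exact h.1
  | succ k ih =>
    obtain ⟨h1, f', h2, h3⟩ := h
    exact ⟨h1, f', h2, ih h3⟩

lemma add (hf : DerivBdd U B k f) (hg : DerivBdd U B' k g) :
    DerivBdd U (B + B') k (fun v => f v + g v) := by
  induction k generalizing f g with
  | zero => exact fun v hv => (abs_add_le _ _).trans (add_le_add (hf v hv) (hg v hv))
  | succ k ih =>
    obtain ⟨h1, f', h2, h3⟩ := hf
    obtain ⟨h1', g', h2', h3'⟩ := hg
    exact ⟨fun v hv => (abs_add_le _ _).trans (add_le_add (h1 v hv) (h1' v hv)), _,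
      fun v hv => (h2 v hv).add (h2' v hv), ih h3 h3'⟩

/-- By Leibniz each differentiation turns one product into two, which accounts for `2 ^ k`. -/
lemma mul (hB : 0 ≤ B) (hB' : 0 ≤ B') (hf : DerivBdd U B k f) (hg : DerivBdd U B' k g) :
    DerivBdd U (2 ^ k * (B * B')) k (fun v => f v * g v) := by
  induction k generalizing f g with
  | zero =>
    intro v hv
    rw [abs_mul, pow_zero, one_mul]
    exact mul_le_mul (hf v hv) (hg v hv) (abs_nonneg _) hB
  | succ k ih =>
    have hf0 := hf
    have hg0 := hg
    obtain ⟨h1, f', h2, h3⟩ := hf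
    obtain ⟨h1', g', h2', h3'⟩ := hg
    refine ⟨fun v hv => ?_, _, fun v hv => (h2 v hv).mul (h2' v hv), ?_⟩
    · rw [abs_mul]
      refine (mul_le_mul (h1 v hv) (h1' v hv) (abs_nonneg _) hB).trans ?_
      exact le_mul_of_one_le_left (by positivity) (one_le_pow₀ (by norm_num))
    · have := (ih h3 hg0.of_succ).add (ih hf0.of_succ h3')
      convert this using 1
      ring

lemma congr (h : DerivBdd U B k f) (hU : IsOpen U) (hfg : ∀ v ∈ U, g v = f v) :
    DerivBdd U B k g := by
  cases k with
  | zero => exact fun v hv => by rw [hfg v hv]; exact h v hv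
  | succ k =>
    obtain ⟨h1, f', h2, h3⟩ := h
    refine ⟨fun v hv => by rw [hfg v hv]; exact h1 v hv, f', fun v hv => ?_, h3⟩
    refine (h2 v hv).congr_of_eventuallyEq ?_
    filter_upwards [hU.mem_nhds hv] with x hx using hfg x hx

/-- Extension by zero. -/
lemma extend (hB : 0 ≤ B) (h : DerivBdd U B k f) (hU : IsOpen U) {T : Set ℝ} (hT : IsClosed T)
    (hTU : T ⊆ U) (hf : ∀ v, v ∉ T → f v = 0) : DerivBdd Set.univ B k f := by
  induction k generalizing f with
  | zero =>
    intro v _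
    by_cases hv : v ∈ T
    · exact h v (hTU hv)
    · rw [hf v hv, abs_zero]; exact hB
  | succ k ih =>
    classical
    obtain ⟨h1, f', h2, h3⟩ := h
    refine ⟨fun v _ => ?_, U.indicator f', fun v _ => ?_, ih ?_ ?_⟩
    · by_cases hv : v ∈ T
      · exact h1 v (hTU hv)
      · rw [hf v hv, abs_zero]; exact hB
    · by_cases hv : v ∈ U
      · rw [Set.indicator_of_mem hv]; exact h2 v hv
      · rw [Set.indicator_of_notMem hv]
        have hvT : v ∈ Tᶜ := fun h => hv (hTU h)
        refine (hasDerivAt_const v (0 : ℝ)).congr_of_eventuallyEq ?_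
        filter_upwards [hT.isOpen_compl.mem_nhds hvT] with x hx using hf x hx
    · exact h3.congr hU fun v hv => Set.indicator_of_mem hv _
    · intro v hv
      by_cases hvU : v ∈ U
      · rw [Set.indicator_of_mem hvU]
        refine (h2 v hvU).unique ((hasDerivAt_const v (0 : ℝ)).congr_of_eventuallyEq ?_)
        filter_upwards [hT.isOpen_compl.mem_nhds hv] with x hx using hf x hx
      · exact Set.indicator_of_notMem hvU _

lemma exists_of_contDiffOn {O K : Set ℝ} (hO : IsOpen O) (hK : IsCompact K) (hKO : K ⊆ O)
    (hf : ContDiffOn ℝ (⊤ : ℕ∞) f O) (k : ℕ) : ∃ B, 0 ≤ B ∧ DerivBdd K B k f := by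
  induction k generalizing f with
  | zero =>
    obtain ⟨C, hC⟩ := hK.exists_bound_of_continuousOn (hf.continuousOn.mono hKO)
    exact ⟨max C 0, le_max_right _ _, fun v hv => (hC v hv).trans (le_max_left _ _)⟩
  | succ k ih =>
    obtain ⟨C, hC⟩ := hK.exists_bound_of_continuousOn (hf.continuousOn.mono hKO)
    obtain ⟨B, hB, h⟩ := ih (f := deriv f) ((contDiffOn_infty_iff_deriv_of_isOpen hO).1 hf).2
    refine ⟨max C B, hB.trans (le_max_right _ _), fun v hv => (hC v hv).trans (le_max_left _ _),
      deriv f, fun v hv => ?_, h.mono subset_rfl (le_max_right _ _)⟩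
    exact ((hf.differentiableOn (by simp)).differentiableAt
      (hO.mem_nhds (hKO hv))).hasDerivAt

/-- The mean value inequality trades one order of differentiability for a factor `|w|`. Differences
commute with derivatives, so the remaining orders survive and the step can be iterated. -/
lemma fwdDiff (h : DerivBdd Set.univ B (k + 1) f) (w : ℝ) :
    DerivBdd Set.univ (|w| * B) k (fwdDiff w f) := by
  have key : ∀ {f f' : ℝ → ℝ}, (∀ v ∈ Set.univ, HasDerivAt f (f' v) v) →
      (∀ v ∈ Set.univ, |f' v| ≤ B) → ∀ v, |_root_.fwdDiff w f v| ≤ |w| * B := by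
    intro f f' h1 h2 v
    have := Convex.norm_image_sub_le_of_norm_hasDerivWithin_le (f := f) (f' := f') (s := Set.univ)
      (C := B) (x := v) (y := v + w) (fun x hx => (h1 x hx).hasDerivWithinAt) h2
      convex_univ (Set.mem_univ _) (Set.mem_univ _)
    simpa [_root_.fwdDiff, mul_comm] using this
  induction k generalizing f with
  | zero =>
    obtain ⟨h1, f', h2, h3⟩ := h
    exact fun v _ => key h2 h3 v
  | succ k ih =>
    obtain ⟨h1, f', h2, h3⟩ := h
    refine ⟨fun v _ => key h2 h3.abs_le v, _root_.fwdDiff w f', fun v _ => ?_, ih h3⟩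
    exact ((h2 (v + w) trivial).comp_add_const v w).sub (h2 v trivial)

lemma abs_fwdDiff_iter_le (h : DerivBdd Set.univ B k f) (w v : ℝ) :
    |(_root_.fwdDiff w)^[k] f v| ≤ |w| ^ k * B := by
  induction k generalizing f B with
  | zero => simpa using h v trivial
  | succ k ih =>
    rw [Function.iterate_succ_apply]
    refine (ih (h.fwdDiff w)).trans_eq ?_
    ring

lemma continuous (h : DerivBdd Set.univ B (k + 1) f) : Continuous f := by
  obtain ⟨_, f', h2, _⟩ := h
  exact continuous_iff_continuousAt.2 fun v => (h2 v trivial).continuousAt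

end DerivBdd

/-! ### Approximation by entire functions of exponential type. -/

open scoped FourierTransform SchwartzMap

lemma fourier_comp_affine (g : ℝ → ℂ) {a : ℝ} (ha : 0 < a) (v s : ℝ) :
    𝓕 (fun ξ : ℝ => g (v + a * ξ)) s =
      (a⁻¹ : ℝ) * (Complex.exp ((2 * Real.pi * (v * s / a) : ℝ) * Complex.I) * 𝓕 g (s / a)) := by
  have h1 : ∀ ξ : ℝ, Complex.exp (↑(-2 * Real.pi * ξ * s) * Complex.I) • g (v + a * ξ) =
      (fun z : ℝ => Complex.exp ((2 * Real.pi * (v * s / a) : ℝ) * Complex.I) *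
        (Complex.exp (↑(-2 * Real.pi * z * (s / a)) * Complex.I) • g z)) (v + a * ξ) := by
    intro ξ
    simp only [smul_eq_mul]
    rw [← mul_assoc, ← Complex.exp_add]
    congr 2
    rw [← add_mul, ← Complex.ofReal_add]
    congr 2
    field_simp
    ring
  rw [Real.fourier_real_eq_integral_exp_smul, Real.fourier_real_eq_integral_exp_smul,
    ← integral_const_mul]
  simp_rw [h1]
  rw [Measure.integral_comp_mul_left (fun y => (fun z : ℝ =>
      Complex.exp ((2 * Real.pi * (v * s / a) : ℝ) * Complex.I) *
        (Complex.exp (↑(-2 * Real.pi * z * (s / a)) * Complex.I) • g z)) (v + y)) a,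
    integral_add_left_eq_self (fun z : ℝ =>
      Complex.exp ((2 * Real.pi * (v * s / a) : ℝ) * Complex.I) *
        (Complex.exp (↑(-2 * Real.pi * z * (s / a)) * Complex.I) • g z)) v,
    abs_of_pos (inv_pos.2 ha)]
  rfl

/-- The Fourier transform is self-adjoint for the bilinear pairing. Moving it from `χ` to `g` leaves
`v` only inside an exponential. -/
lemma integral_fourier_mul_comp_affine (χ : 𝓢(ℝ, ℂ)) {g : ℝ → ℂ} (hg : Integrable g) {a : ℝ}
    (ha : 0 < a) (v : ℝ) :
    ∫ ξ, 𝓕 (χ : ℝ → ℂ) ξ * g (v + a * ξ) = ∫ s, χ s * ((a⁻¹ : ℝ) *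
      (Complex.exp ((2 * Real.pi * (v * s / a) : ℝ) * Complex.I) * 𝓕 g (s / a))) := by
  have hint : Integrable (fun ξ : ℝ => g (v + a * ξ)) :=
    (hg.comp_add_left v).comp_mul_left' ha.ne'
  have := VectorFourier.integral_fourierIntegral_smul_eq_flip (L := innerₗ ℝ)
    Real.continuous_fourierChar continuous_inner (χ.integrable (μ := volume)) hint
  rw [flip_innerₗ] at this
  simp only [smul_eq_mul] at this
  refine this.trans ?_
  congr 1
  ext s
  rw [← fourier_comp_affine g ha v s]
  rfl

/-- Mollifying by the transform of a function supported in `[-1, 1]` is band limiting. After the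
Fourier transform is moved to `g`, `v` enters through `exp(2πi v s / a)` with `|s| ≤ 1`, so the
exponential series integrates term by term to an entire function of type `2π / a`. -/
lemma hasSum_integral_fourier_mul_comp_affine (χ : 𝓢(ℝ, ℂ)) (hχ : ∀ s, 1 < |s| → χ s = 0)
    {g : ℝ → ℂ} (hg : Integrable g) {G : ℝ} (hG : ∫ z, ‖g z‖ ≤ G) {a : ℝ} (ha : 0 < a) :
    ∃ A : ℕ → ℂ, (∀ k, ‖A k‖ ≤ (∫ s, ‖χ s‖) * G * a⁻¹ * (2 * Real.pi * a⁻¹) ^ k / k.factorial) ∧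
      ∀ v : ℝ, HasSum (fun k => A k * (v : ℂ) ^ k) (∫ ξ, 𝓕 (χ : ℝ → ℂ) ξ * g (v + a * ξ)) := by
  have hpi := Real.pi_pos
  have hFc : Continuous (𝓕 g) :=
    VectorFourier.fourierIntegral_continuous Real.continuous_fourierChar continuous_inner hg
  have hFb : ∀ w, ‖𝓕 g w‖ ≤ G := fun w =>
    (VectorFourier.norm_fourierIntegral_le_integral_norm _ _ _ _ _).trans hG
  have hG0 : 0 ≤ G := (norm_nonneg _).trans (hFb 0)
  set T : ℕ → ℝ → ℂ := fun k s => χ s * ((a⁻¹ : ℝ) *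
      (((2 * Real.pi * (s / a) : ℝ) * Complex.I) ^ k / k.factorial * 𝓕 g (s / a))) with hT
  have hTc : ∀ k, Continuous (T k) := by
    intro k
    have := χ.continuous
    simp only [hT]
    fun_prop
  have hTb : ∀ k s, ‖T k s‖ ≤ ‖χ s‖ * (G * a⁻¹ * (2 * Real.pi * a⁻¹) ^ k / k.factorial) := by
    intro k s
    by_cases hs : 1 < |s|
    · simp [hT, hχ s hs]
    · push Not at hs
      rw [hT]
      simp only [norm_mul, norm_div, norm_pow, Complex.norm_I, mul_one, Complex.norm_real,
        Complex.norm_natCast]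
      refine mul_le_mul_of_nonneg_left ?_ (norm_nonneg _)
      have e1 : ‖a⁻¹‖ = a⁻¹ := by rw [Real.norm_eq_abs, abs_of_pos (inv_pos.2 ha)]
      have e2 : ‖(2 : ℝ)‖ * ‖Real.pi‖ * (‖s‖ / ‖a‖) ≤ 2 * Real.pi * a⁻¹ := by
        rw [Real.norm_eq_abs, Real.norm_eq_abs, Real.norm_eq_abs, Real.norm_eq_abs,
          abs_of_pos hpi, abs_of_pos ha, abs_two, div_eq_mul_inv]
        have : 0 < a⁻¹ := inv_pos.2 ha
        gcongr
        nlinarith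
      rw [e1]
      calc a⁻¹ * ((‖(2 : ℝ)‖ * ‖Real.pi‖ * (‖s‖ / ‖a‖)) ^ k / k.factorial * ‖𝓕 g (s / a)‖)
          ≤ a⁻¹ * ((2 * Real.pi * a⁻¹) ^ k / k.factorial * G) := by
            gcongr
            exact hFb _
        _ = _ := by ring
  have hTi : ∀ k, Integrable (T k) := fun k =>
    ((χ.integrable (μ := volume)).norm.mul_const _).mono' (hTc k).aestronglyMeasurable
      (Eventually.of_forall (hTb k))
  have hTint : ∀ k, ∫ s, ‖T k s‖ ≤
      (∫ s, ‖χ s‖) * G * a⁻¹ * (2 * Real.pi * a⁻¹) ^ k / k.factorial := by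
    intro k
    refine (integral_mono (hTi k).norm ((χ.integrable (μ := volume)).norm.mul_const _)
      (hTb k)).trans_eq ?_
    rw [integral_mul_const]
    ring
  refine ⟨fun k => ∫ s, T k s, fun k => (norm_integral_le_integral_norm _).trans (hTint k), ?_⟩
  intro v
  rw [integral_fourier_mul_comp_affine χ hg ha v]
  have hsum : Summable fun k => ∫ s, ‖T k s * (v : ℂ) ^ k‖ := by
    have hexp : Summable fun k : ℕ => (∫ s, ‖χ s‖) * G * a⁻¹ *
        ((2 * Real.pi * a⁻¹ * |v|) ^ k / k.factorial) :=
      (Real.summable_pow_div_factorial _).mul_left _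
    refine hexp.of_nonneg_of_le (fun k => integral_nonneg fun s => norm_nonneg _) fun k => ?_
    simp only [norm_mul, norm_pow, Complex.norm_real, Real.norm_eq_abs]
    rw [integral_mul_const]
    refine (mul_le_mul_of_nonneg_right (hTint k) (by positivity)).trans_eq ?_
    rw [mul_pow _ (|v|)]
    ring
  have := hasSum_integral_of_summable_integral_norm
    (F := fun k s => T k s * (v : ℂ) ^ k) (fun k => (hTi k).mul_const _) hsum
  simp only [integral_mul_const] at this
  have hEq : ∀ s, χ s * ((a⁻¹ : ℝ) * (Complex.exp ((2 * Real.pi * (v * s / a) : ℝ) * Complex.I) *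
      𝓕 g (s / a))) = ∑' k, T k s * (v : ℂ) ^ k := by
    intro s
    refine HasSum.tsum_eq ?_ |>.symm
    have h1 := NormedSpace.expSeries_div_hasSum_exp
      (((2 * Real.pi * (v * s / a) : ℝ) : ℂ) * Complex.I)
    rw [← Complex.exp_eq_exp_ℂ] at h1
    refine ((((h1.mul_right (𝓕 g (s / a))).mul_left ((a⁻¹ : ℝ) : ℂ))).mul_left (χ s)).congr_fun ?_
    intro k
    simp only [hT]
    have : (((2 * Real.pi * (v * s / a) : ℝ) : ℂ) * Complex.I) ^ k =
        (((2 * Real.pi * (s / a) : ℝ) : ℂ) * Complex.I) ^ k * (v : ℂ) ^ k := by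
      rw [← mul_pow]
      push_cast
      ring
    rw [this]
    ring
  simp_rw [hEq]
  exact this

/-- Jackson type approximation of a function supported in `[0, 1]` by an entire function of
exponential type proportional to `D`. -/
lemma exists_entire_approx (S : ℕ) (hS : 1 ≤ S) : ∃ C : ℝ, 0 < C ∧ ∀ (B : ℝ) (f : ℝ → ℝ),
    DerivBdd Set.univ B S f → (∀ v, v ∉ Set.Icc (0 : ℝ) 1 → f v = 0) → ∀ D : ℝ, 0 < D →
    ∃ A : ℕ → ℝ, (∀ k, |A k| ≤ C * B * D * (2 * Real.pi * D) ^ k / k.factorial) ∧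
      ∀ v, |f v - ∑' k, A k * v ^ k| ≤ C * B * (D ^ S)⁻¹ := by
  obtain ⟨m, rfl⟩ : ∃ m, S = m + 1 := ⟨S - 1, by omega⟩
  -- The value `1` at the origin makes the mollifier `𝓕 χ` have integral one; the support in `[-1,
  -- 1]` controls the exponential type.
  let χ0 : ContDiffBump (0 : ℝ) := ⟨1 / 2, 1, by norm_num, by norm_num⟩
  have hc1 : HasCompactSupport (fun s : ℝ => ((χ0 s : ℝ) : ℂ)) :=
    χ0.hasCompactSupport.comp_left (g := fun x : ℝ => (x : ℂ)) Complex.ofReal_zero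
  have hc2 : ContDiff ℝ (⊤ : ℕ∞) (fun s : ℝ => ((χ0 s : ℝ) : ℂ)) :=
    Complex.ofRealCLM.contDiff.comp χ0.contDiff
  let χ : 𝓢(ℝ, ℂ) := hc1.toSchwartzMap hc2
  have hχ : ∀ s, χ s = ((χ0 s : ℝ) : ℂ) := fun s => rfl
  have hχ0 : ∀ s, 1 < |s| → χ s = 0 := by
    intro s hs
    rw [hχ, χ0.zero_of_le_dist (by simpa [χ0] using hs.le)]
    rfl
  have hF : (𝓕 (χ : ℝ → ℂ)) = ⇑(𝓕 χ : 𝓢(ℝ, ℂ)) := SchwartzMap.fourier_coe χ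
  have hF1 : ∫ ξ, 𝓕 (χ : ℝ → ℂ) ξ = 1 := by
    have h1 := congrFun (Continuous.fourierInv_fourier_eq χ.continuous χ.integrable
      (by rw [hF]; exact (𝓕 χ : 𝓢(ℝ, ℂ)).integrable)) 0
    rw [Real.fourierInv_eq'] at h1
    have h2 : χ 0 = 1 := by
      rw [hχ, χ0.one_of_mem_closedBall (by simp [χ0])]
      rfl
    rw [h2] at h1
    simpa using h1
  set I1 := ∫ s, ‖χ s‖
  set I2 := ∫ ξ, ‖ξ‖ ^ (m + 1) * ‖𝓕 (χ : ℝ → ℂ) ξ‖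
  have hI1 : 0 ≤ I1 := integral_nonneg fun _ => norm_nonneg _
  have hI2 : 0 ≤ I2 := integral_nonneg fun _ => by positivity
  have hI2i : Integrable fun ξ : ℝ => ‖ξ‖ ^ (m + 1) * ‖𝓕 (χ : ℝ → ℂ) ξ‖ := by
    rw [hF]; exact (𝓕 χ : 𝓢(ℝ, ℂ)).integrable_pow_mul volume (m + 1)
  have hFi : Integrable (𝓕 (χ : ℝ → ℂ)) := by rw [hF]; exact (𝓕 χ : 𝓢(ℝ, ℂ)).integrable
  refine ⟨I1 * 2 ^ (m + 1) + I2 + 1, by positivity, ?_⟩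
  intro B f hf hsupp D hD
  have hfc : Continuous f := hf.continuous
  have hB : 0 ≤ B := (abs_nonneg _).trans (hf.abs_le 0 trivial)
  have hfcs : HasCompactSupport f := by
    refine HasCompactSupport.intro (isCompact_Icc (a := (0 : ℝ)) (b := 1)) hsupp
  have hfi : Integrable (fun v => (f v : ℂ)) := (hfc.integrable_of_hasCompactSupport hfcs).ofReal
  have hfB : ∫ z, ‖(f z : ℂ)‖ ≤ B := by
    have e : (fun z => ‖(f z : ℂ)‖) = (Set.Icc (0 : ℝ) 1).indicator fun z => |f z| := by
      ext z
      by_cases hz : z ∈ Set.Icc (0 : ℝ) 1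
      · rw [Set.indicator_of_mem hz, Complex.norm_real, Real.norm_eq_abs]
      · rw [Set.indicator_of_notMem hz, hsupp z hz]; simp
    rw [e, integral_indicator measurableSet_Icc]
    have := norm_setIntegral_le_of_norm_le_const (μ := volume) (s := Set.Icc (0 : ℝ) 1)
      (f := fun z => |f z|) (C := B) (by simp) (fun z _ => by
        rw [Real.norm_eq_abs, abs_abs]; exact hf.abs_le z trivial)
    refine (le_abs_self _).trans (this.trans_eq ?_)
    simp
  have hpos : ∀ i : ℕ, 0 < ((i : ℝ) + 1) / D := fun i => by positivity
  choose A hA1 hA2 using fun i : ℕ =>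
    hasSum_integral_fourier_mul_comp_affine χ hχ0 hfi hfB (hpos i)
  have hAk : ∀ i k, ‖A i k‖ ≤ I1 * B * D * (2 * Real.pi * D) ^ k / k.factorial := by
    intro i k
    refine (hA1 i k).trans ?_
    have : (((i : ℝ) + 1) / D)⁻¹ ≤ D := by
      rw [inv_div]
      exact div_le_self hD.le (by linarith [Nat.cast_nonneg (α := ℝ) i])
    have h0 : 0 ≤ (((i : ℝ) + 1) / D)⁻¹ := (inv_pos.2 (hpos i)).le
    have := Real.pi_pos
    gcongr
  -- Jackson's combination: `f v` minus `∑ c i * f (v + (i+1) z)` is, up to sign, the `(m+1)`-st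
  -- difference of `f` with step `z`. The term of the binomial sum with shift zero is `f v` itself,
  -- hence the shift of index. The dilations `(i+1) / D` all give type at most `2πD`.
  let c : ℕ → ℝ := fun i => -((-1) ^ (i + 1) * ((m + 1).choose (i + 1)))
  have hcabs : ∑ i ∈ Finset.range (m + 1), |c i| ≤ 2 ^ (m + 1) := by
    have h := Nat.sum_range_choose (m + 1)
    have h' : ∑ i ∈ Finset.range (m + 1 + 1), (((m + 1).choose i : ℕ) : ℝ) = 2 ^ (m + 1) := by
      exact_mod_cast h
    rw [← h', Finset.sum_range_succ' _ (m + 1)]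
    simp only [c, abs_neg, abs_mul, abs_pow, abs_one, one_pow, one_mul, Nat.abs_cast]
    simp
  refine ⟨fun k => ∑ i ∈ Finset.range (m + 1), c i * (A i k).re, fun k => ?_, fun v => ?_⟩
  · calc |∑ i ∈ Finset.range (m + 1), c i * (A i k).re|
        ≤ ∑ i ∈ Finset.range (m + 1), |c i * (A i k).re| := Finset.abs_sum_le_sum_abs _ _
      _ ≤ ∑ i ∈ Finset.range (m + 1), |c i| *
            (I1 * B * D * (2 * Real.pi * D) ^ k / k.factorial) := by
          refine Finset.sum_le_sum fun i _ => ?_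
          rw [abs_mul]
          exact mul_le_mul_of_nonneg_left ((Complex.abs_re_le_norm _).trans (hAk i k))
            (abs_nonneg _)
      _ ≤ 2 ^ (m + 1) * (I1 * B * D * (2 * Real.pi * D) ^ k / k.factorial) := by
          rw [← Finset.sum_mul]
          have := Real.pi_pos
          gcongr
      _ = (I1 * 2 ^ (m + 1)) * (B * D * (2 * Real.pi * D) ^ k / k.factorial) := by ring
      _ ≤ (I1 * 2 ^ (m + 1) + I2 + 1) * (B * D * (2 * Real.pi * D) ^ k / k.factorial) := by
          have := Real.pi_pos
          refine mul_le_mul_of_nonneg_right (by linarith) (by positivity)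
      _ = _ := by ring
  · -- the approximant as an integral
    have hsum : HasSum (fun k => (∑ i ∈ Finset.range (m + 1), c i * (A i k).re) * v ^ k)
        (∑ i ∈ Finset.range (m + 1), c i *
          (∫ ξ, 𝓕 (χ : ℝ → ℂ) ξ * (f (v + ((i : ℝ) + 1) / D * ξ) : ℂ)).re) := by
      have h1 : ∀ i ∈ Finset.range (m + 1), HasSum (fun k => c i * ((A i k).re * v ^ k))
          (c i * (∫ ξ, 𝓕 (χ : ℝ → ℂ) ξ * (f (v + ((i : ℝ) + 1) / D * ξ) : ℂ)).re) := by
        intro i _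
        have := (Complex.hasSum_re (hA2 i v)).mul_left (c i)
        refine this.congr_fun fun k => ?_
        rw [← Complex.ofReal_pow, Complex.re_mul_ofReal]
      refine (hasSum_sum h1).congr_fun fun k => ?_
      rw [Finset.sum_mul]
      exact Finset.sum_congr rfl fun i _ => by ring
    rw [hsum.tsum_eq]
    have hint : ∀ i : ℕ, Integrable fun ξ : ℝ => 𝓕 (χ : ℝ → ℂ) ξ * (f (v + i / D * ξ) : ℂ) := by
      intro i
      refine hFi.mul_bdd (c := B) ?_ (Eventually.of_forall fun ξ => ?_)
      · exact (Complex.continuous_ofReal.comp (hfc.comp (by fun_prop))).aestronglyMeasurable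
      · rw [Complex.norm_real]; exact hf.abs_le _ trivial
    -- The error is an average of differences of order `m + 1` with step `ξ / D`. Each is `O((|ξ| /
    -- D)^(m+1))`, and the moment of `𝓕 χ` is finite because `𝓕 χ` is Schwartz.
    have hkey : (f v : ℂ) - ∑ i ∈ Finset.range (m + 1), (c i : ℂ) *
          (∫ ξ, 𝓕 (χ : ℝ → ℂ) ξ * (f (v + ((i : ℝ) + 1) / D * ξ) : ℂ)) =
        (-1) ^ (m + 1) * ∫ ξ, 𝓕 (χ : ℝ → ℂ) ξ * (((fwdDiff (ξ / D))^[m + 1] f v : ℝ) : ℂ) := by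
      have e1 : ∀ ξ, 𝓕 (χ : ℝ → ℂ) ξ * (((fwdDiff (ξ / D))^[m + 1] f v : ℝ) : ℂ) =
          ∑ i ∈ Finset.range (m + 1 + 1), ((-1) ^ (m + 1 - i) * ((m + 1).choose i) : ℂ) *
            (𝓕 (χ : ℝ → ℂ) ξ * (f (v + (i : ℝ) / D * ξ) : ℂ)) := by
        intro ξ
        rw [fwdDiff_iter_eq_sum_shift, Complex.ofReal_sum, Finset.mul_sum]
        refine Finset.sum_congr rfl fun i _ => ?_
        have : v + i • (ξ / D) = v + (i : ℝ) / D * ξ := by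
          rw [nsmul_eq_mul]; ring
        rw [this, zsmul_eq_mul]
        push_cast
        ring
      simp_rw [e1]
      rw [integral_finsetSum _ fun i _ => (hint i).const_mul _]
      simp_rw [integral_const_mul]
      rw [Finset.sum_range_succ' _ (m + 1)]
      have e0 : ∫ ξ, 𝓕 (χ : ℝ → ℂ) ξ * (f (v + ((0 : ℕ) : ℝ) / D * ξ) : ℂ) = f v := by
        simp only [Nat.cast_zero, zero_div, zero_mul, add_zero]
        rw [integral_mul_const, hF1, one_mul]
      rw [e0, mul_add, Finset.mul_sum, sub_eq_add_neg, ← Finset.sum_neg_distrib]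
      refine (add_comm _ _).trans (congrArg₂ (· + ·) ?_ ?_)
      · refine Finset.sum_congr rfl fun i hi => ?_
        have hi' : i + 1 ≤ m + 1 := by simpa [Nat.lt_succ_iff] using hi
        have e2 : ((-1 : ℂ)) ^ (m + 1) * (-1) ^ (m + 1 - (i + 1)) = (-1) ^ (i + 1) := by
          obtain ⟨j, hj⟩ := Nat.exists_eq_add_of_le hi'
          rw [hj, Nat.add_sub_cancel_left, pow_add, mul_assoc, ← mul_pow]
          simp
        rw [← mul_assoc, ← mul_assoc ((-1 : ℂ) ^ (m + 1)), e2]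
        simp only [c]
        push_cast
        ring
      · simp [← mul_assoc, ← mul_pow]
    have hre : f v - ∑ i ∈ Finset.range (m + 1), c i *
          (∫ ξ, 𝓕 (χ : ℝ → ℂ) ξ * (f (v + ((i : ℝ) + 1) / D * ξ) : ℂ)).re =
        ((f v : ℂ) - ∑ i ∈ Finset.range (m + 1), (c i : ℂ) *
          (∫ ξ, 𝓕 (χ : ℝ → ℂ) ξ * (f (v + ((i : ℝ) + 1) / D * ξ) : ℂ))).re := by
      simp [Complex.sub_re, Complex.re_sum]
    rw [hre, hkey]
    refine (Complex.abs_re_le_norm _).trans ?_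
    rw [norm_mul, norm_pow, norm_neg, norm_one, one_pow, one_mul]
    calc ‖∫ ξ, 𝓕 (χ : ℝ → ℂ) ξ * (((fwdDiff (ξ / D))^[m + 1] f v : ℝ) : ℂ)‖
        ≤ ∫ ξ, (‖ξ‖ ^ (m + 1) * ‖𝓕 (χ : ℝ → ℂ) ξ‖) * (B * (D ^ (m + 1))⁻¹) := by
          refine norm_integral_le_of_norm_le (hI2i.mul_const _) (Eventually.of_forall fun ξ => ?_)
          rw [norm_mul, Complex.norm_real, Real.norm_eq_abs]
          refine (mul_le_mul_of_nonneg_left (hf.abs_fwdDiff_iter_le (ξ / D) v)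
            (norm_nonneg _)).trans_eq ?_
          rw [abs_div, abs_of_pos hD, div_pow, Real.norm_eq_abs]
          ring
      _ = I2 * (B * (D ^ (m + 1))⁻¹) := integral_mul_const _ _
      _ ≤ (I1 * 2 ^ (m + 1) + I2 + 1) * (B * (D ^ (m + 1))⁻¹) := by
          refine mul_le_mul_of_nonneg_right ?_ (by positivity)
          have : 0 ≤ I1 * 2 ^ (m + 1) := by positivity
          linarith
      _ = _ := by ring

/-! ### Integrals of localized kernels over dyadic shells. -/

lemma mem_cball {X : Type*} {ρ : X → X → ℝ} {x y : X} {r : ℝ} :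
    y ∈ cball ρ x r ↔ ρ x y ≤ r := Iff.rfl

section Shells

variable {X : Type*} [MeasurableSpace X] {ρ : X → X → ℝ}

/-- Integrals of negative powers of the distance away from a point, against a measure whose balls
have polynomially bounded measure. -/
lemma lintegral_rpow_neg_le {q s : ℝ} (hqs : q < s) (hs : 0 < s) : ∃ C : ℝ, 0 < C ∧
    ∀ (ν : Measure X) (x : X), Measurable (ρ x) → ∀ (R : ℝ≥0∞) (d₀ : ℝ), 0 < d₀ →
      (∀ d, d₀ ≤ d → ν (cball ρ x d) ≤ R * ENNReal.ofReal (d ^ q)) →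
      ∫⁻ y in {y | d₀ < ρ x y}, ENNReal.ofReal (ρ x y ^ (-s)) ∂ν ≤
        ENNReal.ofReal C * R * ENNReal.ofReal (d₀ ^ (q - s)) := by
  have hθ0 : (0 : ℝ) < 2 ^ (q - s) := by positivity
  have hθ1 : (2 : ℝ) ^ (q - s) < 1 :=
    Real.rpow_lt_one_of_one_lt_of_neg (by norm_num) (by linarith)
  refine ⟨2 ^ q * (1 - 2 ^ (q - s))⁻¹, mul_pos (by positivity) (inv_pos.2 (by linarith)), ?_⟩
  intro ν x hx R d₀ hd₀ hν
  -- On the `i`-th shell the integrand is at most `(2^i d₀)^{-s}` and the measure at most `R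
  -- (2^{i+1} d₀)^q`, so the contributions are geometric with ratio `2^{q-s} < 1`.
  let A : ℕ → Set X := fun i => {y | 2 ^ i * d₀ ≤ ρ x y ∧ ρ x y < 2 ^ (i + 1) * d₀}
  have hA : ∀ i, MeasurableSet (A i) := fun i =>
    (measurableSet_le measurable_const hx).inter (measurableSet_lt hx measurable_const)
  have hcov : {y | d₀ < ρ x y} ⊆ ⋃ i, A i := by
    intro y hy
    have hy' : 1 < ρ x y / d₀ := (one_lt_div hd₀).2 hy
    obtain ⟨i, hi1, hi2⟩ := exists_nat_pow_near hy'.le (by norm_num : (1 : ℝ) < 2)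
    refine Set.mem_iUnion.2 ⟨i, ?_, ?_⟩
    · exact (le_div_iff₀ hd₀).1 hi1
    · exact (div_lt_iff₀ hd₀).1 hi2
  have hterm : ∀ i, ∫⁻ y in A i, ENNReal.ofReal (ρ x y ^ (-s)) ∂ν ≤
      R * ENNReal.ofReal (2 ^ q * d₀ ^ (q - s)) * ENNReal.ofReal (2 ^ (q - s)) ^ i := by
    intro i
    have hp : 0 < (2 : ℝ) ^ i * d₀ := by positivity
    calc ∫⁻ y in A i, ENNReal.ofReal (ρ x y ^ (-s)) ∂ν
        ≤ ∫⁻ y in A i, ENNReal.ofReal ((2 ^ i * d₀) ^ (-s)) ∂ν := by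
          refine setLIntegral_mono' (hA i) fun y hy => ENNReal.ofReal_le_ofReal ?_
          exact Real.rpow_le_rpow_of_nonpos hp hy.1 (by linarith)
      _ = ENNReal.ofReal ((2 ^ i * d₀) ^ (-s)) * ν (A i) := setLIntegral_const _ _
      _ ≤ ENNReal.ofReal ((2 ^ i * d₀) ^ (-s)) *
            (R * ENNReal.ofReal ((2 ^ (i + 1) * d₀) ^ q)) := by
          gcongr
          refine (measure_mono fun y hy => mem_cball.2 hy.2.le).trans (hν _ ?_)
          exact le_mul_of_one_le_left hd₀.le (one_le_pow₀ (by norm_num))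
      _ = R * ENNReal.ofReal ((2 ^ i * d₀) ^ (-s) * (2 ^ (i + 1) * d₀) ^ q) := by
          rw [ENNReal.ofReal_mul (by positivity)]; ring
      _ = _ := by
          rw [← ENNReal.ofReal_pow hθ0.le, mul_assoc, ← ENNReal.ofReal_mul (by positivity)]
          congr 2
          rw [pow_succ, mul_assoc, mul_left_comm, Real.mul_rpow (by norm_num) hp.le,
            mul_left_comm, ← Real.rpow_add hp, Real.mul_rpow (by positivity) hd₀.le,
            ← Real.rpow_natCast, ← Real.rpow_natCast, ← Real.rpow_mul (by norm_num),
            ← Real.rpow_mul (by norm_num), show -s + q = q - s by ring, mul_comm (i : ℝ)]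
          ring
  calc ∫⁻ y in {y | d₀ < ρ x y}, ENNReal.ofReal (ρ x y ^ (-s)) ∂ν
      ≤ ∫⁻ y in ⋃ i, A i, ENNReal.ofReal (ρ x y ^ (-s)) ∂ν := lintegral_mono_set hcov
    _ ≤ ∑' i, ∫⁻ y in A i, ENNReal.ofReal (ρ x y ^ (-s)) ∂ν := lintegral_iUnion_le _ _
    _ ≤ ∑' i, R * ENNReal.ofReal (2 ^ q * d₀ ^ (q - s)) * ENNReal.ofReal (2 ^ (q - s)) ^ i :=
        ENNReal.tsum_le_tsum hterm
    _ = R * ENNReal.ofReal (2 ^ q * d₀ ^ (q - s)) * (1 - ENNReal.ofReal (2 ^ (q - s)))⁻¹ := by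
        rw [ENNReal.tsum_mul_left, ENNReal.tsum_geometric]
    _ = _ := by
        rw [← ENNReal.ofReal_one, ← ENNReal.ofReal_sub _ hθ0.le,
          ← ENNReal.ofReal_inv_of_pos (by linarith), ENNReal.ofReal_mul (by positivity),
          ENNReal.ofReal_mul (by positivity)]
        ring

/-- The model decay of kernels localized at scale `1 / M`. -/
def decay (q s M d : ℝ) : ℝ := M ^ q * (1 + M * d) ^ (-s)

lemma decay_nonneg {q s M d : ℝ} (hM : 0 ≤ M) (hd : 0 ≤ d) : 0 ≤ decay q s M d := by
  unfold decay; positivity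

lemma decay_le_rpow {q s M d : ℝ} (hs : 0 ≤ s) (hM : 0 ≤ M) (hd : 0 ≤ d) :
    decay q s M d ≤ M ^ q := by
  have h1 : (1 + M * d) ^ (-s) ≤ 1 :=
    Real.rpow_le_one_of_one_le_of_nonpos (by nlinarith [mul_nonneg hM hd]) (by linarith)
  exact mul_le_of_le_one_right (by positivity) h1

lemma decay_le_rpow_neg {q s M d : ℝ} (hs : 0 ≤ s) (hM : 0 < M) (hd : 0 < d) :
    decay q s M d ≤ M ^ (q - s) * d ^ (-s) := by
  have h1 : (1 + M * d) ^ (-s) ≤ (M * d) ^ (-s) :=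
    Real.rpow_le_rpow_of_nonpos (by positivity) (by linarith) (by linarith)
  calc decay q s M d ≤ M ^ q * (M * d) ^ (-s) := by unfold decay; gcongr
    _ = _ := by rw [Real.mul_rpow hM.le hd.le, ← mul_assoc, ← Real.rpow_add hM, sub_eq_add_neg]

/-- The scale `d₀` from which `ν` is regular is independent of the localization scale `1 / M`. Off
the ball of radius `d₀` the shell estimate applies; on it the kernel is at most `M^q` and the
measure at most `R d₀^q`. The factor `(M d₀)^q` is the price of localization finer than the
regularity of `ν`. -/
lemma lintegral_decay_le {q s : ℝ} (hqs : q < s) (hq : 0 ≤ q) : ∃ C : ℝ, 0 < C ∧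
    ∀ (ν : Measure X) (x : X), (∀ y, 0 ≤ ρ x y) → Measurable (ρ x) →
      ∀ (R : ℝ≥0∞) (M d₀ : ℝ), 0 < d₀ → 0 < M →
      (∀ d, d₀ ≤ d → ν (cball ρ x d) ≤ R * ENNReal.ofReal (d ^ q)) →
      ∫⁻ y in {y | d₀ < ρ x y}, ENNReal.ofReal (decay q s M (ρ x y)) ∂ν ≤
        ENNReal.ofReal C * R * ENNReal.ofReal ((M * d₀) ^ (q - s)) ∧
      (1 ≤ M * d₀ → ∫⁻ y, ENNReal.ofReal (decay q s M (ρ x y)) ∂ν ≤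
        ENNReal.ofReal C * R * ENNReal.ofReal ((M * d₀) ^ q)) := by
  obtain ⟨C, hC, h⟩ := lintegral_rpow_neg_le (ρ := ρ) hqs (by linarith)
  refine ⟨C + 1, by linarith, fun ν x hρ hx R M d₀ hd₀ hM hν => ?_⟩
  have h1 : ∫⁻ y in {y | d₀ < ρ x y}, ENNReal.ofReal (decay q s M (ρ x y)) ∂ν ≤
      ENNReal.ofReal C * R * ENNReal.ofReal ((M * d₀) ^ (q - s)) := by
    have hms : MeasurableSet {y | d₀ < ρ x y} := measurableSet_lt measurable_const hx
    calc ∫⁻ y in {y | d₀ < ρ x y}, ENNReal.ofReal (decay q s M (ρ x y)) ∂ν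
        ≤ ∫⁻ y in {y | d₀ < ρ x y}, ENNReal.ofReal (M ^ (q - s)) *
            ENNReal.ofReal (ρ x y ^ (-s)) ∂ν := by
          refine setLIntegral_mono' hms fun y hy => ?_
          rw [← ENNReal.ofReal_mul (by positivity)]
          exact ENNReal.ofReal_le_ofReal
            (decay_le_rpow_neg (by linarith) hM (hd₀.trans hy))
      _ = ENNReal.ofReal (M ^ (q - s)) *
            ∫⁻ y in {y | d₀ < ρ x y}, ENNReal.ofReal (ρ x y ^ (-s)) ∂ν := by
          rw [lintegral_const_mul' _ _ ENNReal.ofReal_ne_top]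
      _ ≤ ENNReal.ofReal (M ^ (q - s)) *
            (ENNReal.ofReal C * R * ENNReal.ofReal (d₀ ^ (q - s))) := by
          gcongr
          exact h ν x hx R d₀ hd₀ hν
      _ = _ := by
          rw [Real.mul_rpow hM.le hd₀.le, ENNReal.ofReal_mul (by positivity)]
          ring
  refine ⟨h1.trans ?_, fun hMd => ?_⟩
  · gcongr; linarith
  · have h2 : ∫⁻ y in {y | d₀ < ρ x y}ᶜ, ENNReal.ofReal (decay q s M (ρ x y)) ∂ν ≤
        R * ENNReal.ofReal ((M * d₀) ^ q) := by
      calc ∫⁻ y in {y | d₀ < ρ x y}ᶜ, ENNReal.ofReal (decay q s M (ρ x y)) ∂ν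
          ≤ ∫⁻ y in {y | d₀ < ρ x y}ᶜ, ENNReal.ofReal (M ^ q) ∂ν :=
            lintegral_mono fun y =>
              ENNReal.ofReal_le_ofReal (decay_le_rpow (by linarith) hM.le (hρ y))
        _ = ENNReal.ofReal (M ^ q) * ν {y | d₀ < ρ x y}ᶜ := setLIntegral_const _ _
        _ ≤ ENNReal.ofReal (M ^ q) * (R * ENNReal.ofReal (d₀ ^ q)) := by
            gcongr
            refine (measure_mono ?_).trans (hν d₀ le_rfl)
            intro y hy
            simpa [mem_cball] using hy
        _ = _ := by
            rw [Real.mul_rpow hM.le hd₀.le, ENNReal.ofReal_mul (by positivity)]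
            ring
    rw [← lintegral_add_compl _ (measurableSet_lt measurable_const hx : MeasurableSet
      {y | d₀ < ρ x y})]
    calc _ ≤ ENNReal.ofReal C * R * ENNReal.ofReal ((M * d₀) ^ q) +
          R * ENNReal.ofReal ((M * d₀) ^ q) := by
            refine add_le_add (h1.trans ?_) h2
            gcongr
            linarith
      _ = _ := by
            rw [ENNReal.ofReal_add hC.le zero_le_one, ENNReal.ofReal_one]
            ring

end Shells

/-- Powers of `1 + u` are dominated by `exp(1 + u)`, and completing the square gives `u ≤ κ u² +
1/(4κ)`. -/
lemma exists_exp_neg_sq_le {κ : ℝ} (hκ : 0 < κ) (s : ℝ) : ∃ C : ℝ, 0 < C ∧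
    ∀ u : ℝ, 0 ≤ u → Real.exp (-κ * u ^ 2) ≤ C * (1 + u) ^ (-s) := by
  obtain ⟨n, hn⟩ := exists_nat_ge s
  refine ⟨n.factorial * Real.exp (1 + 1 / (4 * κ)), by positivity, fun u hu => ?_⟩
  have h1 : (1 + u) ^ s ≤ (1 + u) ^ n := by
    rw [← Real.rpow_natCast]
    exact Real.rpow_le_rpow_of_exponent_le (by linarith) hn
  have h2 : (1 + u) ^ n ≤ n.factorial * Real.exp (1 + u) := by
    have := Real.pow_div_factorial_le_exp (1 + u) (by linarith) n
    rw [div_le_iff₀ (by positivity)] at this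
    linarith
  have h3 : Real.exp (1 + u) ≤ Real.exp (1 + 1 / (4 * κ)) * Real.exp (κ * u ^ 2) := by
    rw [← Real.exp_add]
    refine Real.exp_le_exp.2 ?_
    have : 0 ≤ κ * (u - 1 / (2 * κ)) ^ 2 := by positivity
    have e : κ * (u - 1 / (2 * κ)) ^ 2 = κ * u ^ 2 - u + 1 / (4 * κ) := by
      field_simp; ring
    linarith
  have hu1 : 0 < (1 + u) ^ s := Real.rpow_pos_of_pos (by linarith) _
  rw [Real.rpow_neg (by linarith), ← div_eq_mul_inv, le_div_iff₀ hu1, neg_mul, Real.exp_neg]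
  have hE : 0 < Real.exp (κ * u ^ 2) := Real.exp_pos _
  rw [inv_mul_le_iff₀ hE]
  calc (1 + u) ^ s ≤ n.factorial * Real.exp (1 + u) := h1.trans h2
    _ ≤ n.factorial * (Real.exp (1 + 1 / (4 * κ)) * Real.exp (κ * u ^ 2)) := by gcongr
    _ = _ := by ring

/-! ### Topology of a data-defined space. -/

namespace IsDataDefinedSpace

variable {X : Type*} [TopologicalSpace X] [MeasurableSpace X]
  {ρ : X → X → ℝ} {μ : Measure X} {lam : ℕ → ℝ} {φ : ℕ → X → ℝ} {q κ₁ κ₂ κ₃ κ₄ : ℝ}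

lemma isOpen_ball (h : IsDataDefinedSpace ρ μ lam φ q κ₁ κ₂ κ₃ κ₄) (x : X) (r : ℝ) :
    IsOpen {y | ρ x y < r} := by
  by_cases hr : 0 < r
  · exact h.basis.isOpen ⟨x, r, hr, rfl⟩
  · have : {y | ρ x y < r} = ∅ := by
      ext y
      simp only [Set.mem_ofPred_eq, Set.mem_empty_iff_false, iff_false, not_lt]
      exact (not_lt.1 hr).trans (h.quasiMetric.nonneg x y)
    rw [this]
    exact isOpen_empty

lemma kappa₁_pos (h : IsDataDefinedSpace ρ μ lam φ q κ₁ κ₂ κ₃ κ₄) : 0 < κ₁ :=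
  zero_lt_one.trans_le h.quasiMetric.one_le

lemma rho_self (h : IsDataDefinedSpace ρ μ lam φ q κ₁ κ₂ κ₃ κ₄) (x : X) : ρ x x = 0 :=
  (h.quasiMetric.eq_zero_iff x x).2 rfl

lemma t2Space (h : IsDataDefinedSpace ρ μ lam φ q κ₁ κ₂ κ₃ κ₄) : T2Space X := by
  refine ⟨fun x y hxy => ?_⟩
  have hd : 0 < ρ x y := lt_of_le_of_ne (h.quasiMetric.nonneg x y)
    fun e => hxy ((h.quasiMetric.eq_zero_iff x y).1 e.symm)
  have hκ := h.kappa₁_pos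
  refine ⟨_, _, h.isOpen_ball x (ρ x y / (2 * κ₁)), h.isOpen_ball y (ρ x y / (2 * κ₁)), ?_, ?_, ?_⟩
  · simp only [Set.mem_ofPred_eq, h.rho_self]; positivity
  · simp only [Set.mem_ofPred_eq, h.rho_self]; positivity
  · rw [Set.disjoint_left]
    intro z hz1 hz2
    simp only [Set.mem_ofPred_eq] at hz1 hz2
    have h1 := h.quasiMetric.triangle x y z
    rw [h.quasiMetric.symm y z] at hz2
    have h2 : κ₁ * (ρ x z + ρ z y) < κ₁ * (ρ x y / (2 * κ₁) + ρ x y / (2 * κ₁)) := by gcongr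
    have h3 : κ₁ * (ρ x y / (2 * κ₁) + ρ x y / (2 * κ₁)) = ρ x y := by field_simp; norm_num
    linarith

lemma isClosed_cball (h : IsDataDefinedSpace ρ μ lam φ q κ₁ κ₂ κ₃ κ₄) (x : X) (r : ℝ) :
    IsClosed (cball ρ x r) := by
  have := h.t2Space
  rcases lt_trichotomy r 0 with hr | hr | hr
  · have : cball ρ x r = ∅ := by
      ext y
      simp only [cball, Set.mem_ofPred_eq, Set.mem_empty_iff_false, iff_false, not_le]
      exact hr.trans_le (h.quasiMetric.nonneg x y)
    rw [this]; exact isClosed_empty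
  · have : cball ρ x r = {x} := by
      ext y
      simp only [cball, Set.mem_ofPred_eq, Set.mem_singleton_iff, hr]
      rw [eq_comm (a := y), ← h.quasiMetric.eq_zero_iff x y]
      exact ⟨fun h1 => le_antisymm h1 (h.quasiMetric.nonneg x y), fun h1 => h1.le⟩
    rw [this]; exact isClosed_singleton
  · exact (h.ball_compact x r hr).isClosed

/-- The relaxed triangle inequality alone does not give continuity. Upper semicontinuity holds
because open balls are open; lower semicontinuity because closed balls are compact, hence closed, in
a Hausdorff space. -/
lemma continuous_rho (h : IsDataDefinedSpace ρ μ lam φ q κ₁ κ₂ κ₃ κ₄) (x : X) :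
    Continuous (ρ x) := by
  rw [continuous_iff_lower_upperSemicontinuous, lowerSemicontinuous_iff_isOpen_preimage,
    upperSemicontinuous_iff_isOpen_preimage]
  refine ⟨fun r => ?_, fun r => h.isOpen_ball x r⟩
  have : ρ x ⁻¹' Set.Ioi r = (cball ρ x r)ᶜ := by
    ext y; simp [cball]
  rw [this]
  exact (h.isClosed_cball x r).isOpen_compl

/-- A basic open ball containing `x` need not be centred at `x`. Instead, `ρ x` attains a positive
minimum on the compact set of points of the unit ball outside `U`. -/
lemma exists_cball_subset (h : IsDataDefinedSpace ρ μ lam φ q κ₁ κ₂ κ₃ κ₄) {x : X} {U : Set X}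
    (hU : IsOpen U) (hx : x ∈ U) : ∃ ε, 0 < ε ∧ cball ρ x ε ⊆ U := by
  have hK : IsCompact (cball ρ x 1 \ U) := (h.ball_compact x 1 one_pos).diff hU
  rcases (cball ρ x 1 \ U).eq_empty_or_nonempty with he | hne
  · exact ⟨1, one_pos, Set.sdiff_eq_empty.1 he⟩
  · obtain ⟨z, hz, hmin⟩ := hK.exists_isMinOn hne (h.continuous_rho x).continuousOn
    have hpos : 0 < ρ x z := lt_of_le_of_ne (h.quasiMetric.nonneg x z)
      fun e => hz.2 ((h.quasiMetric.eq_zero_iff x z).1 e.symm ▸ hx)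
    refine ⟨min 1 (ρ x z / 2), lt_min one_pos (half_pos hpos), fun y hy => ?_⟩
    by_contra hyU
    have h1 : ρ x z ≤ ρ x y := hmin ⟨mem_cball.2 ((mem_cball.1 hy).trans (min_le_left _ _)), hyU⟩
    have h2 : ρ x y ≤ ρ x z / 2 := (mem_cball.1 hy).trans (min_le_right _ _)
    linarith

lemma nonempty (h : IsDataDefinedSpace ρ μ lam φ q κ₁ κ₂ κ₃ κ₄) : Nonempty X :=
  have := h.prob
  nonempty_of_isProbabilityMeasure μ

/-- The compact balls about a fixed point exhaust the space and have finite nets at every scale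
`1/(k+1)`; the balls about these net points form a countable basis. -/
lemma secondCountableTopology (h : IsDataDefinedSpace ρ μ lam φ q κ₁ κ₂ κ₃ κ₄) :
    SecondCountableTopology X := by
  classical
  obtain ⟨x₀⟩ := h.nonempty
  have hκ := h.kappa₁_pos
  have hpos : ∀ k : ℕ, (0 : ℝ) < 1 / ((k : ℝ) + 1) := fun k => by positivity
  have hfin : ∀ m k : ℕ, ∃ t : Finset X,
      cball ρ x₀ ((m : ℝ) + 1) ⊆ ⋃ d ∈ t, {y | ρ d y < 1 / ((k : ℝ) + 1)} := by
    intro m k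
    obtain ⟨t, _, ht⟩ := (h.ball_compact x₀ ((m : ℝ) + 1) (by positivity)).elim_nhds_subcover
      (fun d => {y | ρ d y < 1 / ((k : ℝ) + 1)}) fun d _ =>
        (h.isOpen_ball d _).mem_nhds (by simpa [h.rho_self] using hpos k)
    exact ⟨t, ht⟩
  choose t ht using hfin
  let 𝓑 : Set (Set X) := ⋃ (m : ℕ) (k : ℕ), (fun d => {y | ρ d y < 1 / ((k : ℝ) + 1)}) '' (t m k)
  have hcount : 𝓑.Countable := Set.countable_iUnion fun m => Set.countable_iUnion fun k =>
    ((t m k).countable_toSet.image _)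
  refine (TopologicalSpace.isTopologicalBasis_of_isOpen_of_nhds (s := 𝓑) ?_ ?_).secondCountableTopology
    hcount
  · intro u hu
    simp only [𝓑, Set.mem_iUnion] at hu
    obtain ⟨m, k, d, _, rfl⟩ := hu
    exact h.isOpen_ball d _
  · intro x U hx hU
    obtain ⟨ε, hε, hεU⟩ := h.exists_cball_subset hU hx
    obtain ⟨k, hk⟩ := exists_nat_gt (2 * κ₁ / ε)
    obtain ⟨m, hm⟩ := exists_nat_ge (ρ x₀ x)
    have hxm : x ∈ cball ρ x₀ ((m : ℝ) + 1) := by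
      simp only [cball, Set.mem_ofPred_eq]; linarith
    obtain ⟨d, hd, hdx⟩ := Set.mem_iUnion₂.1 (ht m k hxm)
    refine ⟨{y | ρ d y < 1 / ((k : ℝ) + 1)}, ?_, hdx, fun y hy => hεU ?_⟩
    · simp only [𝓑, Set.mem_iUnion]
      exact ⟨m, k, d, hd, rfl⟩
    · simp only [Set.mem_ofPred_eq] at hdx hy
      rw [h.quasiMetric.symm d x] at hdx
      have h1 := h.quasiMetric.triangle x y d
      have h2 : κ₁ * (ρ x d + ρ d y) ≤ κ₁ * (1 / ((k : ℝ) + 1) + 1 / ((k : ℝ) + 1)) := by gcongr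
      have h3 : κ₁ * (1 / ((k : ℝ) + 1) + 1 / ((k : ℝ) + 1)) ≤ ε := by
        rw [div_lt_iff₀ hε] at hk
        rw [← add_div, mul_div_assoc', div_le_iff₀ (by positivity)]
        nlinarith
      exact h1.trans (h2.trans h3)

lemma metrizableSpace (h : IsDataDefinedSpace ρ μ lam φ q κ₁ κ₂ κ₃ κ₄) :
    TopologicalSpace.MetrizableSpace X := by
  have := h.t2Space
  have := h.secondCountableTopology
  have : WeaklyLocallyCompactSpace X := ⟨fun x => ⟨cball ρ x 1, h.ball_compact x 1 one_pos, by
    refine mem_of_superset ((h.isOpen_ball x 1).mem_nhds (by simp [h.rho_self])) ?_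
    exact fun y (hy : ρ x y < 1) => mem_cball.2 hy.le⟩⟩
  exact TopologicalSpace.metrizableSpace_of_t3_secondCountable X

variable [BorelSpace X]

/-- Only separate continuity of `ρ` is known; over a second countable metrizable space that suffices
for joint measurability. -/
lemma measurable_uncurry_rho (h : IsDataDefinedSpace ρ μ lam φ q κ₁ κ₂ κ₃ κ₄) :
    Measurable (Function.uncurry ρ) := by
  have := h.secondCountableTopology
  have := h.metrizableSpace
  refine measurable_uncurry_of_continuous_of_measurable (u := ρ) (fun y => ?_) fun x =>
    (h.continuous_rho x).measurable
  have : (fun x => ρ x y) = ρ y := funext fun x => h.quasiMetric.symm x y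
  rw [this]
  exact h.continuous_rho y

lemma measurable_phi (h : IsDataDefinedSpace ρ μ lam φ q κ₁ κ₂ κ₃ κ₄) (k : ℕ) :
    Measurable (φ k) := (h.phi_continuous k).measurable

end IsDataDefinedSpace

/-! ### Elementary properties of the heat kernel. -/

/-- The heat kernel. -/
def heat {X : Type*} (lam : ℕ → ℝ) (φ : ℕ → X → ℝ) (t : ℝ) (x y : X) : ℝ :=
  ∑' k, Real.exp (-(lam k) ^ 2 * t) * φ k x * φ k y

lemma heat_comm {X : Type*} (lam : ℕ → ℝ) (φ : ℕ → X → ℝ) (t : ℝ) (x y : X) :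
    heat lam φ t x y = heat lam φ t y x :=
  tsum_congr fun k => by ring

namespace IsDataDefinedSpace

variable {X : Type*} [TopologicalSpace X] [MeasurableSpace X]
  {ρ : X → X → ℝ} {μ : Measure X} {lam : ℕ → ℝ} {φ : ℕ → X → ℝ} {q κ₁ κ₂ κ₃ κ₄ : ℝ}

/-- The inequality `2|ab| ≤ a² + b²` reduces to the diagonal, where the heat series has nonnegative
terms and its sum is bounded by hypothesis. It serves any multiplier dominated by a heat multiplier.
-/
lemma summable_abs_of_le (h : IsDataDefinedSpace ρ μ lam φ q κ₁ κ₂ κ₃ κ₄) {t : ℝ} (ht : 0 < t)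
    (ht1 : t ≤ 1) {a : ℕ → ℝ} {ε : ℝ} (hε : 0 ≤ ε)
    (ha : ∀ k, |a k| ≤ ε * Real.exp (-(lam k) ^ 2 * t)) (x y : X) :
    (Summable fun k => |a k * φ k x * φ k y|) ∧
      ∑' k, |a k * φ k x * φ k y| ≤ ε * (κ₃ * t ^ (-q / 2)) := by
  have hd : ∀ z : X, (Summable fun k => Real.exp (-(lam k) ^ 2 * t) * φ k z * φ k z) ∧
      ∑' k, Real.exp (-(lam k) ^ 2 * t) * φ k z * φ k z ≤ κ₃ * t ^ (-q / 2) := by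
    intro z
    refine ⟨h.heat_summable t z z ht ht1, ?_⟩
    have := h.heat_gaussian t z z ht ht1
    rw [h.rho_self] at this
    simpa using (le_abs_self _).trans this
  have hs := (((hd x).1.add (hd y).1).mul_left (ε / 2))
  have hle : ∀ k, |a k * φ k x * φ k y| ≤ ε / 2 * (Real.exp (-(lam k) ^ 2 * t) * φ k x * φ k x +
      Real.exp (-(lam k) ^ 2 * t) * φ k y * φ k y) := by
    intro k
    have h1 : |φ k x| * |φ k y| ≤ (φ k x * φ k x + φ k y * φ k y) / 2 := by
      nlinarith [sq_nonneg (|φ k x| - |φ k y|), abs_mul_abs_self (φ k x),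
        abs_mul_abs_self (φ k y)]
    rw [abs_mul, abs_mul, mul_assoc]
    calc |a k| * (|φ k x| * |φ k y|)
        ≤ (ε * Real.exp (-(lam k) ^ 2 * t)) * ((φ k x * φ k x + φ k y * φ k y) / 2) := by
          gcongr
          exact ha k
      _ = _ := by ring
  have hsum := hs.of_nonneg_of_le (fun k => abs_nonneg _) hle
  refine ⟨hsum, (hsum.tsum_le_tsum hle hs).trans ?_⟩
  rw [tsum_mul_left, (hd x).1.tsum_add (hd y).1]
  calc _ ≤ ε / 2 * (κ₃ * t ^ (-q / 2) + κ₃ * t ^ (-q / 2)) := by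
        gcongr
        · exact (hd x).2
        · exact (hd y).2
    _ = _ := by ring

lemma exp_le_exp_of_le {l t t' : ℝ} (htt : t ≤ t') :
    |Real.exp (-l ^ 2 * t')| ≤ 1 * Real.exp (-l ^ 2 * t) := by
  rw [abs_of_pos (Real.exp_pos _), one_mul]
  refine Real.exp_le_exp.2 ?_
  nlinarith [sq_nonneg l]

/-- Heat coefficients decrease in time, so a bound at time `t` persists later, including times `t' >
1` where the hypotheses say nothing. -/
lemma abs_heat_le (h : IsDataDefinedSpace ρ μ lam φ q κ₁ κ₂ κ₃ κ₄) {t t' : ℝ} (ht : 0 < t)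
    (ht1 : t ≤ 1) (htt : t ≤ t') (x y : X) : |heat lam φ t' x y| ≤ κ₃ * t ^ (-q / 2) := by
  obtain ⟨h1, h2⟩ := h.summable_abs_of_le ht ht1 zero_le_one
    (fun k => exp_le_exp_of_le (l := lam k) htt) x y
  rw [one_mul] at h2
  exact (norm_tsum_le_tsum_norm (f := fun k => Real.exp (-(lam k) ^ 2 * t') * φ k x * φ k y)
    h1).trans h2

lemma abs_heat_le_decay (h : IsDataDefinedSpace ρ μ lam φ q κ₁ κ₂ κ₃ κ₄) {C s : ℝ}
    (hC : ∀ u : ℝ, 0 ≤ u → Real.exp (-κ₄ * u ^ 2) ≤ C * (1 + u) ^ (-s)) {M : ℝ} (hM : 1 ≤ M)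
    (x y : X) : |heat lam φ (1 / M ^ 2) x y| ≤ κ₃ * C * decay q s M (ρ x y) := by
  have hM0 : 0 < M := by linarith
  have h1 := h.heat_gaussian (1 / M ^ 2) x y (by positivity)
    (by rw [div_le_one (by positivity)]; exact one_le_pow₀ hM)
  refine h1.trans ?_
  have e1 : (1 / M ^ 2) ^ (-q / 2) = M ^ q := by
    rw [one_div, ← Real.rpow_natCast, ← Real.rpow_neg hM0.le, ← Real.rpow_mul hM0.le]
    congr 1
    push_cast
    ring
  have e2 : -κ₄ * ρ x y ^ 2 / (1 / M ^ 2) = -κ₄ * (M * ρ x y) ^ 2 := by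
    field_simp
  rw [e1, e2]
  have hk := h.kappa₃_pos
  calc κ₃ * M ^ q * Real.exp (-κ₄ * (M * ρ x y) ^ 2)
      ≤ κ₃ * M ^ q * (C * (1 + M * ρ x y) ^ (-s)) := by
        gcongr
        exact hC _ (mul_nonneg hM0.le (h.quasiMetric.nonneg x y))
    _ = _ := by unfold decay; ring

lemma measure_cball_le (h : IsDataDefinedSpace ρ μ lam φ q κ₁ κ₂ κ₃ κ₄) (x : X) {d : ℝ}
    (hd : 0 < d) : μ (cball ρ x d) ≤ ENNReal.ofReal κ₂ * ENNReal.ofReal (d ^ q) := by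
  rw [← ENNReal.ofReal_mul h.kappa₂_pos.le]
  exact h.ball_measure x d hd

variable [BorelSpace X]

lemma integrable_phi_mul (h : IsDataDefinedSpace ρ μ lam φ q κ₁ κ₂ κ₃ κ₄) {f : X → ℝ}
    (hf : Integrable f μ) (k : ℕ) : Integrable (fun y => φ k y * f y) μ := by
  obtain ⟨C, hC⟩ := h.phi_bounded k
  exact hf.bdd_mul (h.measurable_phi k).aestronglyMeasurable
    (Eventually.of_forall fun y => by simpa using hC y)

lemma measurable_heat (h : IsDataDefinedSpace ρ μ lam φ q κ₁ κ₂ κ₃ κ₄) {t : ℝ} (ht : 0 < t)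
    (ht1 : t ≤ 1) : Measurable (Function.uncurry (heat lam φ t)) := by
  refine measurable_of_tendsto_metrizable (f := fun n (z : X × X) =>
    ∑ k ∈ Finset.range n, Real.exp (-(lam k) ^ 2 * t) * φ k z.1 * φ k z.2) (fun n => ?_) ?_
  · refine Finset.measurable_sum _ fun k _ => ?_
    have := h.measurable_phi k
    fun_prop
  · rw [tendsto_pi_nhds]
    exact fun z => (h.heat_summable t z.1 z.2 ht ht1).hasSum.tendsto_sum_nat

lemma integral_heat_mul (h : IsDataDefinedSpace ρ μ lam φ q κ₁ κ₂ κ₃ κ₄) {t : ℝ} (ht : 0 < t)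
    (ht1 : t ≤ 1) {f : X → ℝ} (hf : Integrable f μ) (x : X) :
    ∫ y, heat lam φ t x y * f y ∂μ =
      ∑' k, Real.exp (-(lam k) ^ 2 * t) * φ k x * ∫ y, φ k y * f y ∂μ := by
  have hm : ∀ k, AEStronglyMeasurable
      (fun y => Real.exp (-(lam k) ^ 2 * t) * φ k x * φ k y * f y) μ := fun k => by
    have := (h.integrable_phi_mul hf k).aestronglyMeasurable.const_mul
      (Real.exp (-(lam k) ^ 2 * t) * φ k x)
    simpa [mul_assoc] using this
  have hb := fun y => h.summable_abs_of_le ht ht1 zero_le_one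
    (fun k => exp_le_exp_of_le (l := lam k) (le_refl t)) x y
  have key := integral_tsum (μ := μ)
    (f := fun k y => Real.exp (-(lam k) ^ 2 * t) * φ k x * φ k y * f y) hm ?_
  · simp_rw [tsum_mul_right] at key
    refine key.trans (tsum_congr fun k => ?_)
    rw [← integral_const_mul]
    simp only [mul_assoc]
  · rw [← lintegral_tsum fun k => (hm k).enorm]
    have hle : ∀ y, ∑' k, ‖Real.exp (-(lam k) ^ 2 * t) * φ k x * φ k y * f y‖ₑ ≤
        ENNReal.ofReal (κ₃ * t ^ (-q / 2)) * ‖f y‖ₑ := by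
      intro y
      simp_rw [enorm_mul _ (f y)]
      rw [ENNReal.tsum_mul_right]
      gcongr
      simp_rw [Real.enorm_eq_ofReal_abs]
      rw [← ENNReal.ofReal_tsum_of_nonneg (fun k => abs_nonneg _) (hb y).1]
      exact ENNReal.ofReal_le_ofReal (by simpa using (hb y).2)
    refine ((lintegral_mono hle).trans_lt ?_).ne
    rw [lintegral_const_mul' _ _ ENNReal.ofReal_ne_top]
    exact ENNReal.mul_lt_top ENNReal.ofReal_lt_top hf.2

/-- Orthogonality to `φ 0 = 1` removes every term except `k = 0`, for which `lam 0 = 0`. -/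
lemma integral_heat (h : IsDataDefinedSpace ρ μ lam φ q κ₁ κ₂ κ₃ κ₄) {t : ℝ} (ht : 0 < t)
    (ht1 : t ≤ 1) (x : X) : ∫ y, heat lam φ t x y ∂μ = 1 := by
  have := h.prob
  have h1 := h.integral_heat_mul ht ht1 (integrable_const (1 : ℝ)) x
  simp only [mul_one] at h1
  rw [h1, tsum_eq_single 0]
  · have h2 := h.phi_orthonormal 0 0
    simp only [h.phi_zero, h.lam_zero] at h2 ⊢
    simp
  · intro k hk
    have h2 := h.phi_orthonormal k 0
    simp only [h.phi_zero, mul_one, hk, if_false] at h2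
    rw [h2, mul_zero]

lemma integrable_heat (h : IsDataDefinedSpace ρ μ lam φ q κ₁ κ₂ κ₃ κ₄) {t : ℝ} (ht : 0 < t)
    (ht1 : t ≤ 1) (x : X) : Integrable (heat lam φ t x) μ := by
  have := h.prob
  refine Integrable.of_bound (C := κ₃ * t ^ (-q / 2)) ?_
    (Eventually.of_forall fun y => h.abs_heat_le ht ht1 le_rfl x y)
  exact ((h.measurable_heat ht ht1).comp measurable_prodMk_left).aestronglyMeasurable

/-! ### Volume of balls, boundedness of the quasi-metric, regularity across scales. -/

/-- Balls of radius at most `1` have measure bounded below by a power of the radius. -/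
lemma exists_measure_cball_ge (q κ₂ κ₃ κ₄ : ℝ) (hκ₄ : 0 < κ₄) (hq : 0 < q) (hκ₃ : 0 < κ₃)
    (hκ₂ : 0 < κ₂)
    (ρ : X → X → ℝ) : ∃ c : ℝ, 0 < c ∧ ∀ (μ : Measure X) (lam : ℕ → ℝ) (φ : ℕ → X → ℝ) (κ₁ : ℝ),
    IsDataDefinedSpace ρ μ lam φ q κ₁ κ₂ κ₃ κ₄ → ∀ (x : X) (r : ℝ), 0 < r → r ≤ 1 →
      ENNReal.ofReal (c * r ^ q) ≤ μ (cball ρ x r) := by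
  obtain ⟨Cg, hCg, hg⟩ := exists_exp_neg_sq_le hκ₄ (q + 1)
  obtain ⟨Cd, hCd, hdec⟩ := lintegral_decay_le (ρ := ρ) (q := q) (s := q + 1) (by linarith) hq.le
  set T := κ₃ * Cg * (Cd * κ₂) with hT
  have hT0 : 0 < T := by positivity
  refine ⟨1 / (2 * (κ₃ * Cg) * (2 * T + 1) ^ q), by positivity, ?_⟩
  intro μ lam φ κ₁ h x r hr hr1
  have := h.prob
  -- The mass of the heat kernel at time `1 / M²` outside the ball of radius `r` is at most `T / (M
  -- r)`. This choice of `M` makes it at most `1/2`, so at least half of the total mass one lies in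
  -- the ball, where the kernel is `O(M^q)`.
  set M := (2 * T + 1) / r with hMdef
  have hM1 : 1 ≤ M := by rw [hMdef, one_le_div hr]; linarith
  have hM0 : 0 < M := by linarith
  have hMr : M * r = 2 * T + 1 := by rw [hMdef]; field_simp
  have ht : (0 : ℝ) < 1 / M ^ 2 := by positivity
  have ht1 : 1 / M ^ 2 ≤ 1 := by rw [div_le_one (by positivity)]; exact one_le_pow₀ hM1
  have hρm := (h.continuous_rho x).measurable
  have h1 : (1 : ℝ≥0∞) ≤ ∫⁻ y, ENNReal.ofReal (κ₃ * Cg) *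
      ENNReal.ofReal (decay q (q + 1) M (ρ x y)) ∂μ := by
    calc (1 : ℝ≥0∞) = ‖∫ y, heat lam φ (1 / M ^ 2) x y ∂μ‖ₑ := by
          rw [h.integral_heat ht ht1 x]; simp
      _ ≤ ∫⁻ y, ‖heat lam φ (1 / M ^ 2) x y‖ₑ ∂μ := enorm_integral_le_lintegral_enorm _
      _ ≤ _ := by
          refine lintegral_mono fun y => ?_
          rw [Real.enorm_eq_ofReal_abs, ← ENNReal.ofReal_mul (by positivity)]
          exact ENNReal.ofReal_le_ofReal (h.abs_heat_le_decay hg hM1 x y)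
  rw [lintegral_const_mul' _ _ ENNReal.ofReal_ne_top, ← lintegral_add_compl _
    (measurableSet_lt measurable_const hρm : MeasurableSet {y | r < ρ x y}), mul_add] at h1
  have h2 : ENNReal.ofReal (κ₃ * Cg) *
      ∫⁻ y in {y | r < ρ x y}, ENNReal.ofReal (decay q (q + 1) M (ρ x y)) ∂μ ≤
      ENNReal.ofReal (1 / 2) := by
    calc _ ≤ ENNReal.ofReal (κ₃ * Cg) * (ENNReal.ofReal Cd * ENNReal.ofReal κ₂ *
          ENNReal.ofReal ((M * r) ^ (q - (q + 1)))) := by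
          gcongr
          exact (hdec μ x (h.quasiMetric.nonneg x) hρm _ M r hr hM0 fun d hd =>
            h.measure_cball_le x (hr.trans_le hd)).1
      _ = ENNReal.ofReal (T * (2 * T + 1)⁻¹) := by
          rw [← ENNReal.ofReal_mul hCd.le, ← ENNReal.ofReal_mul (by positivity),
            ← ENNReal.ofReal_mul (by positivity), hMr, sub_add_cancel_left, Real.rpow_neg_one,
            hT]
          congr 1
          ring
      _ ≤ _ := by
          refine ENNReal.ofReal_le_ofReal ?_
          rw [← div_eq_mul_inv, div_le_div_iff₀ (by linarith) (by norm_num)]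
          linarith
  have h3 : ENNReal.ofReal (κ₃ * Cg) *
      ∫⁻ y in {y | r < ρ x y}ᶜ, ENNReal.ofReal (decay q (q + 1) M (ρ x y)) ∂μ ≤
      ENNReal.ofReal (κ₃ * Cg * M ^ q) * μ (cball ρ x r) := by
    rw [ENNReal.ofReal_mul (q := M ^ q) (by positivity), mul_assoc]
    refine mul_le_mul' le_rfl ?_
    calc _ ≤ ∫⁻ y in {y | r < ρ x y}ᶜ, ENNReal.ofReal (M ^ q) ∂μ :=
          lintegral_mono fun y => ENNReal.ofReal_le_ofReal
            (decay_le_rpow (by linarith) hM0.le (h.quasiMetric.nonneg x y))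
      _ = ENNReal.ofReal (M ^ q) * μ {y | r < ρ x y}ᶜ := setLIntegral_const _ _
      _ ≤ _ := by
          gcongr
          intro y hy
          simpa [mem_cball] using hy
  have h4 : ENNReal.ofReal (1 / 2) ≤ ENNReal.ofReal (κ₃ * Cg * M ^ q) * μ (cball ρ x r) := by
    have h5 : ENNReal.ofReal (1 / 2) + ENNReal.ofReal (1 / 2) ≤
        ENNReal.ofReal (1 / 2) + ENNReal.ofReal (κ₃ * Cg * M ^ q) * μ (cball ρ x r) := by
      rw [← ENNReal.ofReal_add (by norm_num) (by norm_num)]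
      norm_num
      norm_num at h2
      exact h1.trans (add_le_add h2 h3)
    exact (ENNReal.add_le_add_iff_left ENNReal.ofReal_ne_top).1 h5
  have hA : 0 < κ₃ * Cg * M ^ q := by positivity
  have e : 1 / (2 * (κ₃ * Cg) * (2 * T + 1) ^ q) * r ^ q = (κ₃ * Cg * M ^ q)⁻¹ * (1 / 2) := by
    rw [hMdef, Real.div_rpow (by linarith) hr.le]
    have : 0 < r ^ q := by positivity
    have : 0 < (2 * T + 1) ^ q := by positivity
    field_simp
  rw [e, ENNReal.ofReal_mul (by positivity), ENNReal.ofReal_inv_of_pos hA]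
  calc _ ≤ (ENNReal.ofReal (κ₃ * Cg * M ^ q))⁻¹ *
        (ENNReal.ofReal (κ₃ * Cg * M ^ q) * μ (cball ρ x r)) := by gcongr
    _ = _ := by
        rw [← mul_assoc, ENNReal.inv_mul_cancel (by simpa using hA) ENNReal.ofReal_ne_top, one_mul]

/-- Every unit ball has mass at least some `c > 0`. A ball about `x₀` of mass greater than `1 - c`
therefore meets every unit ball, since the total mass is one. -/
lemma exists_rho_le (h : IsDataDefinedSpace ρ μ lam φ q κ₁ κ₂ κ₃ κ₄) :
    ∃ Δ : ℝ, 0 < Δ ∧ ∀ x y, ρ x y ≤ Δ := by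
  have := h.prob
  obtain ⟨c, hc, hball⟩ := exists_measure_cball_ge q κ₂ κ₃ κ₄ h.kappa₄_pos h.q_pos h.kappa₃_pos
    h.kappa₂_pos ρ
  obtain ⟨x₀⟩ := h.nonempty
  have hκ := h.kappa₁_pos
  have hmono : Monotone fun m : ℕ => cball ρ x₀ m := fun m n hmn y hy =>
    mem_cball.2 ((mem_cball.1 hy).trans (by exact_mod_cast hmn))
  have hU : ⋃ m : ℕ, cball ρ x₀ (m : ℝ) = Set.univ := by
    refine Set.eq_univ_of_forall fun y => ?_
    obtain ⟨m, hm⟩ := exists_nat_ge (ρ x₀ y)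
    exact Set.mem_iUnion.2 ⟨m, mem_cball.2 hm⟩
  have htend := tendsto_measure_iUnion_atTop (μ := μ) hmono
  rw [hU, measure_univ] at htend
  have hlt : (1 : ℝ≥0∞) - ENNReal.ofReal c < 1 :=
    ENNReal.sub_lt_self ENNReal.one_ne_top one_ne_zero (by simpa using hc)
  obtain ⟨m, hm⟩ := (htend.eventually (lt_mem_nhds hlt)).exists
  have hx : ∀ x, ρ x₀ x ≤ κ₁ * (m + 1) := by
    intro x
    have hne : (cball ρ x₀ m ∩ cball ρ x 1).Nonempty := by
      by_contra hempty
      rw [Set.not_nonempty_iff_eq_empty] at hempty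
      have h1 := measure_union (μ := μ) (Set.disjoint_iff_inter_eq_empty.2 hempty)
        (h.isClosed_cball x 1).measurableSet
      have h2 : ENNReal.ofReal c ≤ μ (cball ρ x 1) := by
        simpa using hball μ lam φ κ₁ h x 1 one_pos le_rfl
      have h3 : (1 : ℝ≥0∞) < μ (cball ρ x₀ m) + μ (cball ρ x 1) := by
        refine lt_of_lt_of_le ?_ (add_le_add_right h2 _)
        rw [ENNReal.sub_lt_iff_lt_right ENNReal.ofReal_ne_top] at hm
        · exact hm
        · exact h2.trans prob_le_one
      rw [← h1] at h3
      exact absurd prob_le_one (not_le.2 h3)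
    obtain ⟨z, hz1, hz2⟩ := hne
    refine (h.quasiMetric.triangle x₀ x z).trans ?_
    have h1 := mem_cball.1 hz1
    have h2 := mem_cball.1 hz2
    rw [h.quasiMetric.symm x z] at h2
    gcongr
  refine ⟨κ₁ * (κ₁ * (m + 1) + κ₁ * (m + 1)), by positivity, fun x y => ?_⟩
  refine (h.quasiMetric.triangle x y x₀).trans ?_
  have h1 := hx x
  rw [h.quasiMetric.symm x₀ x] at h1
  have h2 := hx y
  gcongr

/-- Regularity of a measure at one scale gives regularity at all larger scales. -/
lemma measure_cball_le_of_scale (h : IsDataDefinedSpace ρ μ lam φ q κ₁ κ₂ κ₃ κ₄) {c : ℝ}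
    (hc : 0 < c) (hball : ∀ (x : X) (r : ℝ), 0 < r → r ≤ 1 →
      ENNReal.ofReal (c * r ^ q) ≤ μ (cball ρ x r))
    (ν : Measure X) [IsFiniteMeasure ν] {R : ℝ≥0∞} {δ : ℝ} (hδ : 0 < δ) (hδ1 : δ ≤ 1)
    (hν : ∀ x, ν (cball ρ x δ) ≤ R * ENNReal.ofReal (δ ^ q)) (x : X) {d : ℝ} (hd : δ ≤ d) :
    ν (cball ρ x d) ≤ ENNReal.ofReal (κ₂ * (2 * κ₁) ^ q / c) * R * ENNReal.ofReal (d ^ q) := by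
  have := h.prob
  have hκ := h.kappa₁_pos
  have hκ2 := h.kappa₂_pos
  have hd0 : 0 < d := hδ.trans_le hd
  have hset : MeasurableSet {z : X × X | ρ z.1 z.2 ≤ δ} :=
    measurableSet_le h.measurable_uncurry_rho measurable_const
  have hcx : MeasurableSet (cball ρ x d) := (h.isClosed_cball x d).measurableSet
  -- Double counting of the pairs at distance at most `δ` with `w` in the large ball. Integrating
  -- first in `z` gives at least `c δ^q ν(B(x,d))`. Integrating first in `w` gives at most `R δ^q`
  -- for each `z`, and only `z` in `B(x, 2κ₁d)` contribute.
  set f : X → X → ℝ≥0∞ := fun w z => {p : X × X | ρ p.1 p.2 ≤ δ}.indicator 1 (w, z) with hf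
  have hfm : Measurable (Function.uncurry f) := measurable_one.indicator hset
  have hfz : ∀ w, ∫⁻ z, f w z ∂μ = μ (cball ρ w δ) := by
    intro w
    have : (fun z => f w z) = (cball ρ w δ).indicator 1 := by
      ext z; simp [hf, Set.indicator, mem_cball]
    rw [this, lintegral_indicator_one (h.isClosed_cball w δ).measurableSet]
  have hδq : 0 < δ ^ q := by positivity
  have h1 : ENNReal.ofReal (c * δ ^ q) * ν (cball ρ x d) ≤
      ∫⁻ w in cball ρ x d, ∫⁻ z, f w z ∂μ ∂ν := by
    rw [← setLIntegral_const]
    exact lintegral_mono fun w => by rw [hfz]; exact hball w δ hδ hδ1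
  have h2 : ∫⁻ w in cball ρ x d, ∫⁻ z, f w z ∂μ ∂ν =
      ∫⁻ z, ∫⁻ w in cball ρ x d, f w z ∂ν ∂μ := lintegral_lintegral_swap hfm.aemeasurable
  have h3 : ∀ z, ∫⁻ w in cball ρ x d, f w z ∂ν ≤
      (cball ρ x (2 * κ₁ * d)).indicator (fun _ => R * ENNReal.ofReal (δ ^ q)) z := by
    intro z
    have e : (fun w => f w z) = (cball ρ z δ).indicator 1 := by
      ext w; simp [hf, Set.indicator, mem_cball, h.quasiMetric.symm w z]
    rw [e, lintegral_indicator_one (h.isClosed_cball z δ).measurableSet]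
    by_cases hz : z ∈ cball ρ x (2 * κ₁ * d)
    · rw [Set.indicator_of_mem hz]
      exact (Measure.restrict_apply_le _ _).trans (hν z)
    · rw [Set.indicator_of_notMem hz, Measure.restrict_apply (h.isClosed_cball z δ).measurableSet]
      have : cball ρ z δ ∩ cball ρ x d = ∅ := by
        rw [Set.eq_empty_iff_forall_notMem]
        rintro w ⟨hw1, hw2⟩
        refine hz (mem_cball.2 ((h.quasiMetric.triangle x z w).trans ?_))
        have a1 := mem_cball.1 hw1
        have a2 := mem_cball.1 hw2
        rw [h.quasiMetric.symm z w] at a1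
        calc κ₁ * (ρ x w + ρ w z) ≤ κ₁ * (d + d) := by gcongr; linarith
          _ = _ := by ring
      rw [this, measure_empty]
  have h4 : ∫⁻ z, ∫⁻ w in cball ρ x d, f w z ∂ν ∂μ ≤
      R * ENNReal.ofReal (δ ^ q) * (ENNReal.ofReal κ₂ * ENNReal.ofReal ((2 * κ₁ * d) ^ q)) := by
    refine (lintegral_mono h3).trans ?_
    rw [lintegral_indicator_const (h.isClosed_cball x _).measurableSet]
    gcongr
    exact h.measure_cball_le x (by positivity)
  have h5 := h1.trans (h2.le.trans h4)
  have hA : 0 < c * δ ^ q := by positivity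
  have h6 : ν (cball ρ x d) ≤ (ENNReal.ofReal (c * δ ^ q))⁻¹ * (R * ENNReal.ofReal (δ ^ q) *
      (ENNReal.ofReal κ₂ * ENNReal.ofReal ((2 * κ₁ * d) ^ q))) := by
    calc ν (cball ρ x d) = (ENNReal.ofReal (c * δ ^ q))⁻¹ *
          (ENNReal.ofReal (c * δ ^ q) * ν (cball ρ x d)) := by
          rw [← mul_assoc, ENNReal.inv_mul_cancel (by simpa using hA) ENNReal.ofReal_ne_top,
            one_mul]
      _ ≤ _ := by gcongr
  refine h6.trans_eq ?_
  have : (κ₂ * (2 * κ₁) ^ q / c) = (c * δ ^ q)⁻¹ * (δ ^ q) * κ₂ * (2 * κ₁) ^ q := by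
    field_simp
  rw [this, ← ENNReal.ofReal_inv_of_pos hA, Real.mul_rpow (by positivity) hd0.le,
    ENNReal.ofReal_mul (by positivity), ENNReal.ofReal_mul (by positivity),
    ENNReal.ofReal_mul (by positivity), ENNReal.ofReal_mul (by positivity)]
  ring

end IsDataDefinedSpace

/-! ### The heat kernel as approximate identity; uniqueness of Fourier coefficients. -/

namespace IsDataDefinedSpace

variable {X : Type*} [TopologicalSpace X] [MeasurableSpace X] [BorelSpace X]
  {ρ : X → X → ℝ} {μ : Measure X} {lam : ℕ → ℝ} {φ : ℕ → X → ℝ} {q κ₁ κ₂ κ₃ κ₄ : ℝ}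

/-- The Gaussian is dominated by `decay` with exponent `q + 1`. One power beyond integrability
yields the tail factor `(M r)⁻¹`. -/
lemma exists_lintegral_heat_le (h : IsDataDefinedSpace ρ μ lam φ q κ₁ κ₂ κ₃ κ₄) :
    ∃ K : ℝ, 0 < K ∧ ∀ M : ℝ, 1 ≤ M → ∀ x,
      ∫⁻ y, ‖heat lam φ (1 / M ^ 2) x y‖ₑ ∂μ ≤ ENNReal.ofReal K ∧
      ∀ r, 0 < r → ∫⁻ y in {y | r < ρ x y}, ‖heat lam φ (1 / M ^ 2) x y‖ₑ ∂μ ≤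
        ENNReal.ofReal (K * (M * r)⁻¹) := by
  obtain ⟨Cg, hCg, hg⟩ := exists_exp_neg_sq_le h.kappa₄_pos (q + 1)
  obtain ⟨Cd, hCd, hdec⟩ := lintegral_decay_le (ρ := ρ) (q := q) (s := q + 1) (by linarith)
    h.q_pos.le
  have hk3 := h.kappa₃_pos
  have hk2 := h.kappa₂_pos
  refine ⟨κ₃ * Cg * (Cd * κ₂), by positivity, fun M hM x => ?_⟩
  have hM0 : 0 < M := by linarith
  have hle : ∀ y, ‖heat lam φ (1 / M ^ 2) x y‖ₑ ≤ ENNReal.ofReal (κ₃ * Cg) *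
      ENNReal.ofReal (decay q (q + 1) M (ρ x y)) := fun y => by
    rw [Real.enorm_eq_ofReal_abs, ← ENNReal.ofReal_mul (by positivity)]
    exact ENNReal.ofReal_le_ofReal (h.abs_heat_le_decay hg hM x y)
  have hD := fun r (hr : 0 < r) => hdec μ x (h.quasiMetric.nonneg x) (h.continuous_rho x).measurable
    (ENNReal.ofReal κ₂) M r hr hM0 fun d hd => h.measure_cball_le x (hr.trans_le hd)
  constructor
  · refine (lintegral_mono hle).trans ?_
    rw [lintegral_const_mul' _ _ ENNReal.ofReal_ne_top, ENNReal.ofReal_mul (p := κ₃ * Cg)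
      (by positivity)]
    have e : M * (1 / M) = 1 := by field_simp
    have := (hD (1 / M) (by positivity)).2 e.ge
    rw [e, Real.one_rpow, ENNReal.ofReal_one, mul_one, ← ENNReal.ofReal_mul hCd.le] at this
    exact mul_le_mul' le_rfl this
  · intro r hr
    refine (lintegral_mono hle).trans ?_
    rw [lintegral_const_mul' _ _ ENNReal.ofReal_ne_top, mul_assoc (κ₃ * Cg),
      ENNReal.ofReal_mul (p := κ₃ * Cg) (by positivity)]
    have := (hD r hr).1
    rw [sub_add_cancel_left, Real.rpow_neg_one, ← ENNReal.ofReal_mul hCd.le,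
      ← ENNReal.ofReal_mul (by positivity)] at this
    exact mul_le_mul' le_rfl this

lemma inv_sq_mem {n : ℕ} : (0 : ℝ) < 1 / ((n : ℝ) + 1) ^ 2 ∧ 1 / ((n : ℝ) + 1) ^ 2 ≤ 1 := by
  refine ⟨by positivity, ?_⟩
  rw [div_le_one (by positivity)]
  exact one_le_pow₀ (by linarith [Nat.cast_nonneg (α := ℝ) n])

/-- The heat kernel is an approximate identity. -/
lemma tendsto_integral_heat_mul (h : IsDataDefinedSpace ρ μ lam φ q κ₁ κ₂ κ₃ κ₄) {f : X → ℝ}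
    (hf : Continuous f) (hf1 : ∀ x, |f x| ≤ 1) (x : X) :
    Tendsto (fun n : ℕ => ∫ y, heat lam φ (1 / ((n : ℝ) + 1) ^ 2) x y * f y ∂μ) atTop
      (𝓝 (f x)) := by
  have := h.prob
  obtain ⟨K, hK, hheat⟩ := h.exists_lintegral_heat_le
  rw [Metric.tendsto_atTop]
  intro ε hε
  have hε' : 0 < ε / (4 * K) := by positivity
  obtain ⟨r, hr, hrU⟩ := h.exists_cball_subset (x := x) (U := {y | |f y - f x| < ε / (4 * K)})
    (isOpen_lt (by fun_prop) continuous_const) (by simpa using hε')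
  obtain ⟨m, hm⟩ := exists_nat_gt (4 * 2 * K / (r * ε))
  refine ⟨m, fun n hn => ?_⟩
  set M : ℝ := (n : ℝ) + 1
  have hM1 : 1 ≤ M := by simp [M]
  have hM0 : 0 < M := by linarith
  obtain ⟨ht, ht1⟩ := inv_sq_mem (n := n)
  have hKi := h.integrable_heat ht ht1 x
  have hKfi : Integrable (fun y => heat lam φ (1 / M ^ 2) x y * f y) μ :=
    hKi.mul_bdd hf.measurable.aestronglyMeasurable (Eventually.of_forall hf1)
  have e1 : (∫ y, heat lam φ (1 / M ^ 2) x y * f y ∂μ) - f x =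
      ∫ y, heat lam φ (1 / M ^ 2) x y * (f y - f x) ∂μ := by
    simp_rw [mul_sub]
    rw [integral_sub hKfi (hKi.mul_const _), integral_mul_const, h.integral_heat ht ht1, one_mul]
  have hms : MeasurableSet {y | r < ρ x y} :=
    measurableSet_lt measurable_const (h.continuous_rho x).measurable
  obtain ⟨hh1, hh2⟩ := hheat M hM1 x
  have e2 : ‖∫ y, heat lam φ (1 / M ^ 2) x y * (f y - f x) ∂μ‖ₑ ≤
      ENNReal.ofReal (2 * (K * (M * r)⁻¹) + ε / (4 * K) * K) := by
    calc _ ≤ ∫⁻ y, ‖heat lam φ (1 / M ^ 2) x y * (f y - f x)‖ₑ ∂μ :=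
          enorm_integral_le_lintegral_enorm _
      _ = (∫⁻ y in {y | r < ρ x y}, ‖heat lam φ (1 / M ^ 2) x y * (f y - f x)‖ₑ ∂μ) +
          ∫⁻ y in {y | r < ρ x y}ᶜ, ‖heat lam φ (1 / M ^ 2) x y * (f y - f x)‖ₑ ∂μ :=
          (lintegral_add_compl _ hms).symm
      _ ≤ (∫⁻ y in {y | r < ρ x y}, ENNReal.ofReal 2 * ‖heat lam φ (1 / M ^ 2) x y‖ₑ ∂μ) +
          ∫⁻ y in {y | r < ρ x y}ᶜ, ENNReal.ofReal (ε / (4 * K)) *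
            ‖heat lam φ (1 / M ^ 2) x y‖ₑ ∂μ := by
          gcongr ?_ + ?_
          · refine lintegral_mono fun y => ?_
            rw [enorm_mul, mul_comm]
            gcongr
            rw [Real.enorm_eq_ofReal_abs]
            refine ENNReal.ofReal_le_ofReal ((abs_sub _ _).trans ?_)
            linarith [hf1 x, hf1 y]
          · refine setLIntegral_mono' hms.compl fun y hy => ?_
            rw [enorm_mul, mul_comm]
            gcongr
            rw [Real.enorm_eq_ofReal_abs]
            refine ENNReal.ofReal_le_ofReal (le_of_lt ?_)
            have : y ∈ cball ρ x r := by simpa [mem_cball] using hy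
            exact hrU this
      _ ≤ ENNReal.ofReal 2 * ENNReal.ofReal (K * (M * r)⁻¹) +
          ENNReal.ofReal (ε / (4 * K)) * ENNReal.ofReal K := by
          rw [lintegral_const_mul' _ _ ENNReal.ofReal_ne_top,
            lintegral_const_mul' _ _ ENNReal.ofReal_ne_top]
          gcongr
          · exact hh2 r hr
          · exact (setLIntegral_le_lintegral _ _).trans hh1
      _ = _ := by
          rw [← ENNReal.ofReal_mul (by norm_num), ← ENNReal.ofReal_mul hε'.le,
            ← ENNReal.ofReal_add (by positivity) (by positivity)]
  rw [Real.dist_eq, e1]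
  rw [Real.enorm_eq_ofReal_abs, ENNReal.ofReal_le_ofReal_iff (by positivity)] at e2
  refine e2.trans_lt ?_
  have h1 : ε / (4 * K) * K = ε / 4 := by field_simp
  have h2 : 2 * (K * (M * r)⁻¹) ≤ ε / 4 := by
    have hmM : 4 * 2 * K / (r * ε) < M := hm.trans_le
      ((Nat.cast_le (α := ℝ)).2 hn |>.trans (by simp [M]))
    rw [div_lt_iff₀ (by positivity)] at hmM
    rw [← div_eq_mul_inv, mul_div_assoc', div_le_div_iff₀ (by positivity) (by norm_num)]
    nlinarith
  linarith

/-- An integrable function is determined by its Fourier coefficients. -/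
lemma ae_eq_zero_of_coef (h : IsDataDefinedSpace ρ μ lam φ q κ₁ κ₂ κ₃ κ₄) {g : X → ℝ}
    (hg : Integrable g μ) (hcoef : ∀ k, ∫ y, φ k y * g y ∂μ = 0) : g =ᵐ[μ] 0 := by
  have := h.prob
  have := h.metrizableSpace
  have := h.secondCountableTopology
  obtain ⟨K, hK, hheat⟩ := h.exists_lintegral_heat_le
  have hcont : ∀ f : X → ℝ, Continuous f → (∀ x, |f x| ≤ 1) → ∫ x, g x * f x ∂μ = 0 := by
    intro f hf hf1
    have hfi : Integrable f μ := Integrable.of_bound hf.measurable.aestronglyMeasurable 1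
      (Eventually.of_forall hf1)
    -- The heat kernel is symmetric, so it can be moved from `f` to `g`; it annihilates `g`, whose
    -- coefficients all vanish. Letting the time tend to zero gives `∫ g f = 0`.
    have hz : ∀ n : ℕ, ∫ x, g x * ∫ y, heat lam φ (1 / ((n : ℝ) + 1) ^ 2) x y * f y ∂μ ∂μ = 0 := by
      intro n
      obtain ⟨ht, ht1⟩ := inv_sq_mem (n := n)
      have hint : Integrable (Function.uncurry fun x y =>
          g x * (heat lam φ (1 / ((n : ℝ) + 1) ^ 2) x y * f y)) (μ.prod μ) := by
        have := (hg.mul_prod hfi).bdd_mul (c := κ₃ * (1 / ((n : ℝ) + 1) ^ 2) ^ (-q / 2))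
          (h.measurable_heat ht ht1).aestronglyMeasurable
          (Eventually.of_forall fun z => h.abs_heat_le ht ht1 le_rfl z.1 z.2)
        refine this.congr (Eventually.of_forall fun z => ?_)
        simp only [Function.uncurry]
        ring
      simp_rw [← integral_const_mul]
      rw [integral_integral_swap hint]
      have : ∀ y, ∫ x, g x * (heat lam φ (1 / ((n : ℝ) + 1) ^ 2) x y * f y) ∂μ = 0 := by
        intro y
        have e : ∀ x, g x * (heat lam φ (1 / ((n : ℝ) + 1) ^ 2) x y * f y) =
            (heat lam φ (1 / ((n : ℝ) + 1) ^ 2) y x * g x) * f y := fun x => by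
          rw [heat_comm]; ring
        simp_rw [e]
        rw [integral_mul_const, h.integral_heat_mul ht ht1 hg]
        simp [hcoef]
      simp_rw [this]
      exact integral_zero _ _
    have hlim := tendsto_integral_of_dominated_convergence (μ := μ)
      (F := fun (n : ℕ) x => g x * ∫ y, heat lam φ (1 / ((n : ℝ) + 1) ^ 2) x y * f y ∂μ)
      (f := fun x => g x * f x) (fun x => ‖g x‖ * K) (fun n => ?_) (hg.norm.mul_const K)
      (fun n => Eventually.of_forall fun x => ?_)
      (Eventually.of_forall fun x => (h.tendsto_integral_heat_mul hf hf1 x).const_mul (g x))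
    · simp_rw [hz] at hlim
      exact (tendsto_nhds_unique hlim tendsto_const_nhds)
    · obtain ⟨ht, ht1⟩ := inv_sq_mem (n := n)
      refine hg.aestronglyMeasurable.mul (StronglyMeasurable.aestronglyMeasurable ?_)
      refine StronglyMeasurable.integral_prod_right (f := fun x y =>
        heat lam φ (1 / ((n : ℝ) + 1) ^ 2) x y * f y) (Measurable.stronglyMeasurable ?_)
      exact (h.measurable_heat ht ht1).mul (hf.measurable.comp measurable_snd)
    · rw [norm_mul]
      gcongr
      have h1 : ‖∫ y, heat lam φ (1 / ((n : ℝ) + 1) ^ 2) x y * f y ∂μ‖ₑ ≤ ENNReal.ofReal K := by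
        refine (enorm_integral_le_lintegral_enorm _).trans (le_trans (lintegral_mono fun y => ?_)
          (hheat ((n : ℝ) + 1) (by linarith [Nat.cast_nonneg (α := ℝ) n]) x).1)
        rw [enorm_mul]
        refine mul_le_of_le_one_right' ?_
        rw [Real.enorm_eq_ofReal_abs, ← ENNReal.ofReal_one]
        exact ENNReal.ofReal_le_ofReal (hf1 y)
      rwa [← ofReal_norm, ENNReal.ofReal_le_ofReal_iff hK.le] at h1
  -- The indicator of a closed set is a pointwise limit of continuous functions with values in `[0,
  -- 1]`; metrizability provides them.
  refine ae_eq_zero_of_forall_setIntegral_isClosed_eq_zero hg fun F hF => ?_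
  have hlim := tendsto_integral_of_dominated_convergence (μ := μ)
    (F := fun (n : ℕ) x => g x * (hF.apprSeq n x : ℝ)) (f := F.indicator g)
    (fun x => ‖g x‖) (fun n => ?_) hg.norm (fun n => Eventually.of_forall fun x => ?_)
    (Eventually.of_forall fun x => ?_)
  · rw [integral_indicator hF.measurableSet] at hlim
    have hz : ∀ n, ∫ x, g x * (hF.apprSeq n x : ℝ) ∂μ = 0 := fun n => by
      refine hcont _ (NNReal.continuous_coe.comp (hF.apprSeq n).continuous) fun x => ?_
      rw [abs_of_nonneg (NNReal.coe_nonneg _)]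
      exact_mod_cast HasOuterApproxClosed.apprSeq_apply_le_one hF n x
    simp_rw [hz] at hlim
    exact (tendsto_nhds_unique hlim tendsto_const_nhds)
  · exact hg.aestronglyMeasurable.mul
      (NNReal.continuous_coe.comp (hF.apprSeq n).continuous).measurable.aestronglyMeasurable
  · rw [norm_mul]
    refine mul_le_of_le_one_right (norm_nonneg _) ?_
    rw [Real.norm_eq_abs, abs_of_nonneg (NNReal.coe_nonneg _)]
    exact_mod_cast HasOuterApproxClosed.apprSeq_apply_le_one hF n x
  · have h1 := (tendsto_pi_nhds.1 (HasOuterApproxClosed.tendsto_apprSeq hF)) x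
    have h2 := ((NNReal.continuous_coe.tendsto _).comp h1).const_mul (g x)
    have e : F.indicator g x = g x * ((F.indicator (fun _ => (1 : ℝ≥0)) x : ℝ≥0) : ℝ) := by
      by_cases hx : x ∈ F <;> simp [hx]
    rw [e]
    exact h2

end IsDataDefinedSpace

/-! ### Localization of smooth spectral multipliers. -/

lemma rpow_mul_exp_neg_le (S : ℕ) {ε R : ℝ} (hε : 0 < ε) (hR : 0 < R) :
    R * Real.exp (-(ε * R)) ≤ (S + 1).factorial * (1 / ε) ^ (S + 1) * (R ^ S)⁻¹ := by
  have h1 := Real.pow_div_factorial_le_exp (ε * R) (by positivity) (S + 1)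
  rw [Real.exp_neg]
  have hE := Real.exp_pos (ε * R)
  rw [← div_eq_mul_inv, ← div_eq_mul_inv, div_le_div_iff₀ hE (by positivity)]
  rw [div_le_iff₀ (by positivity)] at h1
  have h2 : R * R ^ S = (1 / ε) ^ (S + 1) * (ε * R) ^ (S + 1) := by
    rw [← mul_pow, ← mul_assoc, one_div_mul_cancel hε.ne', one_mul, pow_succ']
  rw [h2]
  calc (1 / ε) ^ (S + 1) * (ε * R) ^ (S + 1)
      ≤ (1 / ε) ^ (S + 1) * (Real.exp (ε * R) * (S + 1).factorial) := by gcongr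
    _ = _ := by ring

namespace IsDataDefinedSpace

variable {X : Type*} [TopologicalSpace X] [MeasurableSpace X]
  {ρ : X → X → ℝ} {μ : Measure X} {lam : ℕ → ℝ} {φ : ℕ → X → ℝ} {q κ₁ κ₂ κ₃ κ₄ : ℝ}

/-- With `v = exp(-λ² t)`, the monomial `v · v^k` is the heat multiplier at time `(k+1)t`. The extra
factor `v` makes even the constant term of the power series give a convergent expansion. -/
lemma tsum_mul_power_series (h : IsDataDefinedSpace ρ μ lam φ q κ₁ κ₂ κ₃ κ₄) {t : ℝ} (ht : 0 < t)
    (ht1 : t ≤ 1) {A : ℕ → ℝ} (hA : Summable fun k => |A k|) (x y : X) :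
    ∑' j, Real.exp (-(lam j) ^ 2 * t) * (∑' k, A k * Real.exp (-(lam j) ^ 2 * t) ^ k) *
        φ j x * φ j y = ∑' k, A k * heat lam φ ((k + 1 : ℝ) * t) x y := by
  have hs := (h.summable_abs_of_le ht ht1 zero_le_one
    (fun k => exp_le_exp_of_le (l := lam k) (le_refl t)) x y).1
  have hsum : Summable (Function.uncurry fun j k => A k *
      (Real.exp (-(lam j) ^ 2 * ((k + 1 : ℝ) * t)) * φ j x * φ j y)) := by
    refine Summable.of_norm_bounded
      (hs.mul_of_nonneg hA (fun _ => abs_nonneg _) fun _ => abs_nonneg _) fun z => ?_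
    simp only [Function.uncurry, norm_mul, Real.norm_eq_abs, abs_mul]
    rw [mul_comm (|A z.2|)]
    have h1 : t ≤ (z.2 + 1 : ℝ) * t := by nlinarith [Nat.cast_nonneg (α := ℝ) z.2]
    have h2 := exp_le_exp_of_le (l := lam z.1) h1
    rw [one_mul, abs_of_pos (Real.exp_pos _)] at h2
    refine mul_le_mul_of_nonneg_right (mul_le_mul_of_nonneg_right (mul_le_mul_of_nonneg_right ?_
      (abs_nonneg _)) (abs_nonneg _)) (abs_nonneg _)
    rwa [abs_of_pos (Real.exp_pos _), abs_of_pos (Real.exp_pos _)]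
  have hpow : ∀ j k : ℕ, Real.exp (-(lam j) ^ 2 * ((k + 1 : ℝ) * t)) =
      Real.exp (-(lam j) ^ 2 * t) * Real.exp (-(lam j) ^ 2 * t) ^ k := by
    intro j k
    rw [← pow_succ', ← Real.exp_nat_mul]
    congr 1
    push_cast
    ring
  calc _ = ∑' j, ∑' k, A k * (Real.exp (-(lam j) ^ 2 * ((k + 1 : ℝ) * t)) * φ j x * φ j y) := by
        refine tsum_congr fun j => ?_
        rw [← tsum_mul_left, ← tsum_mul_right, ← tsum_mul_right]
        refine tsum_congr fun k => ?_
        rw [hpow]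
        ring
    _ = ∑' k, ∑' j, A k * (Real.exp (-(lam j) ^ 2 * ((k + 1 : ℝ) * t)) * φ j x * φ j y) :=
        hsum.tsum_comm.symm
    _ = _ := by
        refine tsum_congr fun k => ?_
        rw [tsum_mul_left]
        rfl

/-- Off-diagonal bound for the heat kernel at multiples of the time `1 / M ^ 2`. -/
lemma abs_heat_mul_le (h : IsDataDefinedSpace ρ μ lam φ q κ₁ κ₂ κ₃ κ₄) {ε M : ℝ} (hε : 0 < ε)
    (hε4 : ε ^ 2 ≤ κ₄) (hM : 1 ≤ M) (x y : X) (hερ : ε * ρ x y ≤ 1) (k : ℕ) :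
    |heat lam φ ((k + 1 : ℝ) * (1 / M ^ 2)) x y| ≤
      κ₃ * M ^ q * Real.exp (k + 1 - ε * (M * ρ x y)) := by
  have hM0 : 0 < M := by linarith
  have hρ := h.quasiMetric.nonneg x y
  have hk3 := h.kappa₃_pos
  have hq := h.q_pos
  have hk0 : (0 : ℝ) ≤ k := Nat.cast_nonneg k
  have ht : (0 : ℝ) < 1 / M ^ 2 := by positivity
  have ht1 : 1 / M ^ 2 ≤ 1 := by rw [div_le_one (by positivity)]; exact one_le_pow₀ hM
  have e1 : (1 / M ^ 2) ^ (-q / 2) = M ^ q := by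
    rw [one_div, ← Real.rpow_natCast, ← Real.rpow_neg hM0.le, ← Real.rpow_mul hM0.le]
    congr 1
    push_cast
    ring
  -- In the first case `ε ρ ≤ 1` puts the time `(k+1)/M²` below `1`, and the Gaussian exponent is at
  -- least `ε² (Mρ)² / (k+1) ≥ ε Mρ`. In the second the exponent on the right is positive and the
  -- diagonal bound is enough.
  by_cases hk : (k + 1 : ℝ) ≤ ε * (M * ρ x y)
  · have hR : 0 < ρ x y := by
      rcases hρ.lt_or_eq with h0 | h0
      · exact h0
      · rw [← h0] at hk; simp at hk; linarith
    have hkt : (k + 1 : ℝ) * (1 / M ^ 2) ≤ 1 := by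
      rw [mul_one_div, div_le_one (by positivity)]
      calc (k + 1 : ℝ) ≤ (ε * ρ x y) * M := by linarith
        _ ≤ 1 * M := by gcongr
        _ ≤ M ^ 2 := by nlinarith
    refine (h.heat_gaussian _ x y (by positivity) hkt).trans ?_
    have h1 : ((k + 1 : ℝ) * (1 / M ^ 2)) ^ (-q / 2) ≤ M ^ q := by
      rw [← e1]
      exact Real.rpow_le_rpow_of_nonpos ht (by nlinarith) (by linarith)
    have h2 : -κ₄ * ρ x y ^ 2 / ((k + 1 : ℝ) * (1 / M ^ 2)) ≤ k + 1 - ε * (M * ρ x y) := by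
      have h3 : ε * (M * ρ x y) ≤ κ₄ * ρ x y ^ 2 / ((k + 1 : ℝ) * (1 / M ^ 2)) := by
        rw [le_div_iff₀ (by positivity)]
        calc ε * (M * ρ x y) * ((k + 1 : ℝ) * (1 / M ^ 2))
            ≤ ε * (M * ρ x y) * ((ε * (M * ρ x y)) * (1 / M ^ 2)) := by gcongr
          _ = ε ^ 2 * ρ x y ^ 2 := by field_simp
          _ ≤ κ₄ * ρ x y ^ 2 := by gcongr
      rw [neg_mul, neg_div]
      linarith
    gcongr
  · push Not at hk
    have h1 := h.abs_heat_le ht ht1 (t' := (k + 1 : ℝ) * (1 / M ^ 2)) (by nlinarith) x y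
    rw [e1] at h1
    refine h1.trans (le_mul_of_one_le_right (by positivity) ?_)
    exact Real.one_le_exp (by linarith)

/-- Localization of kernels of smooth spectral multipliers. -/
lemma exists_localization {κ₃ κ₄ Δ : ℝ} (q : ℝ) (hκ₄ : 0 < κ₄) (hΔ : 0 < Δ) (hκ₃ : 0 < κ₃)
    (S : ℕ) (hS : 1 ≤ S) (ρ : X → X → ℝ) (hρΔ : ∀ x y, ρ x y ≤ Δ) :
    ∃ C : ℝ, 0 < C ∧ ∀ (μ : Measure X) (lam : ℕ → ℝ) (φ : ℕ → X → ℝ) (κ₁ κ₂ : ℝ),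
    IsDataDefinedSpace ρ μ lam φ q κ₁ κ₂ κ₃ κ₄ → ∀ (B : ℝ) (g : ℝ → ℝ),
    DerivBdd Set.univ B S g → (∀ v, v ∉ Set.Icc (0 : ℝ) 1 → g v = 0) →
    ∀ M : ℝ, 1 ≤ M → ∀ x y,
      |∑' k, Real.exp (-(lam k) ^ 2 * (1 / M ^ 2)) * g (Real.exp (-(lam k) ^ 2 * (1 / M ^ 2))) *
        φ k x * φ k y| ≤ C * B * decay q S M (ρ x y) := by
  obtain ⟨CJ, hCJ, hJ⟩ := exists_entire_approx S hS
  have hpi := Real.pi_pos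
  -- The two entries give the two requirements of `abs_heat_mul_le`: `ε ρ ≤ 1` everywhere and `ε² ≤
  -- κ₄`.
  set ε := min (1 / Δ) (Real.sqrt κ₄) with hεdef
  have hε : 0 < ε := lt_min (by positivity) (Real.sqrt_pos.2 hκ₄)
  have hε4 : ε ^ 2 ≤ κ₄ := by
    calc ε ^ 2 ≤ Real.sqrt κ₄ ^ 2 := by gcongr; exact min_le_right _ _
      _ = κ₄ := Real.sq_sqrt hκ₄.le
  set e1 := Real.exp 1 with he1
  have he1pos : 0 < e1 := Real.exp_pos 1
  -- The approximant has type `Y = 2πηR`, and summing `Y^k / k!` against `exp(k + 1 - εR)` produces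
  -- `exp(Ye - εR)` up to a constant. This `η` makes `Ye = εR/2`, so half of the decay survives.
  set η := ε / (4 * Real.pi * e1) with hη
  have hη0 : 0 < η := by positivity
  set C1 := CJ * (η ^ S)⁻¹ * κ₃ with hC1
  set C2 := κ₃ * CJ * η * e1 * ((S + 1).factorial * (1 / (ε / 2)) ^ (S + 1)) with hC2
  refine ⟨2 ^ S * (κ₃ + (C1 + C2)), by positivity, ?_⟩
  intro μ lam φ κ₁ κ₂ h B g hg hsupp M hM x y
  have hB : 0 ≤ B := (abs_nonneg _).trans (hg.abs_le 0 trivial)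
  have hM0 : 0 < M := by linarith
  have hρ := h.quasiMetric.nonneg x y
  have ht : (0 : ℝ) < 1 / M ^ 2 := by positivity
  have ht1 : 1 / M ^ 2 ≤ 1 := by rw [div_le_one (by positivity)]; exact one_le_pow₀ hM
  have eq1 : (1 / M ^ 2) ^ (-q / 2) = M ^ q := by
    rw [one_div, ← Real.rpow_natCast, ← Real.rpow_neg hM0.le, ← Real.rpow_mul hM0.le]
    congr 1
    push_cast
    ring
  set v : ℕ → ℝ := fun k => Real.exp (-(lam k) ^ 2 * (1 / M ^ 2)) with hv
  have hv0 : ∀ k, 0 < v k := fun k => Real.exp_pos _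
  have hbound : ∀ (u : ℝ → ℝ) (b : ℝ), 0 ≤ b → (∀ z, |u z| ≤ b) →
      (Summable fun k => v k * u (v k) * φ k x * φ k y) ∧
      |∑' k, v k * u (v k) * φ k x * φ k y| ≤ b * (κ₃ * M ^ q) := by
    intro u b hb hu
    have ha : ∀ k, |v k * u (v k)| ≤ b * Real.exp (-(lam k) ^ 2 * (1 / M ^ 2)) := fun k => by
      rw [abs_mul, abs_of_pos (hv0 k), mul_comm]
      exact mul_le_mul_of_nonneg_right (hu _) (hv0 k).le
    obtain ⟨h1, h2⟩ := h.summable_abs_of_le ht ht1 hb ha x y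
    rw [eq1] at h2
    exact ⟨h1.of_abs, (norm_tsum_le_tsum_norm (f := fun k => v k * u (v k) * φ k x * φ k y)
      h1).trans h2⟩
  have hMq : 0 < M ^ q := by positivity
  set R := M * ρ x y with hR
  have hR0 : 0 ≤ R := mul_nonneg hM0.le hρ
  have hdecay : decay q S M (ρ x y) = M ^ q * ((1 + R) ^ S)⁻¹ := by
    rw [decay, Real.rpow_neg (by positivity), Real.rpow_natCast]
  rw [hdecay]
  obtain ⟨hgs, hgb⟩ := hbound g B hB fun z => hg.abs_le z trivial
  by_cases hR1 : R ≤ 1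
  · refine hgb.trans ?_
    have h1 : (2 ^ S)⁻¹ ≤ ((1 + R) ^ S)⁻¹ := by
      gcongr
      linarith
    calc B * (κ₃ * M ^ q) = (2 ^ S * κ₃) * B * (M ^ q * (2 ^ S)⁻¹) := by field_simp
      _ ≤ (2 ^ S * (κ₃ + (C1 + C2))) * B * (M ^ q * ((1 + R) ^ S)⁻¹) := by
          gcongr
          have : 0 < C1 + C2 := by positivity
          linarith
  · push Not at hR1
    have hRpos : 0 < R := by linarith
    have hD : 0 < η * R := by positivity
    obtain ⟨A, hA1, hA2⟩ := hJ B g hg hsupp (η * R) hD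
    set Y := 2 * Real.pi * (η * R) with hY
    have hY0 : 0 < Y := by positivity
    have hYe : Y * e1 = ε * R / 2 := by
      rw [hY, hη]; field_simp; ring
    clear_value Y
    have hA1' : ∀ k, |A k| ≤ CJ * B * (η * R) * (Y ^ k / k.factorial) := fun k =>
      (hA1 k).trans_eq (by rw [hY]; ring)
    have hAs : Summable fun k => |A k| :=
      ((Real.summable_pow_div_factorial Y).mul_left _).of_nonneg_of_le (fun k => abs_nonneg _) hA1'
    have hE0 : 0 ≤ CJ * B * ((η * R) ^ S)⁻¹ := by positivity
    obtain ⟨hds, hdb⟩ := hbound (fun z => g z - ∑' k, A k * z ^ k) _ hE0 hA2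
    have hP := h.tsum_mul_power_series ht ht1 hAs x y
    have hsplit : ∑' k, v k * g (v k) * φ k x * φ k y =
        (∑' k, v k * (g (v k) - ∑' l, A l * v k ^ l) * φ k x * φ k y) +
          ∑' k, A k * heat lam φ ((k + 1 : ℝ) * (1 / M ^ 2)) x y := by
      rw [← hP, ← hds.tsum_add]
      · exact tsum_congr fun k => by ring
      · refine (hgs.sub hds).congr fun k => ?_
        ring
    have hheat : |∑' k, A k * heat lam φ ((k + 1 : ℝ) * (1 / M ^ 2)) x y| ≤
        C2 * B * (M ^ q * (R ^ S)⁻¹) := by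
      have hερ : ε * ρ x y ≤ 1 := by
        calc ε * ρ x y ≤ 1 / Δ * Δ := by
              gcongr
              · exact min_le_left _ _
              · exact hρΔ x y
          _ = 1 := by field_simp
      have hterm : ∀ k, ‖A k * heat lam φ ((k + 1 : ℝ) * (1 / M ^ 2)) x y‖ ≤
          (κ₃ * M ^ q * (CJ * B * (η * R)) * (e1 * Real.exp (-(ε * R)))) *
            ((Y * e1) ^ k / k.factorial) := by
        intro k
        rw [norm_mul, Real.norm_eq_abs, Real.norm_eq_abs]
        calc |A k| * |heat lam φ ((k + 1 : ℝ) * (1 / M ^ 2)) x y|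
            ≤ (CJ * B * (η * R) * (Y ^ k / k.factorial)) *
              (κ₃ * M ^ q * Real.exp (k + 1 - ε * R)) := by
              gcongr
              · exact hA1' k
              · exact h.abs_heat_mul_le hε hε4 hM x y hερ k
          _ = _ := by
              have : Real.exp (k + 1 - ε * R) = e1 ^ k * (e1 * Real.exp (-(ε * R))) := by
                rw [he1, ← Real.exp_nat_mul, ← Real.exp_add, ← Real.exp_add]
                congr 1
                ring
              rw [this, mul_pow]
              ring
      have hexp : ∑' k : ℕ, (Y * e1) ^ k / k.factorial = Real.exp (Y * e1) := by
        rw [Real.exp_eq_exp_ℝ, NormedSpace.exp_eq_tsum_div]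
      have hsum : HasSum (fun k : ℕ => (κ₃ * M ^ q * (CJ * B * (η * R)) *
          (e1 * Real.exp (-(ε * R)))) * ((Y * e1) ^ k / k.factorial))
          ((κ₃ * M ^ q * (CJ * B * (η * R)) * (e1 * Real.exp (-(ε * R)))) * Real.exp (Y * e1)) := by
        rw [← hexp]
        exact (Real.summable_pow_div_factorial (Y * e1)).hasSum.mul_left _
      refine (tsum_of_norm_bounded hsum hterm).trans ?_
      have hx : Real.exp (-(ε * R)) * Real.exp (Y * e1) = Real.exp (-(ε / 2 * R)) := by
        rw [← Real.exp_add, hYe]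
        congr 1
        ring
      calc _ = κ₃ * M ^ q * (CJ * B * η) * e1 *
            (R * (Real.exp (-(ε * R)) * Real.exp (Y * e1))) := by ring
        _ ≤ κ₃ * M ^ q * (CJ * B * η) * e1 *
            ((S + 1).factorial * (1 / (ε / 2)) ^ (S + 1) * (R ^ S)⁻¹) := by
            rw [hx]
            exact mul_le_mul_of_nonneg_left (rpow_mul_exp_neg_le S (by positivity) hRpos)
              (by positivity)
        _ = _ := by rw [hC2]; ring
    have hmain : |∑' k, v k * g (v k) * φ k x * φ k y| ≤
        (C1 + C2) * B * (M ^ q * (R ^ S)⁻¹) := by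
      rw [hsplit]
      refine (abs_add_le _ _).trans ((add_le_add hdb hheat).trans_eq ?_)
      rw [hC1, mul_pow, mul_inv]
      ring
    refine hmain.trans ?_
    have h1 : (R ^ S)⁻¹ ≤ 2 ^ S * ((1 + R) ^ S)⁻¹ := by
      rw [← div_eq_mul_inv, inv_eq_one_div, div_le_div_iff₀ (by positivity) (by positivity),
        one_mul, ← mul_pow]
      gcongr
      linarith
    calc (C1 + C2) * B * (M ^ q * (R ^ S)⁻¹)
        ≤ (κ₃ + (C1 + C2)) * B * (M ^ q * (2 ^ S * ((1 + R) ^ S)⁻¹)) := by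
          have : 0 < C1 + C2 := by positivity
          have h2 : C1 + C2 ≤ κ₃ + (C1 + C2) := by linarith
          exact mul_le_mul (mul_le_mul_of_nonneg_right h2 hB)
            (mul_le_mul_of_nonneg_left h1 hMq.le) (by positivity) (by positivity)
      _ = _ := by ring

end IsDataDefinedSpace

/-! ### Smooth dyadic profiles of masks. -/

namespace DerivBdd

/-- The chain rule with a constant independent of the shift `τ`. The shift will be the logarithm of
the dyadic frequency, so this is what makes the estimates uniform in scale. -/
lemma exists_comp_add {U : Set ℝ} {w w' : ℝ → ℝ} {W : ℝ} {k : ℕ} (hW : 0 ≤ W)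
    (hw : ∀ v ∈ U, HasDerivAt w (w' v) v) (hw' : DerivBdd U W k w') :
    ∃ C : ℝ, 0 ≤ C ∧ ∀ (V : Set ℝ) (B : ℝ) (E : ℝ → ℝ) (τ : ℝ), 0 ≤ B →
      (∀ v ∈ U, w v + τ ∈ V) → DerivBdd V B k E →
      DerivBdd U (C * B) k (fun v => E (w v + τ)) := by
  induction k with
  | zero =>
    refine ⟨1, zero_le_one, fun V B E τ hB hV hE v hv => ?_⟩
    rw [one_mul]
    exact hE _ (hV v hv)
  | succ k ih =>
    obtain ⟨C, hC, h⟩ := ih hw'.of_succ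
    refine ⟨1 + 2 ^ k * (C * W), by positivity, fun V B E τ hB hV hE => ?_⟩
    obtain ⟨h1, E', h2, h3⟩ := hE
    refine ⟨fun v hv => ?_, fun v => E' (w v + τ) * w' v, fun v hv => ?_, ?_⟩
    · refine (h1 _ (hV v hv)).trans (le_mul_of_one_le_left hB ?_)
      have : 0 ≤ 2 ^ k * (C * W) := by positivity
      linarith
    · exact (h2 _ (hV v hv)).comp v ((hw v hv).add_const τ)
    · refine ((h V B E' τ hB hV h3).mul (by positivity) hW hw'.of_succ).mono subset_rfl ?_
      nlinarith

lemma const_mul {U : Set ℝ} {B : ℝ} {k : ℕ} {f : ℝ → ℝ} (c : ℝ) (h : DerivBdd U B k f) :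
    DerivBdd U (|c| * B) k (fun v => c * f v) := by
  induction k generalizing f with
  | zero =>
    intro v hv
    rw [abs_mul]
    exact mul_le_mul_of_nonneg_left (h v hv) (abs_nonneg c)
  | succ k ih =>
    obtain ⟨h1, f', h2, h3⟩ := h
    refine ⟨fun v hv => ?_, _, fun v hv => (h2 v hv).const_mul c, ih h3⟩
    rw [abs_mul]
    exact mul_le_mul_of_nonneg_left (h1 v hv) (abs_nonneg c)

/-- The derivative of `1/f` is `-f' · (1/f) · (1/f)`, so the induction closes. It is applied to the
factor `F` of the mask, to treat `1/b` like `b`. -/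
lemma exists_inv {U : Set ℝ} {B c : ℝ} {k : ℕ} {f : ℝ → ℝ} (hc : 0 < c) (hB : 0 ≤ B)
    (hf : ∀ v ∈ U, c ≤ f v) (h : DerivBdd U B k f) :
    ∃ B', 0 ≤ B' ∧ DerivBdd U B' k (fun v => (f v)⁻¹) := by
  have hinv : ∀ v ∈ U, |(f v)⁻¹| ≤ c⁻¹ := fun v hv => by
    have h0 : 0 < f v := hc.trans_le (hf v hv)
    rw [abs_of_pos (by positivity)]
    exact inv_anti₀ hc (hf v hv)
  induction k with
  | zero => exact ⟨c⁻¹, by positivity, hinv⟩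
  | succ k ih =>
    obtain ⟨B', hB', h'⟩ := ih h.of_succ
    obtain ⟨h1, f', h2, h3⟩ := h
    have h4 := ((h3.mul hB hB' h').mul (by positivity) hB' h').const_mul (-1)
    refine ⟨c⁻¹ + |-1| * (2 ^ k * (2 ^ k * (B * B') * B')), by positivity, fun v hv => ?_, _,
      fun v hv => ?_, h4.mono subset_rfl ?_⟩
    · refine (hinv v hv).trans (le_add_of_nonneg_right (by positivity))
    · have h0 : 0 < f v := hc.trans_le (hf v hv)
      refine ((h2 v hv).inv h0.ne').congr_deriv ?_
      field_simp
    · have : 0 < c⁻¹ := by positivity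
      linarith

lemma of_iteratedDeriv {c : ℝ} {k : ℕ} {f : ℝ → ℝ} (hf : ContDiff ℝ k f)
    (h : ∀ j, j ≤ k → ∀ u, |iteratedDeriv j f u| ≤ c) : DerivBdd Set.univ c k f := by
  induction k generalizing f with
  | zero =>
    intro v _
    simpa using h 0 le_rfl v
  | succ k ih =>
    have h0 := h 0 (Nat.zero_le _)
    simp only [iteratedDeriv_zero] at h0
    push_cast at hf
    rw [contDiff_succ_iff_deriv] at hf
    refine ⟨fun v _ => h0 v, deriv f, fun v _ => (hf.1 v).hasDerivAt, ih hf.2.2 fun j hj u => ?_⟩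
    rw [← iteratedDeriv_succ']
    exact h (j + 1) (by omega) u

lemma exp_neg (k : ℕ) (a : ℝ) : DerivBdd (Set.Ioi a) (Real.exp (-a)) k
    (fun w => Real.exp (-w)) := by
  have hb : ∀ v ∈ Set.Ioi a, |Real.exp (-v)| ≤ Real.exp (-a) := fun v hv => by
    rw [abs_of_pos (Real.exp_pos _)]
    exact Real.exp_le_exp.2 (neg_le_neg (le_of_lt hv))
  induction k with
  | zero => exact hb
  | succ k ih =>
    refine ⟨hb, fun w => -1 * Real.exp (-w), fun v _ => ?_, by simpa using ih.const_mul (-1)⟩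
    exact ((hasDerivAt_neg v).exp).congr_deriv (by ring)

/-- In the variable `w = log t` one has `(1 + t)^s = t^s (1 + exp(-w))^s`. The last factor is the
smooth correction to homogeneity, bounded once `w` is bounded below. -/
lemma exists_one_add_exp_neg_rpow (k : ℕ) (a s : ℝ) :
    ∃ B, 0 ≤ B ∧ DerivBdd (Set.Ioi a) B k (fun w => (1 + Real.exp (-w)) ^ s) := by
  have hb : ∀ (s : ℝ), ∀ v ∈ Set.Ioi a, |(1 + Real.exp (-v)) ^ s| ≤ (1 + Real.exp (-a)) ^ |s| := by
    intro s v hv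
    have h1 := Real.exp_pos (-v)
    have h2 : Real.exp (-v) ≤ Real.exp (-a) := Real.exp_le_exp.2 (neg_le_neg (le_of_lt hv))
    rw [abs_of_pos (by positivity)]
    calc (1 + Real.exp (-v)) ^ s ≤ (1 + Real.exp (-v)) ^ |s| :=
          Real.rpow_le_rpow_of_exponent_le (by linarith) (le_abs_self s)
      _ ≤ _ := Real.rpow_le_rpow (by positivity) (by linarith) (abs_nonneg s)
  induction k generalizing s with
  | zero => exact ⟨_, by positivity, hb s⟩
  | succ k ih =>
    obtain ⟨B, hB, h⟩ := ih (s - 1)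
    have h4 := ((exp_neg k a).mul (Real.exp_pos _).le hB h).const_mul (-s)
    refine ⟨(1 + Real.exp (-a)) ^ |s| + |-s| * (2 ^ k * (Real.exp (-a) * B)), by positivity,
      fun v hv => ?_, _, fun v hv => ?_, h4.mono subset_rfl ?_⟩
    · exact (hb s v hv).trans (le_add_of_nonneg_right (by positivity))
    · have h0 : (1 + Real.exp (-v)) ≠ 0 := by positivity
      refine ((((hasDerivAt_neg v).exp).const_add 1).rpow_const (p := s) (Or.inl h0)).congr_deriv ?_
      ring
    · have : 0 ≤ (1 + Real.exp (-a)) ^ |s| := by positivity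
      linarith

end DerivBdd

/-- A smooth cutoff: `1` on `(-∞, 1]` and `0` on `[2, ∞)`. -/
def cutoff (u : ℝ) : ℝ := Real.smoothTransition (2 - u)

/-- A smooth bump on `[1/2, 2]` whose dyadic dilates telescope. -/
def bump (u : ℝ) : ℝ := cutoff u - cutoff (2 * u)

lemma cutoff_nonneg (u : ℝ) : 0 ≤ cutoff u := Real.smoothTransition.nonneg _

lemma cutoff_le_one (u : ℝ) : cutoff u ≤ 1 := Real.smoothTransition.le_one _

lemma cutoff_eq_one {u : ℝ} (hu : u ≤ 1) : cutoff u = 1 :=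
  Real.smoothTransition.one_of_one_le (by linarith)

lemma cutoff_eq_zero {u : ℝ} (hu : 2 ≤ u) : cutoff u = 0 :=
  Real.smoothTransition.zero_of_nonpos (by linarith)

lemma contDiff_cutoff : ContDiff ℝ (⊤ : ℕ∞) cutoff :=
  Real.smoothTransition.contDiff.comp (contDiff_const.sub contDiff_id)

lemma contDiff_bump : ContDiff ℝ (⊤ : ℕ∞) bump :=
  contDiff_cutoff.sub (contDiff_cutoff.comp (contDiff_const.mul contDiff_id))

lemma bump_eq_zero {u : ℝ} (hu : u ∉ Set.Ioo (1 / 2) 2) : bump u = 0 := by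
  rw [Set.mem_Ioo, not_and_or, not_lt, not_lt] at hu
  rcases hu with hu | hu
  · rw [bump, cutoff_eq_one (by linarith), cutoff_eq_one (by linarith), sub_self]
  · rw [bump, cutoff_eq_zero hu, cutoff_eq_zero (by linarith), sub_self]

/-- `bump u * u ^ s * E (log u + τ)` is `v * g v` with `v = exp (-u ^ 2)` and `g` smooth,
uniformly in `τ ≥ 0`. -/
lemma exists_bump_profile (S : ℕ) (s : ℝ) :
    ∃ C : ℝ, 0 ≤ C ∧ ∀ (E : ℝ → ℝ) (B : ℝ), 0 ≤ B → DerivBdd (Set.Ioi (-2)) B S E →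
      ∀ τ, 0 ≤ τ → ∃ g : ℝ → ℝ, DerivBdd Set.univ (C * B) S g ∧
        (∀ v, v ∉ Set.Icc (0 : ℝ) 1 → g v = 0) ∧ ∀ u, 0 ≤ u →
          Real.exp (-u ^ 2) * g (Real.exp (-u ^ 2)) = bump u * u ^ s * E (Real.log u + τ) := by
  -- If `v = exp(-u²)` with `u > 0`, then `u = ℓ v` and `log u = w v`. The division by `v` in `Θ`
  -- cancels the prefactor `v` of the desired identity.
  set ℓ : ℝ → ℝ := fun v => Real.sqrt (-Real.log v) with hℓ
  set w : ℝ → ℝ := fun v => (1 / 2) * Real.log (-Real.log v) with hw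
  set w' : ℝ → ℝ := fun v => (1 / 2) * (-v⁻¹ / -Real.log v) with hw'
  set Θ : ℝ → ℝ := fun v => bump (ℓ v) * ℓ v ^ s / v with hΘ
  set O : Set ℝ := Set.Ioo 0 1
  -- `T` corresponds to `1/2 ≤ u ≤ 2`, which contains the support of `bump`; `K` corresponds to `1/3
  -- ≤ u ≤ 3`. The margin permits extension by zero, and on `U` one still has `log u > -2`, so `log
  -- u + τ` stays in the domain where `E` is controlled.
  set K : Set ℝ := Set.Icc (Real.exp (-9)) (Real.exp (-(1 / 9))) with hK
  set U : Set ℝ := Set.Ioo (Real.exp (-9)) (Real.exp (-(1 / 9))) with hU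
  set T : Set ℝ := Set.Icc (Real.exp (-4)) (Real.exp (-(1 / 4))) with hT
  have hKO : K ⊆ O := fun v hv =>
    ⟨(Real.exp_pos _).trans_le hv.1, hv.2.trans_lt (by rw [Real.exp_lt_one_iff]; norm_num)⟩
  have hUK : U ⊆ K := Set.Ioo_subset_Icc_self
  have hlog : ∀ v ∈ O, 0 < -Real.log v := fun v hv => by
    have := Real.log_neg hv.1 hv.2
    linarith
  have clog : ContDiffOn ℝ (⊤ : ℕ∞) (fun v => -Real.log v) O :=
    (contDiffOn_id.log fun v hv => hv.1.ne').neg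
  have cℓ : ContDiffOn ℝ (⊤ : ℕ∞) ℓ O := clog.sqrt fun v hv => (hlog v hv).ne'
  have cΘ : ContDiffOn ℝ (⊤ : ℕ∞) Θ O := by
    refine ((contDiff_bump.comp_contDiffOn cℓ).mul
      (cℓ.rpow_const_of_ne fun v hv => (Real.sqrt_pos.2 (hlog v hv)).ne')).div contDiffOn_id
      fun v hv => hv.1.ne'
  have cw' : ContDiffOn ℝ (⊤ : ℕ∞) w' O := by
    refine contDiffOn_const.mul (ContDiffOn.div (contDiffOn_id.inv fun v hv => hv.1.ne').neg clog
      fun v hv => (hlog v hv).ne')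
  have dw : ∀ v ∈ U, HasDerivAt w (w' v) v := fun v hv => by
    have hv' := hKO (hUK hv)
    exact (((Real.hasDerivAt_log hv'.1.ne').neg).log (hlog v hv').ne').const_mul _
  obtain ⟨B1, hB1, h1⟩ := DerivBdd.exists_of_contDiffOn isOpen_Ioo isCompact_Icc hKO cΘ S
  obtain ⟨B2, hB2, h2⟩ := DerivBdd.exists_of_contDiffOn isOpen_Ioo isCompact_Icc hKO cw' S
  obtain ⟨C, hC, h3⟩ := DerivBdd.exists_comp_add hB2 dw (h2.mono hUK le_rfl)
  refine ⟨2 ^ S * (B1 * C), by positivity, fun E B hB hE τ hτ => ?_⟩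
  have hwU : ∀ v ∈ U, w v + τ ∈ Set.Ioi (-2 : ℝ) := fun v hv => by
    have hv' := hKO (hUK hv)
    have h4 : 1 / 9 < -Real.log v := by
      have := (Real.log_lt_iff_lt_exp hv'.1).2 hv.2
      linarith
    have h5 : Real.log (1 / 9) < Real.log (-Real.log v) := Real.log_lt_log (by norm_num) h4
    have h6 : -4 ≤ Real.log (1 / 9) := by
      rw [Real.le_log_iff_exp_le (by norm_num), Real.exp_neg, one_div]
      refine inv_anti₀ (by norm_num) ?_
      have := Real.pow_div_factorial_le_exp (4 : ℝ) (by norm_num) 2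
      have h7 := Real.pow_div_factorial_le_exp (4 : ℝ) (by norm_num) 3
      norm_num [Nat.factorial] at h7
      linarith
    simp only [hw, Set.mem_Ioi]
    linarith
  have h4 := (h1.mono hUK le_rfl).mul hB1 (by positivity) (h3 _ B E τ hB hwU hE)
  classical
  set g : ℝ → ℝ := fun v => if v ∈ T then Θ v * E (w v + τ) else 0 with hg
  have hbz : ∀ v ∈ U, v ∉ T → bump (ℓ v) = 0 := fun v hv hvT => by
    have hv' := hKO (hUK hv)
    refine bump_eq_zero fun hcon => hvT ?_
    have h5 := Real.sq_sqrt (hlog v hv').le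
    have h6 : (1 / 2 : ℝ) ^ 2 < ℓ v ^ 2 := by gcongr; exact hcon.1
    have h7 : ℓ v ^ 2 < 2 ^ 2 := by gcongr; exact hcon.2
    simp only [hℓ, h5] at h6 h7
    refine ⟨?_, ?_⟩
    · rw [← Real.le_log_iff_exp_le hv'.1]; linarith
    · rw [← Real.log_le_iff_le_exp hv'.1]; linarith
  have h5 : DerivBdd U (2 ^ S * (B1 * (C * B))) S g := h4.congr isOpen_Ioo fun v hv => by
    simp only [hg]
    split_ifs with hvT
    · rfl
    · simp [hΘ, hbz v hv hvT]
  have hTU : T ⊆ U := fun v hv =>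
    ⟨lt_of_lt_of_le (Real.exp_lt_exp.2 (by norm_num)) hv.1,
      lt_of_le_of_lt hv.2 (Real.exp_lt_exp.2 (by norm_num))⟩
  have h6 := h5.extend (by positivity) isOpen_Ioo isClosed_Icc hTU fun v hv => by
    exact if_neg hv
  refine ⟨g, h6.mono subset_rfl (by rw [mul_assoc, mul_assoc]), fun v hv => ?_, fun u hu => ?_⟩
  · simp only [hg]
    rw [if_neg]
    intro hvT
    have := hKO (hUK (hTU hvT))
    exact hv ⟨this.1.le, this.2.le⟩
  · simp only [hg]
    split_ifs with hvT
    · have hu0 : u ≠ 0 := by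
        rintro rfl
        have := (hKO (hUK (hTU hvT))).2
        simp at this
      simp only [hΘ, hℓ, hw, Real.log_exp, neg_neg, Real.sqrt_sq hu, Real.log_pow]
      have hne := (Real.exp_pos (-u ^ 2)).ne'
      push_cast
      rw [← mul_assoc (1 / 2 : ℝ)]
      norm_num
      field_simp
    · rw [bump_eq_zero, mul_zero, zero_mul, zero_mul]
      intro hcon
      refine hvT ⟨Real.exp_le_exp.2 ?_, Real.exp_le_exp.2 ?_⟩ <;> nlinarith [hcon.1, hcon.2]

/-- The integral kernel of the spectral multiplier `m`. -/
def spectralKernel {X : Type*} (lam : ℕ → ℝ) (φ : ℕ → X → ℝ) (m : ℝ → ℝ) (x y : X) : ℝ :=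
  ∑' k, m (lam k) * φ k x * φ k y

lemma spectralKernel_comm {X : Type*} (lam : ℕ → ℝ) (φ : ℕ → X → ℝ) (m : ℝ → ℝ) (x y : X) :
    spectralKernel lam φ m x y = spectralKernel lam φ m y x :=
  tsum_congr fun k => by ring

namespace IsMask

variable {S : ℕ} {β : ℝ} {b : ℝ → ℝ}

lemma exists_profile (hb : IsMask S β b) : ∃ (F : ℝ → ℝ) (c c₁ : ℝ), 0 ≤ c ∧ 0 < c₁ ∧
    (∀ t, 0 < t → b t = (1 + t) ^ (-β) * F (Real.log t)) ∧ DerivBdd Set.univ c S F ∧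
    ∀ u, c₁ ≤ F u := by
  obtain ⟨F, c, c₁, hc₁, h1, h2, h3⟩ := hb.exists_factor
  have hc : 0 ≤ c := (abs_nonneg _).trans (h2 0 (Nat.zero_le _) 0)
  have hF : F = fun u => (1 + Real.exp u) ^ β * b (Real.exp u) := by
    ext u
    have h0 : 0 < 1 + Real.exp u := by positivity
    rw [h1 _ (Real.exp_pos u), Real.log_exp, ← mul_assoc, ← Real.rpow_add h0]
    simp
  have hcd : ContDiff ℝ S F := by
    rw [hF]
    exact ((contDiff_const.add Real.contDiff_exp).rpow_const_of_ne
      fun u => by positivity).mul (hb.contDiff.comp Real.contDiff_exp)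
  exact ⟨F, c, c₁, hc, hc₁, h1, DerivBdd.of_iteratedDeriv hcd h2, h3⟩

/-- At `t = 0` the factorization says nothing directly, but the lower bound on `F` passes to the
limit by continuity of `b`. -/
lemma pos (hb : IsMask S β b) {t : ℝ} (ht : 0 ≤ t) : 0 < b t := by
  obtain ⟨F, c, c₁, _, hc₁, h1, _, h3⟩ := hb.exists_profile
  rcases ht.lt_or_eq with ht | rfl
  · rw [h1 t ht]
    have := hc₁.trans_le (h3 (Real.log t))
    positivity
  · have hlim : Tendsto (fun t : ℝ => c₁ * (1 + t) ^ (-β)) (𝓝[>] 0) (𝓝 c₁) := by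
      have : ContinuousAt (fun t : ℝ => c₁ * (1 + t) ^ (-β)) 0 :=
        continuousAt_const.mul ((continuousAt_const.add continuousAt_id).rpow_const
          (Or.inl (by simp)))
      have := this.tendsto.mono_left (nhdsWithin_le_nhds (s := Set.Ioi 0))
      simpa using this
    have hlim2 : Tendsto b (𝓝[>] 0) (𝓝 (b 0)) :=
      hb.contDiff.continuous.continuousAt.tendsto.mono_left nhdsWithin_le_nhds
    refine hc₁.trans_le (le_of_tendsto_of_tendsto hlim hlim2 ?_)
    filter_upwards [self_mem_nhdsWithin] with t ht
    rw [h1 t ht, mul_comm]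
    have : 0 < 1 + t := by linarith [Set.mem_Ioi.1 ht]
    exact mul_le_mul_of_nonneg_left (h3 _) (by positivity)

lemma exists_inv_le (hb : IsMask S β b) (a : ℝ) :
    ∃ C, 0 < C ∧ ∀ t, 0 ≤ t → t ≤ a → (b t)⁻¹ ≤ C := by
  rcases le_or_gt 0 a with ha | ha
  · obtain ⟨t₀, ht₀, hmin⟩ := isCompact_Icc.exists_isMinOn (Set.nonempty_Icc.2 ha)
      (hb.contDiff.continuous.continuousOn)
    have h0 := hb.pos ht₀.1
    exact ⟨(b t₀)⁻¹, by positivity, fun t h1 h2 => inv_anti₀ h0 (hmin ⟨h1, h2⟩)⟩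
  · exact ⟨1, one_pos, fun t h1 h2 => by linarith⟩

end IsMask

lemma telescope_bump (t : ℝ) {N : ℝ} (L : ℕ) :
    cutoff (2 * t / (N * 2 ^ L)) =
      cutoff (2 * t / N) + ∑ j ∈ Finset.range L, bump (t / (N * 2 ^ j)) := by
  induction L with
  | zero => simp
  | succ L ih =>
    rw [Finset.sum_range_succ, ← add_assoc, ← ih, bump]
    have h1 : 2 * t / (N * 2 ^ (L + 1)) = t / (N * 2 ^ L) := by
      rw [pow_succ, ← mul_assoc, mul_comm (N * 2 ^ L) 2, mul_div_mul_left _ _ two_ne_zero]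
    have h2 : 2 * (t / (N * 2 ^ L)) = 2 * t / (N * 2 ^ L) := by ring
    rw [h1, h2]
    ring

/-- The downward telescoping decomposes a polynomial of degree below `N`, whereas `telescope_bump`
runs upward from `N` and decomposes the tail of the kernel. -/
lemma telescope_bump_low (t : ℝ) {N : ℝ} (J : ℕ) :
    cutoff (t / N) = (∑ j ∈ Finset.range J, bump (t / (N / 2 ^ j))) + cutoff (t / (N / 2 ^ J)) := by
  induction J with
  | zero => simp
  | succ J ih =>
    rw [Finset.sum_range_succ, add_assoc, ih, bump]
    have h1 : t / (N / 2 ^ (J + 1)) = 2 * (t / (N / 2 ^ J)) := by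
      rw [pow_succ]; simp only [div_div_eq_mul_div]; ring
    rw [h1]
    ring

/-! ### Kernels of band-limited multipliers and of dyadic pieces. -/

namespace IsDataDefinedSpace

variable {X : Type*} [TopologicalSpace X] [MeasurableSpace X]
  {ρ : X → X → ℝ} {μ : Measure X} {lam : ℕ → ℝ} {φ : ℕ → X → ℝ} {q κ₁ κ₂ κ₃ κ₄ : ℝ}

lemma lam_nonneg (h : IsDataDefinedSpace ρ μ lam φ q κ₁ κ₂ κ₃ κ₄) (k : ℕ) : 0 ≤ lam k := by
  rw [← h.lam_zero]
  exact h.lam_mono (Nat.zero_le k)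

lemma finite_lam_lt (h : IsDataDefinedSpace ρ μ lam φ q κ₁ κ₂ κ₃ κ₄) (N : ℝ) :
    {k | lam k < N}.Finite := by
  obtain ⟨k₀, hk₀⟩ := (h.lam_tendsto.eventually_ge_atTop N).exists_forall_of_atTop
  exact (Set.finite_lt_nat k₀).subset fun k hk => by
    by_contra hcon
    exact absurd (hk₀ k (not_lt.1 hcon)) (not_le.2 hk)

/-- The indices of the eigenvalues below `N`. -/
def indices (h : IsDataDefinedSpace ρ μ lam φ q κ₁ κ₂ κ₃ κ₄) (N : ℝ) : Finset ℕ :=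
  (h.finite_lam_lt N).toFinset

lemma mem_indices (h : IsDataDefinedSpace ρ μ lam φ q κ₁ κ₂ κ₃ κ₄) {N : ℝ} {k : ℕ} :
    k ∈ h.indices N ↔ lam k < N := by simp [indices]

lemma spectralKernel_eq_sum (h : IsDataDefinedSpace ρ μ lam φ q κ₁ κ₂ κ₃ κ₄) {m : ℝ → ℝ} {N : ℝ}
    (hm : ∀ l, N ≤ l → m l = 0) (x y : X) :
    spectralKernel lam φ m x y = ∑ k ∈ h.indices N, m (lam k) * φ k x * φ k y :=
  tsum_eq_sum fun k hk => by
    rw [h.mem_indices, not_lt] at hk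
    rw [hm _ hk, zero_mul, zero_mul]

lemma exists_abs_spectralKernel_le (h : IsDataDefinedSpace ρ μ lam φ q κ₁ κ₂ κ₃ κ₄) {m : ℝ → ℝ}
    {N : ℝ} (hm : ∀ l, N ≤ l → m l = 0) :
    ∃ C, 0 ≤ C ∧ ∀ x y, |spectralKernel lam φ m x y| ≤ C := by
  choose c hc using h.phi_bounded
  obtain ⟨x₀⟩ := h.nonempty
  have hc0 : ∀ k, 0 ≤ c k := fun k => (abs_nonneg _).trans (hc k x₀)
  refine ⟨∑ k ∈ h.indices N, |m (lam k)| * c k * c k,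
    Finset.sum_nonneg fun k _ => mul_nonneg (mul_nonneg (abs_nonneg _) (hc0 k)) (hc0 k),
    fun x y => ?_⟩
  rw [h.spectralKernel_eq_sum hm]
  refine (Finset.abs_sum_le_sum_abs _ _).trans (Finset.sum_le_sum fun k _ => ?_)
  rw [abs_mul, abs_mul]
  have := hc0 k
  gcongr
  · exact hc k x
  · exact hc k y

/-- Localization of a dyadic piece of a multiplier of order `σ`. -/
lemma exists_bump_kernel_le {κ₃ κ₄ Δ : ℝ} (q : ℝ) (hκ₄ : 0 < κ₄) (hΔ : 0 < Δ) (hκ₃ : 0 < κ₃)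
    (S : ℕ) (hS : 1 ≤ S) (ρ : X → X → ℝ) (hρΔ : ∀ x y, ρ x y ≤ Δ) {σ c : ℝ} {F m : ℝ → ℝ}
    (hc : 0 ≤ c) (hF : DerivBdd (Set.Ioi (-2)) c S F)
    (hm : ∀ t, 0 < t → m t = (1 + t) ^ σ * F (Real.log t)) :
    ∃ C : ℝ, 0 < C ∧ ∀ (μ : Measure X) (lam : ℕ → ℝ) (φ : ℕ → X → ℝ) (κ₁ κ₂ : ℝ),
    IsDataDefinedSpace ρ μ lam φ q κ₁ κ₂ κ₃ κ₄ → ∀ M : ℝ, 1 ≤ M → ∀ x y,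
      |spectralKernel lam φ (fun t => bump (t / M) * m t) x y| ≤
        C * M ^ σ * decay q S M (ρ x y) := by
  obtain ⟨C, hC, hloc⟩ := exists_localization q hκ₄ hΔ hκ₃ S hS ρ hρΔ
  obtain ⟨C', hC', hprof⟩ := exists_bump_profile S σ
  obtain ⟨B, hB, hexp⟩ := DerivBdd.exists_one_add_exp_neg_rpow S (-2) σ
  have hE := hexp.mul hB hc hF
  set B' := 2 ^ S * (B * c) with hB'
  have hB'0 : 0 ≤ B' := by positivity
  refine ⟨C * (C' * B') + 1, by positivity, fun μ lam φ κ₁ κ₂ h M hM x y => ?_⟩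
  have hM0 : 0 < M := by linarith
  obtain ⟨g, hg1, hg2, hg3⟩ := hprof _ _ hB'0 hE (Real.log M) (Real.log_nonneg hM)
  -- With `u = l / M`, `(1 + l)^σ = M^σ u^σ (1 + exp(-log l))^σ` and `log l = log u + log M`; hence
  -- the shift `τ = log M`, which is nonnegative because `M ≥ 1`.
  have key : ∀ l, 0 ≤ l → bump (l / M) * m l =
      M ^ σ * (Real.exp (-l ^ 2 * (1 / M ^ 2)) * g (Real.exp (-l ^ 2 * (1 / M ^ 2)))) := by
    intro l hl
    have h1 : -l ^ 2 * (1 / M ^ 2) = -(l / M) ^ 2 := by field_simp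
    rw [h1, hg3 _ (by positivity)]
    rcases hl.lt_or_eq with hl | rfl
    · have h2 : Real.log (l / M) + Real.log M = Real.log l := by
        rw [Real.log_div hl.ne' hM0.ne']; ring
      have h3 : (1 + Real.exp (-Real.log l)) = (1 + l) / l := by
        rw [Real.exp_neg, Real.exp_log hl]; field_simp; ring
      simp only [h2, h3]
      rw [hm l hl, Real.div_rpow hl.le hM0.le, Real.div_rpow (by positivity) hl.le]
      have h4 : 0 < l ^ σ := by positivity
      have h5 : 0 < M ^ σ := by positivity
      field_simp
    · rw [zero_div, bump_eq_zero (by norm_num)]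
      simp
  have hk : spectralKernel lam φ (fun t => bump (t / M) * m t) x y =
      M ^ σ * ∑' k, Real.exp (-(lam k) ^ 2 * (1 / M ^ 2)) *
        g (Real.exp (-(lam k) ^ 2 * (1 / M ^ 2))) * φ k x * φ k y := by
    rw [spectralKernel, ← tsum_mul_left]
    refine tsum_congr fun k => ?_
    rw [key _ (h.lam_nonneg k)]
    ring
  have h1 := hloc μ lam φ κ₁ κ₂ h _ g hg1 hg2 M hM x y
  have h2 := decay_nonneg (q := q) (s := S) hM0.le (h.quasiMetric.nonneg x y)
  have h5 : 0 < M ^ σ := by positivity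
  rw [hk, abs_mul, abs_of_pos h5]
  calc M ^ σ * _ ≤ M ^ σ * (C * (C' * B') * decay q S M (ρ x y)) :=
        mul_le_mul_of_nonneg_left h1 h5.le
    _ = (C * (C' * B')) * M ^ σ * decay q S M (ρ x y) := by ring
    _ ≤ _ := by
      refine mul_le_mul_of_nonneg_right (mul_le_mul_of_nonneg_right ?_ h5.le) h2
      linarith

variable {𝕜 : Type*} [RCLike 𝕜]

section

variable [BorelSpace X]

lemma measurable_spectralKernel (h : IsDataDefinedSpace ρ μ lam φ q κ₁ κ₂ κ₃ κ₄) {m : ℝ → ℝ}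
    {N : ℝ} (hm : ∀ l, N ≤ l → m l = 0) :
    Measurable (Function.uncurry (spectralKernel lam φ m)) := by
  have : Function.uncurry (spectralKernel lam φ m) =
      fun z : X × X => ∑ k ∈ h.indices N, m (lam k) * φ k z.1 * φ k z.2 := by
    ext z
    exact h.spectralKernel_eq_sum hm z.1 z.2
  rw [this]
  refine Finset.measurable_sum _ fun k _ => ?_
  exact (((h.measurable_phi k).comp measurable_fst).const_mul _).mul
    ((h.measurable_phi k).comp measurable_snd)

lemma integrable_mul_phi (h : IsDataDefinedSpace ρ μ lam φ q κ₁ κ₂ κ₃ κ₄) {f : X → 𝕜}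
    (hf : Integrable f μ) (k : ℕ) : Integrable (fun y => f y * (φ k y : 𝕜)) μ := by
  obtain ⟨C, hC⟩ := h.phi_bounded k
  refine hf.mul_bdd (c := C) ?_ (Eventually.of_forall fun y => ?_)
  · exact (RCLike.measurable_ofReal.comp (h.measurable_phi k)).aestronglyMeasurable
  · rw [RCLike.norm_ofReal]
    exact hC y

lemma integral_spectralKernel_mul (h : IsDataDefinedSpace ρ μ lam φ q κ₁ κ₂ κ₃ κ₄) {m : ℝ → ℝ}
    {N : ℝ} (hm : ∀ l, N ≤ l → m l = 0) {f : X → 𝕜} (hf : Integrable f μ) (x : X) :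
    ∫ y, (spectralKernel lam φ m x y : 𝕜) * f y ∂μ =
      ∑ k ∈ h.indices N, ((m (lam k) * φ k x : ℝ) : 𝕜) * fourierCoef μ φ f k := by
  simp only [h.spectralKernel_eq_sum hm]
  have : ∀ y, ((∑ k ∈ h.indices N, m (lam k) * φ k x * φ k y : ℝ) : 𝕜) * f y =
      ∑ k ∈ h.indices N, ((m (lam k) * φ k x : ℝ) : 𝕜) * (f y * (φ k y : 𝕜)) := by
    intro y
    push_cast
    rw [Finset.sum_mul]
    exact Finset.sum_congr rfl fun k _ => by ring
  simp only [this]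
  rw [integral_finsetSum _ fun k _ => (h.integrable_mul_phi hf k).const_mul _]
  exact Finset.sum_congr rfl fun k _ => integral_const_mul _ _

end

end IsDataDefinedSpace

/-! ### Schur's test, interpolation and Hölder's inequality. -/

section Analysis

variable {X : Type*} [MeasurableSpace X] {μ : Measure X}

/-- Schur's test. -/
lemma eLpNorm_le_of_kernel [SFinite μ] {E F : Type*} [NormedAddCommGroup E] [NormedAddCommGroup F]
    {k : X → X → ℝ≥0∞} (hk : Measurable (Function.uncurry k)) {C : ℝ≥0∞} (hC : C ≠ ∞)
    (h1 : ∀ x, ∫⁻ y, k x y ∂μ ≤ C) (h2 : ∀ y, ∫⁻ x, k x y ∂μ ≤ C) {p : ℝ≥0∞} (hp : 1 ≤ p)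
    {u : X → E} {v : X → F} (hv : AEStronglyMeasurable v μ)
    (huv : ∀ x, ‖u x‖ₑ ≤ ∫⁻ y, k x y * ‖v y‖ₑ ∂μ) :
    eLpNorm u p μ ≤ C * eLpNorm v p μ := by
  have hkx : ∀ x, Measurable (k x) := fun x => hk.comp measurable_prodMk_left
  rcases eq_or_ne p ∞ with rfl | hp_top
  · rw [eLpNorm_exponent_top, eLpNorm_exponent_top]
    refine essSup_le_of_ae_le _ (Eventually.of_forall fun x => (huv x).trans ?_)
    calc ∫⁻ y, k x y * ‖v y‖ₑ ∂μ ≤ ∫⁻ y, k x y * eLpNormEssSup v μ ∂μ := by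
          refine lintegral_mono_ae ?_
          filter_upwards [enorm_ae_le_eLpNormEssSup v μ] with y hy
          exact mul_le_mul' le_rfl hy
      _ = (∫⁻ y, k x y ∂μ) * eLpNormEssSup v μ := lintegral_mul_const _ (hkx x)
      _ ≤ _ := mul_le_mul' (h1 x) le_rfl
  · have hp0 : p ≠ 0 := (zero_lt_one.trans_le hp).ne'
    set s := p.toReal with hs
    have hs1 : 1 ≤ s := by
      rw [hs, ← ENNReal.toReal_one]
      exact ENNReal.toReal_mono hp_top hp
    have hs0 : 0 < s := by linarith
    have hve : AEMeasurable (fun y => ‖v y‖ₑ ^ s) μ := hv.enorm.pow_const s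
    -- Hölder's inequality for the measure with density `k x`, whose total mass is at most `C`.
    -- Integrating in `x` then uses the other marginal bound.
    have hpt : ∀ x, ‖u x‖ₑ ^ s ≤ C ^ (s - 1) * ∫⁻ y, k x y * ‖v y‖ₑ ^ s ∂μ := by
      intro x
      have hac := withDensity_absolutelyContinuous μ (k x)
      have h3 := eLpNorm'_le_eLpNorm'_mul_rpow_measure_univ (μ := μ.withDensity (k x))
        zero_lt_one hs1 (hv.mono_ac hac)
      rw [eLpNorm'_eq_lintegral_enorm, eLpNorm'_eq_lintegral_enorm] at h3
      simp only [ENNReal.rpow_one, div_one] at h3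
      rw [lintegral_withDensity_eq_lintegral_mul₀ (hkx x).aemeasurable hv.enorm,
        lintegral_withDensity_eq_lintegral_mul₀ (hkx x).aemeasurable hve,
        withDensity_apply _ MeasurableSet.univ, setLIntegral_univ] at h3
      have h4 := (huv x).trans h3
      calc ‖u x‖ₑ ^ s ≤ ((∫⁻ y, k x y * ‖v y‖ₑ ^ s ∂μ) ^ (1 / s) *
            (∫⁻ y, k x y ∂μ) ^ (1 - 1 / s)) ^ s := by
            gcongr
            exact h4
        _ = (∫⁻ y, k x y ∂μ) ^ (s - 1) * ∫⁻ y, k x y * ‖v y‖ₑ ^ s ∂μ := by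
            rw [ENNReal.mul_rpow_of_nonneg _ _ hs0.le, ← ENNReal.rpow_mul, ← ENNReal.rpow_mul,
              one_div_mul_cancel hs0.ne', ENNReal.rpow_one, mul_comm, sub_mul, one_mul,
              one_div_mul_cancel hs0.ne']
        _ ≤ _ := by
            gcongr
            exact h1 x
    rw [eLpNorm_eq_lintegral_rpow_enorm_toReal hp0 hp_top,
      eLpNorm_eq_lintegral_rpow_enorm_toReal hp0 hp_top, ← hs]
    have hint : ∫⁻ x, ‖u x‖ₑ ^ s ∂μ ≤ C ^ s * ∫⁻ y, ‖v y‖ₑ ^ s ∂μ := by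
      have hpm : AEMeasurable (Function.uncurry fun x y => k x y * ‖v y‖ₑ ^ s) (μ.prod μ) :=
        hk.aemeasurable.mul hve.comp_snd
      calc ∫⁻ x, ‖u x‖ₑ ^ s ∂μ ≤ ∫⁻ x, C ^ (s - 1) * ∫⁻ y, k x y * ‖v y‖ₑ ^ s ∂μ ∂μ :=
            lintegral_mono hpt
        _ = C ^ (s - 1) * ∫⁻ x, ∫⁻ y, k x y * ‖v y‖ₑ ^ s ∂μ ∂μ :=
            lintegral_const_mul' _ _ (ENNReal.rpow_ne_top_of_nonneg (by linarith) hC)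
        _ = C ^ (s - 1) * ∫⁻ y, ∫⁻ x, k x y * ‖v y‖ₑ ^ s ∂μ ∂μ := by
            rw [lintegral_lintegral_swap hpm]
        _ = C ^ (s - 1) * ∫⁻ y, (∫⁻ x, k x y ∂μ) * ‖v y‖ₑ ^ s ∂μ := by
            congr 1
            refine lintegral_congr fun y => ?_
            rw [lintegral_mul_const]
            exact hk.comp measurable_prodMk_right
        _ ≤ C ^ (s - 1) * ∫⁻ y, C * ‖v y‖ₑ ^ s ∂μ := by
            gcongr with y
            exact h2 y
        _ = _ := by
            rw [lintegral_const_mul' _ _ hC, ← mul_assoc]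
            congr 1
            have : s = (s - 1) + 1 := by ring
            conv_rhs => rw [this, ENNReal.rpow_add_of_nonneg _ _ (by linarith) zero_le_one,
              ENNReal.rpow_one]
    calc (∫⁻ x, ‖u x‖ₑ ^ s ∂μ) ^ (1 / s) ≤ (C ^ s * ∫⁻ y, ‖v y‖ₑ ^ s ∂μ) ^ (1 / s) := by gcongr
      _ = _ := by
        rw [ENNReal.mul_rpow_of_nonneg _ _ (by positivity), ← ENNReal.rpow_mul,
          mul_one_div_cancel hs0.ne', ENNReal.rpow_one]

/-- Interpolation between a uniform and an `L¹` bound. -/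
lemma eLpNorm_conjExponent_le {E : Type*} [NormedAddCommGroup E] {p : ℝ≥0∞} (hp : 1 ≤ p)
    {u : X → E} {a Q : ℝ≥0∞} (h1 : ∀ y, ‖u y‖ₑ ≤ a * Q) (h2 : ∫⁻ y, ‖u y‖ₑ ∂μ ≤ a) :
    eLpNorm u p.conjExponent μ ≤ a * Q ^ (p⁻¹).toReal := by
  have hconj := ENNReal.HolderConjugate.conjExponent hp
  rcases eq_or_ne p.conjExponent ∞ with htop | htop
  · rw [htop, eLpNorm_exponent_top]
    have hp1 : p⁻¹ = 1 := by
      have := hconj.inv_add_inv_eq_inv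
      rw [htop] at this
      simpa using this
    rw [hp1, ENNReal.toReal_one, ENNReal.rpow_one]
    exact essSup_le_of_ae_le _ (Eventually.of_forall h1)
  · have hc1 : 1 ≤ p.conjExponent := ENNReal.HolderConjugate.one_le p.conjExponent p
    have hc0 : p.conjExponent ≠ 0 := (zero_lt_one.trans_le hc1).ne'
    set s := p.conjExponent.toReal with hs
    have hs1 : 1 ≤ s := by
      rw [hs, ← ENNReal.toReal_one]
      exact ENNReal.toReal_mono htop hc1
    have hs0 : 0 < s := by linarith
    have hps : (p⁻¹).toReal = 1 - 1 / s := by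
      have := congrArg ENNReal.toReal hconj.inv_add_inv_eq_inv
      rw [ENNReal.toReal_add (by simpa using (zero_lt_one.trans_le hp).ne') (by simpa using hc0),
        ENNReal.toReal_inv p.conjExponent, inv_one, ENNReal.toReal_one] at this
      rw [one_div, ← this]
      ring
    rw [eLpNorm_eq_lintegral_rpow_enorm_toReal hc0 htop, ← hs, hps]
    -- All but one power of `u` are estimated uniformly and the last one in `L¹`; this leaves `Q`
    -- with exponent `1 - 1/s`, which is `1/p`.
    have hpt : ∀ y, ‖u y‖ₑ ^ s ≤ (a * Q) ^ (s - 1) * ‖u y‖ₑ := fun y => by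
      have : s = (s - 1) + 1 := by ring
      conv_lhs => rw [this, ENNReal.rpow_add_of_nonneg _ _ (by linarith) zero_le_one,
        ENNReal.rpow_one]
      gcongr
      exact h1 y
    have hint : ∫⁻ y, ‖u y‖ₑ ^ s ∂μ ≤ (a * Q) ^ (s - 1) * a := by
      refine (lintegral_mono hpt).trans ?_
      rcases eq_or_ne ((a * Q) ^ (s - 1)) ∞ with h3 | h3
      · rcases eq_or_ne a 0 with rfl | ha
        · have : ∀ y, ‖u y‖ₑ = 0 := fun y => le_antisymm (by simpa using h1 y) zero_le
          simp [this]
        · rw [h3, ENNReal.top_mul ha]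
          exact le_top
      · rw [lintegral_const_mul' _ _ h3]
        gcongr
    calc (∫⁻ y, ‖u y‖ₑ ^ s ∂μ) ^ (1 / s) ≤ ((a * Q) ^ (s - 1) * a) ^ (1 / s) := by gcongr
      _ = (a ^ (s - 1) * Q ^ (s - 1) * a) ^ (1 / s) := by
          rw [ENNReal.mul_rpow_of_nonneg _ _ (by linarith : 0 ≤ s - 1)]
      _ = (a ^ s * Q ^ (s - 1)) ^ (1 / s) := by
          have : s = (s - 1) + 1 := by ring
          conv_rhs => rw [this, ENNReal.rpow_add_of_nonneg _ _ (by linarith) zero_le_one,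
            ENNReal.rpow_one, ← this]
          congr 1
          ring
      _ = _ := by
          rw [ENNReal.mul_rpow_of_nonneg _ _ (by positivity), ← ENNReal.rpow_mul,
            ← ENNReal.rpow_mul, mul_one_div_cancel hs0.ne', ENNReal.rpow_one]
          congr 2
          field_simp

lemma enorm_integral_mul_le {𝕜 : Type*} [RCLike 𝕜] {p : ℝ≥0∞} (hp : 1 ≤ p) {u : X → ℝ} {v : X → 𝕜}
    (hu : AEStronglyMeasurable u μ) (hv : AEStronglyMeasurable v μ) :
    ‖∫ y, (u y : 𝕜) * v y ∂μ‖ₑ ≤ eLpNorm u p.conjExponent μ * eLpNorm v p μ := by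
  have hconj := (ENNReal.HolderConjugate.conjExponent hp).symm
  refine (enorm_integral_le_lintegral_enorm _).trans ?_
  rw [← eLpNorm_one_eq_lintegral_enorm]
  have := eLpNorm_le_eLpNorm_mul_eLpNorm_of_nnnorm (r := 1) hu hv (fun a b => (a : 𝕜) * b) 1
    (Eventually.of_forall fun y => by simp) (hpqr := hconj)
  simpa using this

end Analysis

/-! ### The quadrature error functional and Fubini's theorem for it. -/

section QuadError

variable {X : Type*} [MeasurableSpace X] {μ : Measure X} {ν : SignedMeasure X}
  {E : Type*} [NormedAddCommGroup E] [NormedSpace ℝ E]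

/-- The error of the quadrature `ν` on `f`. -/
def quadError (μ : Measure X) (ν : SignedMeasure X) (f : X → E) : E :=
  (∫ᵛ x, f x ∂<•ν) - ∫ x, f x ∂μ

lemma isFiniteMeasure_variation (ν : SignedMeasure X) : IsFiniteMeasure ν.variation := by
  rw [← SignedMeasure.totalVariation_eq_variation]
  infer_instance

lemma variation_eq_add (ν : SignedMeasure X) : ν.variation =
    ν.toJordanDecomposition.posPart + ν.toJordanDecomposition.negPart := by
  rw [← SignedMeasure.totalVariation_eq_variation, SignedMeasure.totalVariation]

lemma integral_signedMeasure [CompleteSpace E] {f : X → E} (hf : Integrable f ν.variation) :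
    ∫ᵛ x, f x ∂<•ν = ∫ x, f x ∂ν.toJordanDecomposition.posPart -
      ∫ x, f x ∂ν.toJordanDecomposition.negPart := by
  rw [variation_eq_add, integrable_add_measure] at hf
  conv_lhs => rw [← SignedMeasure.toSignedMeasure_toJordanDecomposition ν,
    JordanDecomposition.toSignedMeasure]
  rw [VectorMeasure.integral_sub_vectorMeasure, VectorMeasure.integral_toSignedMeasure,
    VectorMeasure.integral_toSignedMeasure]
  · simpa [VectorMeasure.Integrable] using hf.1
  · simpa [VectorMeasure.Integrable] using hf.2

lemma quadError_eq [CompleteSpace E] {f : X → E} (hf : Integrable f (ν.variation + μ)) :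
    quadError μ ν f = ∫ x, f x ∂ν.toJordanDecomposition.posPart -
      ∫ x, f x ∂ν.toJordanDecomposition.negPart - ∫ x, f x ∂μ := by
  rw [quadError, integral_signedMeasure (integrable_add_measure.1 hf).1]

lemma integrable_parts {E : Type*} [NormedAddCommGroup E] {f : X → E} (hf : Integrable f (ν.variation + μ)) :
    Integrable f ν.toJordanDecomposition.posPart ∧ Integrable f ν.toJordanDecomposition.negPart ∧
      Integrable f μ := by
  rw [variation_eq_add, integrable_add_measure, integrable_add_measure] at hf
  exact ⟨hf.1.1, hf.1.2, hf.2⟩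

lemma enorm_quadError_le [CompleteSpace E] {f : X → E} (hf : Integrable f (ν.variation + μ)) :
    ‖quadError μ ν f‖ₑ ≤ ∫⁻ x, ‖f x‖ₑ ∂(ν.variation + μ) := by
  rw [quadError_eq hf, variation_eq_add, lintegral_add_measure, lintegral_add_measure]
  refine enorm_sub_le.trans (add_le_add (enorm_sub_le.trans (add_le_add ?_ ?_)) ?_) <;>
  exact enorm_integral_le_lintegral_enorm _

lemma quadError_sub [CompleteSpace E] {f g : X → E} (hf : Integrable f (ν.variation + μ))
    (hg : Integrable g (ν.variation + μ)) :
    quadError μ ν (fun x => f x - g x) = quadError μ ν f - quadError μ ν g := by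
  obtain ⟨f1, f2, f3⟩ := integrable_parts hf
  obtain ⟨g1, g2, g3⟩ := integrable_parts hg
  rw [quadError_eq hf, quadError_eq hg, quadError_eq (f := fun x => f x - g x) (hf.sub hg), integral_sub f1 g1,
    integral_sub f2 g2, integral_sub f3 g3]
  abel

lemma quadError_add [CompleteSpace E] {f g : X → E} (hf : Integrable f (ν.variation + μ))
    (hg : Integrable g (ν.variation + μ)) :
    quadError μ ν (fun x => f x + g x) = quadError μ ν f + quadError μ ν g := by
  obtain ⟨f1, f2, f3⟩ := integrable_parts hf
  obtain ⟨g1, g2, g3⟩ := integrable_parts hg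
  rw [quadError_eq hf, quadError_eq hg, quadError_eq (f := fun x => f x + g x) (hf.add hg), integral_add f1 g1,
    integral_add f2 g2, integral_add f3 g3]
  abel

lemma quadError_sum [CompleteSpace E] {ι : Type*} {s : Finset ι} {f : ι → X → E}
    (hf : ∀ i ∈ s, Integrable (f i) (ν.variation + μ)) :
    quadError μ ν (fun x => ∑ i ∈ s, f i x) = ∑ i ∈ s, quadError μ ν (f i) := by
  rw [quadError_eq (integrable_finsetSum _ hf),
    Finset.sum_congr rfl fun i hi => quadError_eq (hf i hi),
    integral_finsetSum _ fun i hi => (integrable_parts (hf i hi)).1,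
    integral_finsetSum _ fun i hi => (integrable_parts (hf i hi)).2.1,
    integral_finsetSum _ fun i hi => (integrable_parts (hf i hi)).2.2,
    Finset.sum_sub_distrib, Finset.sum_sub_distrib]

lemma quadError_ofReal_mul {𝕜 : Type*} [RCLike 𝕜] {f : X → ℝ} (c : 𝕜)
    (hf : Integrable f (ν.variation + μ)) :
    quadError μ ν (fun x => (f x : 𝕜) * c) = ((quadError μ ν f : ℝ) : 𝕜) * c := by
  have : Integrable (fun x => (f x : 𝕜) * c) (ν.variation + μ) := hf.ofReal.mul_const c
  rw [quadError_eq hf, quadError_eq this]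
  simp only [integral_mul_const, integral_ofReal]
  push_cast
  ring

section Fubini

variable [CompleteSpace E] [IsFiniteMeasure μ] {H : X → X → E}

lemma integrable_prod_parts {E : Type*} [NormedAddCommGroup E] {H : X → X → E}
    (hH : Integrable (Function.uncurry H) ((ν.variation + μ).prod μ)) :
    Integrable (Function.uncurry H) (ν.toJordanDecomposition.posPart.prod μ) ∧
    Integrable (Function.uncurry H) (ν.toJordanDecomposition.negPart.prod μ) ∧
    Integrable (Function.uncurry H) (μ.prod μ) := by
  have := isFiniteMeasure_variation ν
  rw [Measure.add_prod] at hH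
  rw [integrable_add_measure] at hH
  obtain ⟨h1, h2⟩ := hH
  rw [variation_eq_add, Measure.add_prod, integrable_add_measure] at h1
  exact ⟨h1.1, h1.2, h2⟩

/-- The sections `H · y` are known to be integrable for `|ν| + μ` only for almost every `y`; nothing
is claimed where the integrals may take default values. -/
lemma ae_quadError_eq (hH : Integrable (Function.uncurry H) ((ν.variation + μ).prod μ)) :
    (fun y => quadError μ ν fun x => H x y) =ᵐ[μ] fun y =>
      ∫ x, H x y ∂ν.toJordanDecomposition.posPart -
      ∫ x, H x y ∂ν.toJordanDecomposition.negPart - ∫ x, H x y ∂μ := by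
  have := isFiniteMeasure_variation ν
  filter_upwards [hH.prod_left_ae] with y hy using quadError_eq hy

lemma aestronglyMeasurable_quadError
    (hH : Integrable (Function.uncurry H) ((ν.variation + μ).prod μ)) :
    AEStronglyMeasurable (fun y => quadError μ ν fun x => H x y) μ := by
  obtain ⟨h1, h2, h3⟩ := integrable_prod_parts hH
  exact ((h1.integral_prod_right.1.sub h2.integral_prod_right.1).sub
    h3.integral_prod_right.1).congr (ae_quadError_eq hH).symm

lemma integral_quadError (hH : Integrable (Function.uncurry H) ((ν.variation + μ).prod μ)) :
    ∫ y, quadError μ ν (fun x => H x y) ∂μ = quadError μ ν (fun x => ∫ y, H x y ∂μ) := by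
  have := isFiniteMeasure_variation ν
  obtain ⟨h1, h2, h3⟩ := integrable_prod_parts hH
  have i1 : Integrable (fun y => ∫ x, H x y ∂ν.toJordanDecomposition.posPart) μ :=
    h1.integral_prod_right
  have i2 : Integrable (fun y => ∫ x, H x y ∂ν.toJordanDecomposition.negPart) μ :=
    h2.integral_prod_right
  have i3 : Integrable (fun y => ∫ x, H x y ∂μ) μ := h3.integral_prod_right
  have i12 : Integrable (fun y => ∫ x, H x y ∂ν.toJordanDecomposition.posPart -
    ∫ x, H x y ∂ν.toJordanDecomposition.negPart) μ := i1.sub i2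
  rw [integral_congr_ae (ae_quadError_eq hH), integral_sub i12 i3, integral_sub i1 i2,
    quadError_eq (f := fun x => ∫ y, H x y ∂μ) hH.integral_prod_left, integral_integral_swap h1, integral_integral_swap h2,
    integral_integral_swap h3]

end Fubini

end QuadError

/-! ### Dyadic splitting of the kernel `G`. -/

/-- The part of the multiplier `m` at frequencies about `M`. -/
def dyadicPiece (m : ℝ → ℝ) (M t : ℝ) : ℝ := bump (t / M) * m t

/-- The part of the multiplier `m` at frequencies below `N`. -/
def lowPass (m : ℝ → ℝ) (N t : ℝ) : ℝ := cutoff (2 * t / N) * m t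

lemma dyadicPiece_eq_zero {m : ℝ → ℝ} {M t : ℝ} (hM : 0 < M) (ht : 2 * M ≤ t) :
    dyadicPiece m M t = 0 := by
  rw [dyadicPiece, bump_eq_zero, zero_mul]
  intro hcon
  have := hcon.2
  rw [div_lt_iff₀ hM] at this
  linarith

lemma lowPass_eq_zero {m : ℝ → ℝ} {N t : ℝ} (hN : 0 < N) (ht : N ≤ t) : lowPass m N t = 0 := by
  rw [lowPass, cutoff_eq_zero, zero_mul]
  rw [le_div_iff₀ hN]
  linarith

lemma tsum_bump (t : ℝ) {N : ℝ} (hN : 0 < N) :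
    ∑' j : ℕ, bump (t / (N * 2 ^ j)) = 1 - cutoff (2 * t / N) := by
  obtain ⟨J, hJ⟩ := pow_unbounded_of_one_lt (2 * t / N) one_lt_two
  rw [div_lt_iff₀ hN] at hJ
  have h1 := telescope_bump t (N := N) J
  have h2 : ∀ j, J ≤ j → 2 * t / (N * 2 ^ j) ≤ 1 := fun j hj => by
    rw [div_le_one (by positivity)]
    have : (2 : ℝ) ^ J ≤ 2 ^ j := pow_le_pow_right₀ one_le_two hj
    nlinarith
  rw [cutoff_eq_one (h2 J le_rfl)] at h1
  rw [tsum_eq_sum (s := Finset.range J), h1]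
  · ring
  · intro j hj
    rw [Finset.mem_range, not_lt] at hj
    have h3 := h2 j hj
    refine bump_eq_zero fun hcon => ?_
    have := hcon.1
    rw [mul_div_assoc] at h3
    linarith

lemma tsum_ofReal_geometric {C w : ℝ} (hC : 0 ≤ C) (hw : 0 ≤ w) (hw1 : w < 1) :
    ∑' j : ℕ, ENNReal.ofReal (C * w ^ j) = ENNReal.ofReal (C * (1 - w)⁻¹) := by
  rw [← ENNReal.ofReal_tsum_of_nonneg (fun j => by positivity)
    ((summable_geometric_of_lt_one hw hw1).mul_left C), tsum_mul_left,
    tsum_geometric_of_lt_one hw hw1]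

lemma integrable_prod_of_lintegral_le {X E : Type*} [MeasurableSpace X] [NormedAddCommGroup E] {μ τ : Measure X}
    [IsFiniteMeasure τ] [SFinite μ] {H : X → X → E}
    (hH : AEStronglyMeasurable (Function.uncurry H) (τ.prod μ)) {C : ℝ}
    (hC : ∀ x, ∫⁻ y, ‖H x y‖ₑ ∂μ ≤ ENNReal.ofReal C) :
    Integrable (Function.uncurry H) (τ.prod μ) := by
  refine ⟨hH, ?_⟩
  rw [HasFiniteIntegral, lintegral_prod _ hH.enorm]
  calc ∫⁻ x, ∫⁻ y, ‖Function.uncurry H (x, y)‖ₑ ∂μ ∂τ ≤ ∫⁻ _, ENNReal.ofReal C ∂τ :=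
        lintegral_mono hC
    _ < ∞ := by
        rw [lintegral_const]
        exact ENNReal.mul_lt_top ENNReal.ofReal_lt_top (measure_lt_top _ _)

namespace IsDataDefinedSpace

variable {X : Type*} [TopologicalSpace X] [MeasurableSpace X]
  {ρ : X → X → ℝ} {μ : Measure X} {lam : ℕ → ℝ} {φ : ℕ → X → ℝ} {q κ₁ κ₂ κ₃ κ₄ : ℝ}

lemma lintegral_spectralKernel_le (h : IsDataDefinedSpace ρ μ lam φ q κ₁ κ₂ κ₃ κ₄) {m : ℝ → ℝ}
    {N : ℝ} (hm : ∀ l, N ≤ l → m l = 0) : ∃ C : ℝ, 0 ≤ C ∧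
      ∀ x, ∫⁻ y, ‖spectralKernel lam φ m x y‖ₑ ∂μ ≤ ENNReal.ofReal C := by
  have := h.prob
  obtain ⟨C, hC, hb⟩ := h.exists_abs_spectralKernel_le hm
  refine ⟨C, hC, fun x => ?_⟩
  calc _ ≤ ∫⁻ _, ENNReal.ofReal C ∂μ := by
        refine lintegral_mono fun y => ?_
        rw [Real.enorm_eq_ofReal_abs]
        exact ENNReal.ofReal_le_ofReal (hb x y)
    _ = _ := by simp

variable [BorelSpace X]

lemma exists_lintegral_decay_le {q κ₂ : ℝ} {S : ℕ} (hq : 0 < q) (hκ₂ : 0 < κ₂) (hS : q < S)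
    (ρ : X → X → ℝ) : ∃ C : ℝ, 0 < C ∧ ∀ (μ : Measure X) (lam : ℕ → ℝ) (φ : ℕ → X → ℝ)
    (κ₁ κ₃ κ₄ : ℝ), IsDataDefinedSpace ρ μ lam φ q κ₁ κ₂ κ₃ κ₄ → ∀ M : ℝ, 1 ≤ M → ∀ x,
      ∫⁻ y, ENNReal.ofReal (decay q S M (ρ x y)) ∂μ ≤ ENNReal.ofReal C := by
  obtain ⟨C, hC, hdec⟩ := lintegral_decay_le (X := X) (ρ := ρ) hS hq.le
  refine ⟨C * κ₂, by positivity, fun μ lam φ κ₁ κ₃ κ₄ h M hM x => ?_⟩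
  have hM0 : 0 < M := by linarith
  have h1 := (hdec μ x (h.quasiMetric.nonneg x) (h.continuous_rho x).measurable
    (ENNReal.ofReal κ₂) M (1 / M) (by positivity) hM0
    (fun d hd => h.measure_cball_le x (lt_of_lt_of_le (by positivity) hd))).2
    (by rw [mul_one_div_cancel hM0.ne'])
  rw [mul_one_div_cancel hM0.ne', Real.one_rpow, ENNReal.ofReal_one, mul_one,
    ← ENNReal.ofReal_mul hC.le] at h1
  exact h1

lemma integrable_spectralKernel (h : IsDataDefinedSpace ρ μ lam φ q κ₁ κ₂ κ₃ κ₄) {m : ℝ → ℝ}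
    {N : ℝ} (hm : ∀ l, N ≤ l → m l = 0) (x : X) : Integrable (spectralKernel lam φ m x) μ := by
  obtain ⟨C, _, hC⟩ := h.lintegral_spectralKernel_le hm
  exact ⟨((h.measurable_spectralKernel hm).comp measurable_prodMk_left).aestronglyMeasurable,
    (hC x).trans_lt ENNReal.ofReal_lt_top⟩

lemma integrable_phi (h : IsDataDefinedSpace ρ μ lam φ q κ₁ κ₂ κ₃ κ₄) (k : ℕ) :
    Integrable (φ k) μ := by
  have := h.prob
  simpa using h.integrable_phi_mul (integrable_const (1 : ℝ)) k

lemma integral_spectralKernel_mul_phi (h : IsDataDefinedSpace ρ μ lam φ q κ₁ κ₂ κ₃ κ₄)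
    {m : ℝ → ℝ} {N : ℝ} (hm : ∀ l, N ≤ l → m l = 0) (x : X) (k : ℕ) :
    ∫ y, spectralKernel lam φ m x y * φ k y ∂μ = m (lam k) * φ k x := by
  have h1 := h.integral_spectralKernel_mul (𝕜 := ℝ) hm (h.integrable_phi k) x
  simp only [RCLike.ofReal_real_eq_id, id_eq, fourierCoef, h.phi_orthonormal] at h1
  rw [h1]
  simp only [mul_ite, mul_one, mul_zero, Finset.sum_ite_eq, h.mem_indices]
  split_ifs with hk
  · rfl
  · rw [hm _ (not_lt.1 hk), zero_mul]

/-- The low pass parts of a kernel converge to it in `L¹`. -/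
lemma lintegral_sub_lowPass_le (h : IsDataDefinedSpace ρ μ lam φ q κ₁ κ₂ κ₃ κ₄) {b : ℝ → ℝ}
    {G : X → X → ℝ} (hG : IsKernel μ lam φ b G) {C β : ℝ} (hC : 0 ≤ C) (hβ : 0 < β)
    (hpiece : ∀ M : ℝ, 1 ≤ M → ∀ x, ∫⁻ y, ‖spectralKernel lam φ (dyadicPiece b M) x y‖ₑ ∂μ ≤
      ENNReal.ofReal (C * M ^ (-β))) {N : ℝ} (hN : 1 ≤ N) (x : X) :
    ∫⁻ y, ‖G x y - spectralKernel lam φ (lowPass b N) x y‖ₑ ∂μ ≤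
      ENNReal.ofReal (C * (1 - 2 ^ (-β))⁻¹ * N ^ (-β)) := by
  have hN0 : 0 < N := by linarith
  have hM : ∀ j : ℕ, 1 ≤ N * 2 ^ j := fun j => one_le_mul_of_one_le_of_one_le hN
    (one_le_pow₀ one_le_two)
  set Φ : ℕ → X → ℝ := fun j => spectralKernel lam φ (dyadicPiece b (N * 2 ^ j)) x with hΦ
  have hz : ∀ j : ℕ, ∀ l, 2 * (N * 2 ^ j) ≤ l → dyadicPiece b (N * 2 ^ j) l = 0 := fun j l hl =>
    dyadicPiece_eq_zero (by positivity) hl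
  have hmeas : ∀ j, Measurable (Φ j) := fun j =>
    (h.measurable_spectralKernel (hz j)).comp measurable_prodMk_left
  have hw1 : (2 : ℝ) ^ (-β) < 1 := Real.rpow_lt_one_of_one_lt_of_neg one_lt_two (by linarith)
  have hle : ∑' j, ∫⁻ y, ‖Φ j y‖ₑ ∂μ ≤ ENNReal.ofReal (C * (1 - 2 ^ (-β))⁻¹ * N ^ (-β)) := by
    calc _ ≤ ∑' j : ℕ, ENNReal.ofReal ((C * N ^ (-β)) * (2 ^ (-β)) ^ j) := by
          refine ENNReal.tsum_le_tsum fun j => (hpiece _ (hM j) x).trans_eq ?_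
          rw [Real.mul_rpow hN0.le (by positivity), ← Real.rpow_natCast, ← Real.rpow_natCast,
            ← Real.rpow_mul zero_le_two, ← Real.rpow_mul zero_le_two, mul_comm (j : ℝ), mul_assoc]
      _ = _ := by
          rw [tsum_ofReal_geometric (by positivity) (by positivity) hw1]
          congr 1
          ring
  have hfin : ∑' j, ∫⁻ y, ‖Φ j y‖ₑ ∂μ ≠ ∞ := (hle.trans_lt ENNReal.ofReal_lt_top).ne
  have hle2 : ∫⁻ y, ‖∑' j, Φ j y‖ₑ ∂μ ≤ ENNReal.ofReal (C * (1 - 2 ^ (-β))⁻¹ * N ^ (-β)) := by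
    calc _ ≤ ∫⁻ y, ∑' j, ‖Φ j y‖ₑ ∂μ := lintegral_mono fun y => enorm_tsum_le_tsum_enorm
      _ = ∑' j, ∫⁻ y, ‖Φ j y‖ₑ ∂μ := lintegral_tsum fun j => (hmeas j).enorm.aemeasurable
      _ ≤ _ := hle
  have hint : Integrable (fun y => ∑' j, Φ j y) μ :=
    ⟨(Measurable.tsum hmeas).aestronglyMeasurable, hle2.trans_lt ENNReal.ofReal_lt_top⟩
  have hlow : ∀ l, N ≤ l → lowPass b N l = 0 := fun l hl => lowPass_eq_zero hN0 hl
  have hilow := h.integrable_spectralKernel hlow x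
  have hcoef : ∀ k, ∫ y, (∑' j, Φ j y) * φ k y ∂μ =
      (1 - cutoff (2 * lam k / N)) * (b (lam k) * φ k x) := by
    intro k
    obtain ⟨c, hc⟩ := h.phi_bounded k
    have hcx : 0 ≤ c := (abs_nonneg _).trans (hc x)
    simp only [← tsum_mul_right]
    rw [integral_tsum (f := fun j y => Φ j y * φ k y)
      fun j => ((hmeas j).mul (h.measurable_phi k)).aestronglyMeasurable]
    · rw [← tsum_bump _ hN0, ← tsum_mul_right]
      refine tsum_congr fun j => ?_
      rw [hΦ]
      rw [h.integral_spectralKernel_mul_phi (hz j), dyadicPiece, mul_assoc]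
    · refine ne_top_of_le_ne_top (ENNReal.mul_ne_top (ENNReal.ofReal_ne_top (r := c)) hfin) ?_
      rw [← ENNReal.tsum_mul_left]
      refine ENNReal.tsum_le_tsum fun j => ?_
      rw [← lintegral_const_mul' _ _ ENNReal.ofReal_ne_top]
      refine lintegral_mono fun y => ?_
      rw [enorm_mul, mul_comm]
      refine mul_le_mul' ?_ le_rfl
      rw [Real.enorm_eq_ofReal_abs]
      exact ENNReal.ofReal_le_ofReal (hc y)
  -- `G x` is given only through its Fourier coefficients, so its identity with the low pass part
  -- plus the `L¹`-convergent series of dyadic pieces comes from uniqueness of coefficients.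
  have hae := h.ae_eq_zero_of_coef (g := fun y => G x y - spectralKernel lam φ (lowPass b N) x y -
      ∑' j, Φ j y) (((hG.integrable x).sub hilow).sub hint) fun k => by
    have e1 := h.integrable_phi_mul (hG.integrable x) k
    have e2 := h.integrable_phi_mul hilow k
    have e3 := h.integrable_phi_mul hint k
    simp only [mul_sub]
    rw [integral_sub (f := fun y => φ k y * G x y - φ k y * spectralKernel lam φ (lowPass b N) x y)
      (e1.sub e2) e3, integral_sub e1 e2]
    simp only [mul_comm (φ k _)]
    rw [hG.coef, h.integral_spectralKernel_mul_phi hlow, hcoef, lowPass]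
    ring
  refine le_trans (le_of_eq (lintegral_congr_ae ?_)) hle2
  filter_upwards [hae] with y hy
  rw [sub_eq_zero.1 hy]

lemma exists_lintegral_kernel_le (h : IsDataDefinedSpace ρ μ lam φ q κ₁ κ₂ κ₃ κ₄) {b : ℝ → ℝ}
    {G : X → X → ℝ} (hG : IsKernel μ lam φ b G) {C β : ℝ} (hC : 0 ≤ C) (hβ : 0 < β)
    (hpiece : ∀ M : ℝ, 1 ≤ M → ∀ x, ∫⁻ y, ‖spectralKernel lam φ (dyadicPiece b M) x y‖ₑ ∂μ ≤
      ENNReal.ofReal (C * M ^ (-β))) :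
    ∃ C' : ℝ, 0 ≤ C' ∧ ∀ x, ∫⁻ y, ‖G x y‖ₑ ∂μ ≤ ENNReal.ofReal C' := by
  have hlow : ∀ l, 1 ≤ l → lowPass b 1 l = 0 := fun l hl => lowPass_eq_zero one_pos hl
  obtain ⟨C1, hC1, h1⟩ := h.lintegral_spectralKernel_le hlow
  have hw1 : (2 : ℝ) ^ (-β) < 1 := Real.rpow_lt_one_of_one_lt_of_neg one_lt_two (by linarith)
  have hw2 : 0 < 1 - (2 : ℝ) ^ (-β) := by linarith
  refine ⟨C * (1 - 2 ^ (-β))⁻¹ * 1 ^ (-β) + C1, by positivity, fun x => ?_⟩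
  have h2 := h.lintegral_sub_lowPass_le hG hC hβ hpiece le_rfl x
  rw [ENNReal.ofReal_add (by positivity) hC1]
  refine le_trans ?_ (add_le_add h2 (h1 x))
  have hm : Measurable fun y => spectralKernel lam φ (lowPass b 1) x y :=
    (h.measurable_spectralKernel hlow).comp measurable_prodMk_left
  rw [← lintegral_add_right _ hm.enorm]
  refine lintegral_mono fun y => ?_
  calc ‖G x y‖ₑ = ‖(G x y - spectralKernel lam φ (lowPass b 1) x y) +
        spectralKernel lam φ (lowPass b 1) x y‖ₑ := by rw [sub_add_cancel]
    _ ≤ _ := enorm_add_le _ _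

end IsDataDefinedSpace

/-! ### Duality between polynomials and the kernel; kernel error of a quadrature measure. -/

lemma quadError_mul_const {X : Type*} [MeasurableSpace X] {μ : Measure X} {ν : SignedMeasure X}
    {f : X → ℝ} (c : ℝ) (hf : Integrable f (ν.variation + μ)) :
    quadError μ ν (fun x => f x * c) = quadError μ ν f * c := by
  rw [quadError_eq hf, quadError_eq (hf.mul_const c)]
  simp only [integral_mul_const]
  ring

/-- The expansion with coefficients `a` over the finite set `s` of indices. -/
def expansion {𝕜 X : Type*} [RCLike 𝕜] (φ : ℕ → X → ℝ) (s : Finset ℕ) (a : ℕ → 𝕜) (x : X) : 𝕜 :=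
  ∑ k ∈ s, a k * (φ k x : 𝕜)

namespace IsDataDefinedSpace

variable {X : Type*} [TopologicalSpace X] [MeasurableSpace X]
  {ρ : X → X → ℝ} {μ : Measure X} {lam : ℕ → ℝ} {φ : ℕ → X → ℝ} {q κ₁ κ₂ κ₃ κ₄ : ℝ}
  {𝕜 : Type*} [RCLike 𝕜]

lemma exists_eq_expansion (h : IsDataDefinedSpace ρ μ lam φ q κ₁ κ₂ κ₃ κ₄) {N : ℝ} {P : X → 𝕜}
    (hP : P ∈ diffusionPoly 𝕜 lam φ N) : ∃ a : ℕ → 𝕜, P = expansion φ (h.indices N) a := by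
  classical
  induction hP using Submodule.span_induction with
  | mem P hP =>
    obtain ⟨j, hj, rfl⟩ := hP
    refine ⟨Pi.single j 1, funext fun x => ?_⟩
    rw [expansion, Finset.sum_eq_single_of_mem j (h.mem_indices.2 hj)]
    · simp
    · intro k _ hk
      simp [hk]
  | zero => exact ⟨0, by ext; simp [expansion]⟩
  | add P Q _ _ hP hQ =>
    obtain ⟨a, rfl⟩ := hP
    obtain ⟨c, rfl⟩ := hQ
    exact ⟨a + c, by ext; simp [expansion, add_mul, Finset.sum_add_distrib]⟩
  | smul z P _ hP =>
    obtain ⟨a, rfl⟩ := hP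
    exact ⟨z • a, by ext; simp [expansion, Finset.mul_sum, mul_assoc]⟩

lemma exists_norm_expansion_le (h : IsDataDefinedSpace ρ μ lam φ q κ₁ κ₂ κ₃ κ₄) (s : Finset ℕ)
    (a : ℕ → 𝕜) : ∃ D : ℝ, 0 ≤ D ∧ ∀ x, ‖expansion φ s a x‖ ≤ D := by
  choose c hc using h.phi_bounded
  obtain ⟨x₀⟩ := h.nonempty
  refine ⟨∑ k ∈ s, ‖a k‖ * c k, Finset.sum_nonneg fun k _ =>
    mul_nonneg (norm_nonneg _) ((abs_nonneg _).trans (hc k x₀)), fun x => ?_⟩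
  refine (norm_sum_le _ _).trans (Finset.sum_le_sum fun k _ => ?_)
  rw [norm_mul, RCLike.norm_ofReal]
  gcongr
  exact hc k x

lemma integrable_kernel_prod (h : IsDataDefinedSpace ρ μ lam φ q κ₁ κ₂ κ₃ κ₄) {b : ℝ → ℝ}
    {G : X → X → ℝ} (hG : IsKernel μ lam φ b G) {C : ℝ}
    (hC : ∀ x, ∫⁻ y, ‖G x y‖ₑ ∂μ ≤ ENNReal.ofReal C) (ν : SignedMeasure X) :
    Integrable (Function.uncurry G) ((ν.variation + μ).prod μ) := by
  have := h.prob
  have := isFiniteMeasure_variation ν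
  exact integrable_prod_of_lintegral_le hG.measurable.aestronglyMeasurable hC

variable [BorelSpace X]

lemma measurable_expansion (h : IsDataDefinedSpace ρ μ lam φ q κ₁ κ₂ κ₃ κ₄) (s : Finset ℕ)
    (a : ℕ → 𝕜) : Measurable (expansion φ s a) :=
  Finset.measurable_sum _ fun k _ =>
    (RCLike.measurable_ofReal.comp (h.measurable_phi k)).const_mul _

lemma integrable_phi_of_isFiniteMeasure (h : IsDataDefinedSpace ρ μ lam φ q κ₁ κ₂ κ₃ κ₄) (k : ℕ)
    (τ : Measure X) [IsFiniteMeasure τ] : Integrable (φ k) τ := by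
  obtain ⟨D, hD⟩ := h.phi_bounded k
  exact Integrable.of_bound (h.measurable_phi k).aestronglyMeasurable D (Eventually.of_forall hD)

lemma fourierCoef_expansion (h : IsDataDefinedSpace ρ μ lam φ q κ₁ κ₂ κ₃ κ₄) (s : Finset ℕ)
    (a : ℕ → 𝕜) (k : ℕ) : fourierCoef μ φ (expansion φ s a) k = if k ∈ s then a k else 0 := by
  have := h.prob
  simp only [fourierCoef, expansion, Finset.sum_mul]
  have hi : ∀ j, Integrable (fun x => a j * ((φ j x : 𝕜) * (φ k x : 𝕜))) μ := fun j =>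
    (h.integrable_mul_phi (h.integrable_phi j).ofReal k).const_mul _
  simp only [mul_assoc]
  rw [integral_finsetSum _ fun j _ => hi j]
  have : ∀ j, ∫ x, a j * ((φ j x : 𝕜) * (φ k x : 𝕜)) ∂μ = if k = j then a j else 0 := fun j => by
    rw [integral_const_mul]
    have h1 : ∀ x, (φ j x : 𝕜) * (φ k x : 𝕜) = ((φ j x * φ k x : ℝ) : 𝕜) := fun x => by push_cast; rfl
    simp only [h1]
    rw [integral_ofReal, h.phi_orthonormal]
    by_cases hjk : j = k
    · simp [hjk]
    · simp [hjk, Ne.symm hjk]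
  simp only [this, Finset.sum_ite_eq]

lemma eq_expansion_fourierCoef (h : IsDataDefinedSpace ρ μ lam φ q κ₁ κ₂ κ₃ κ₄) {N : ℝ} {P : X → 𝕜}
    (hP : P ∈ diffusionPoly 𝕜 lam φ N) :
    P = expansion φ (h.indices N) (fourierCoef μ φ P) ∧
      ∀ k, N ≤ lam k → fourierCoef μ φ P k = 0 := by
  obtain ⟨a, rfl⟩ := h.exists_eq_expansion hP
  refine ⟨funext fun x => Finset.sum_congr rfl fun k hk => ?_, fun k hk => ?_⟩
  · rw [h.fourierCoef_expansion, if_pos hk]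
  · rw [h.fourierCoef_expansion, if_neg]
    rw [h.mem_indices]
    exact not_lt.2 hk

/-- The quadrature error of a polynomial is controlled by the kernel error. -/
lemma enorm_quadError_le_kernelError (h : IsDataDefinedSpace ρ μ lam φ q κ₁ κ₂ κ₃ κ₄) {b : ℝ → ℝ}
    (hb : ∀ t, 0 ≤ t → b t ≠ 0) {G : X → X → ℝ} (hG : IsKernel μ lam φ b G) {C : ℝ} (hC0 : 0 ≤ C)
    (hC : ∀ x, ∫⁻ y, ‖G x y‖ₑ ∂μ ≤ ENNReal.ofReal C) {p : ℝ≥0∞} (hp : 1 ≤ p)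
    (s : Finset ℕ) (a : ℕ → 𝕜) (ν : SignedMeasure X) :
    ‖quadError μ ν (expansion φ s a)‖ₑ ≤ kernelError μ G p ν *
      eLpNorm (expansion φ s fun k => (((b (lam k))⁻¹ : ℝ) : 𝕜) * a k) p μ := by
  have := h.prob
  have := isFiniteMeasure_variation ν
  set D := expansion φ s fun k => (((b (lam k))⁻¹ : ℝ) : 𝕜) * a k with hD
  have hDm : Measurable D := h.measurable_expansion _ _
  obtain ⟨d, hd0, hd⟩ := h.exists_norm_expansion_le s fun k => (((b (lam k))⁻¹ : ℝ) : 𝕜) * a k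
  have hGi := h.integrable_kernel_prod hG hC ν
  set H : X → X → 𝕜 := fun x y => (G x y : 𝕜) * D y with hH
  have hHi : Integrable (Function.uncurry H) ((ν.variation + μ).prod μ) := by
    refine integrable_prod_of_lintegral_le (C := C * d) ?_ fun x => ?_
    · exact ((RCLike.measurable_ofReal.comp hG.measurable).mul
        (hDm.comp measurable_snd)).aestronglyMeasurable
    · rw [ENNReal.ofReal_mul hC0]
      calc ∫⁻ y, ‖H x y‖ₑ ∂μ ≤ ∫⁻ y, ‖G x y‖ₑ * ENNReal.ofReal d ∂μ := by
            refine lintegral_mono fun y => ?_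
            simp only [hH]
            rw [enorm_mul]
            refine mul_le_mul' (by simp [← ofReal_norm]) ?_
            rw [← ofReal_norm]
            exact ENNReal.ofReal_le_ofReal (hd y)
        _ = (∫⁻ y, ‖G x y‖ₑ ∂μ) * ENNReal.ofReal d :=
            lintegral_mul_const' _ _ ENNReal.ofReal_ne_top
        _ ≤ _ := mul_le_mul' (hC x) le_rfl
  have hrep : ∀ x, ∫ y, H x y ∂μ = expansion φ s a x := fun x => by
    simp only [hH, hD, expansion, Finset.mul_sum]
    have h1 : ∀ k y, (G x y : 𝕜) * ((((b (lam k))⁻¹ : ℝ) : 𝕜) * a k * (φ k y : 𝕜)) =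
        ((((b (lam k))⁻¹ : ℝ) : 𝕜) * a k) * ((G x y * φ k y : ℝ) : 𝕜) := fun k y => by
      push_cast
      ring
    have h2 : ∀ k, Integrable (fun y => G x y * φ k y) μ := fun k => by
      simpa only [mul_comm] using h.integrable_phi_mul (hG.integrable x) k
    simp only [h1]
    rw [integral_finsetSum _ fun k _ => (h2 k).ofReal.const_mul _]
    refine Finset.sum_congr rfl fun k _ => ?_
    rw [integral_const_mul, integral_ofReal, hG.coef]
    have h3 : ((b (lam k) : ℝ) : 𝕜) ≠ 0 := by
      exact_mod_cast hb _ (h.lam_nonneg k)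
    push_cast
    field_simp
  have hq : (fun y => quadError μ ν fun x => H x y) =ᵐ[μ] fun y =>
      ((quadError μ ν (fun x => G x y) : ℝ) : 𝕜) * D y := by
    filter_upwards [hGi.prod_left_ae] with y hy
    exact quadError_ofReal_mul (D y) hy
  -- Fubini takes the quadrature error inside the integral representation of the polynomial; there
  -- it acts on `G` alone, and Hölder separates the kernel error from `D`.
  have h4 := integral_quadError hHi
  simp only [hrep] at h4
  rw [integral_congr_ae hq] at h4
  have h5 : quadError μ ν (expansion φ s a) = _ := h4.symm
  rw [h5]
  exact enorm_integral_mul_le hp (aestronglyMeasurable_quadError hGi) hDm.aestronglyMeasurable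

lemma quadError_phi_eq_zero (h : IsDataDefinedSpace ρ μ lam φ q κ₁ κ₂ κ₃ κ₄) {N : ℝ}
    {ν : SignedMeasure X} (hν : IsQuadrature 𝕜 μ lam φ N ν) {k : ℕ} (hk : lam k < N) :
    quadError μ ν (φ k) = 0 := by
  have := h.prob
  have := isFiniteMeasure_variation ν
  have h1 := hν (fun x => (φ k x : 𝕜)) (Submodule.subset_span ⟨k, hk, rfl⟩)
  have h2 := quadError_ofReal_mul (𝕜 := 𝕜) 1
    (h.integrable_phi_of_isFiniteMeasure k (ν.variation + μ))
  simp only [mul_one] at h2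
  rw [quadError, h1, sub_self] at h2
  exact_mod_cast h2.symm

lemma integrable_spectralKernel_left (h : IsDataDefinedSpace ρ μ lam φ q κ₁ κ₂ κ₃ κ₄) {m : ℝ → ℝ}
    {N : ℝ} (hm : ∀ l, N ≤ l → m l = 0) (τ : Measure X) [IsFiniteMeasure τ] (y : X) :
    Integrable (fun x => spectralKernel lam φ m x y) τ := by
  obtain ⟨C, _, hC⟩ := h.exists_abs_spectralKernel_le hm
  exact Integrable.of_bound ((h.measurable_spectralKernel hm).comp
    measurable_prodMk_right).aestronglyMeasurable C (Eventually.of_forall fun x => hC x y)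

/-- As a function of `x`, the part cut off at `N` is a combination of the `φ k` with `lam k < N`,
which `ν` integrates exactly. What is left up to `N * 2 ^ L` telescopes into dyadic pieces. -/
lemma quadError_lowPass (h : IsDataDefinedSpace ρ μ lam φ q κ₁ κ₂ κ₃ κ₄) {b : ℝ → ℝ} {N : ℝ}
    (hN : 0 < N) {ν : SignedMeasure X} (hν : IsQuadrature 𝕜 μ lam φ N ν) (L : ℕ) (y : X) :
    quadError μ ν (fun x => spectralKernel lam φ (lowPass b (N * 2 ^ L)) x y) =
      ∑ j ∈ Finset.range L,
        quadError μ ν fun x => spectralKernel lam φ (dyadicPiece b (N * 2 ^ j)) x y := by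
  have := h.prob
  have := isFiniteMeasure_variation ν
  have hlow : ∀ l, N ≤ l → lowPass b N l = 0 := fun l hl => lowPass_eq_zero hN hl
  have hz : ∀ j : ℕ, ∀ l, 2 * (N * 2 ^ j) ≤ l → dyadicPiece b (N * 2 ^ j) l = 0 := fun j l hl =>
    dyadicPiece_eq_zero (by positivity) hl
  have h0 : quadError μ ν (fun x => spectralKernel lam φ (lowPass b N) x y) = 0 := by
    simp only [h.spectralKernel_eq_sum hlow]
    have h1 : ∀ k x, lowPass b N (lam k) * φ k x * φ k y = φ k x * (lowPass b N (lam k) * φ k y) :=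
      fun k x => by ring
    simp only [h1]
    have h2 := fun k => h.integrable_phi_of_isFiniteMeasure k (ν.variation + μ)
    rw [quadError_sum fun k _ => (h2 k).mul_const _]
    refine Finset.sum_eq_zero fun k hk => ?_
    rw [quadError_mul_const _ (h2 k), h.quadError_phi_eq_zero hν (h.mem_indices.1 hk), zero_mul]
  have hsplit : ∀ x, spectralKernel lam φ (lowPass b (N * 2 ^ L)) x y =
      spectralKernel lam φ (lowPass b N) x y +
        ∑ j ∈ Finset.range L, spectralKernel lam φ (dyadicPiece b (N * 2 ^ j)) x y := by
    intro x
    have hΛ : ∀ j, j ≤ L → N * 2 ^ j ≤ N * 2 ^ L := fun j hj => by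
      gcongr
      exact one_le_two
    have hNL : N ≤ N * 2 ^ L := by simpa using hΛ 0 (Nat.zero_le _)
    have hpow : 0 < N * 2 ^ L := by positivity
    rw [h.spectralKernel_eq_sum (N := 2 * (N * 2 ^ L))
        fun l hl => lowPass_eq_zero (by positivity) (by linarith),
      h.spectralKernel_eq_sum (N := 2 * (N * 2 ^ L))
        fun l hl => lowPass_eq_zero hN (by linarith)]
    rw [Finset.sum_congr rfl fun j hj => h.spectralKernel_eq_sum (N := 2 * (N * 2 ^ L))
      (fun l hl => hz j l (by linarith [hΛ j (Finset.mem_range.1 hj).le])) x y]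
    rw [Finset.sum_comm, ← Finset.sum_add_distrib]
    refine Finset.sum_congr rfl fun k _ => ?_
    simp only [lowPass, dyadicPiece]
    rw [telescope_bump, ← Finset.sum_mul, ← Finset.sum_mul, ← Finset.sum_mul]
    ring
  simp only [hsplit]
  rw [quadError_add (h.integrable_spectralKernel_left hlow _ y)
    (integrable_finsetSum _ fun j _ => h.integrable_spectralKernel_left (hz j) _ y), h0, zero_add,
    quadError_sum fun j _ => h.integrable_spectralKernel_left (hz j) _ y]

/-- The kernel error of a quadrature measure of order `N`. -/
lemma kernelError_le_of_isQuadrature (h : IsDataDefinedSpace ρ μ lam φ q κ₁ κ₂ κ₃ κ₄) {b : ℝ → ℝ}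
    {G : X → X → ℝ} (hG : IsKernel μ lam φ b G) {p : ℝ≥0∞} (hp : 1 ≤ p) {C V β : ℝ} (hC : 0 ≤ C)
    (hV : 0 ≤ V) (hβ : q * (p⁻¹).toReal < β)
    (hpiece : ∀ M : ℝ, 1 ≤ M → ∀ x, ∫⁻ y, ‖spectralKernel lam φ (dyadicPiece b M) x y‖ₑ ∂μ ≤
      ENNReal.ofReal (C * M ^ (-β))) {N : ℝ} (hN : 1 ≤ N) {ν : SignedMeasure X}
    (hτ : (ν.variation + μ) Set.univ ≤ ENNReal.ofReal V)
    (hsup : ∀ j : ℕ, ∀ y,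
      ∫⁻ x, ‖spectralKernel lam φ (dyadicPiece b (N * 2 ^ j)) x y‖ₑ ∂(ν.variation + μ) ≤
        ENNReal.ofReal (C * V * (N * 2 ^ j) ^ (-β)) * ENNReal.ofReal ((2 ^ j) ^ q))
    (hν : IsQuadrature 𝕜 μ lam φ N ν) :
    kernelError μ G p ν ≤
      ENNReal.ofReal (C * V * (1 - 2 ^ (q * (p⁻¹).toReal - β))⁻¹ * N ^ (-β)) := by
  have := h.prob
  have := isFiniteMeasure_variation ν
  have hN0 : 0 < N := by linarith
  have hβ0 : 0 < β := lt_of_le_of_lt (mul_nonneg h.q_pos.le ENNReal.toReal_nonneg) hβ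
  set θ := (p⁻¹).toReal with hθ
  set w : ℝ := 2 ^ (q * θ - β) with hw
  have hw0 : 0 < w := by positivity
  have hw1 : w < 1 := Real.rpow_lt_one_of_one_lt_of_neg one_lt_two (by linarith)
  have hz : ∀ j : ℕ, ∀ l, 2 * (N * 2 ^ j) ≤ l → dyadicPiece b (N * 2 ^ j) l = 0 := fun j l hl =>
    dyadicPiece_eq_zero (by positivity) hl
  have hM : ∀ j : ℕ, 1 ≤ N * 2 ^ j := fun j => one_le_mul_of_one_le_of_one_le hN
    (one_le_pow₀ one_le_two)
  set A : ℕ → X → ℝ := fun j y =>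
    quadError μ ν fun x => spectralKernel lam φ (dyadicPiece b (N * 2 ^ j)) x y with hA
  have hkm : ∀ j, Measurable (Function.uncurry (spectralKernel lam φ (dyadicPiece b (N * 2 ^ j)))) :=
    fun j => h.measurable_spectralKernel (hz j)
  have hprod : ∀ j, Integrable (Function.uncurry
      (spectralKernel lam φ (dyadicPiece b (N * 2 ^ j)))) ((ν.variation + μ).prod μ) := fun j =>
    integrable_prod_of_lintegral_le (hkm j).aestronglyMeasurable (hpiece _ (hM j))
  have hAm : ∀ j, AEStronglyMeasurable (A j) μ := fun j => aestronglyMeasurable_quadError (hprod j)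
  have hAle : ∀ j y, ‖A j y‖ₑ ≤
      ∫⁻ x, ‖spectralKernel lam φ (dyadicPiece b (N * 2 ^ j)) x y‖ₑ ∂(ν.variation + μ) := fun j y =>
    enorm_quadError_le (h.integrable_spectralKernel_left (hz j) _ y)
  have hA1 : ∀ j, ∫⁻ y, ‖A j y‖ₑ ∂μ ≤ ENNReal.ofReal (C * V * (N * 2 ^ j) ^ (-β)) := fun j => by
    calc _ ≤ ∫⁻ y, ∫⁻ x, ‖spectralKernel lam φ (dyadicPiece b (N * 2 ^ j)) x y‖ₑ
            ∂(ν.variation + μ) ∂μ := lintegral_mono (hAle j)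
      _ = ∫⁻ x, ∫⁻ y, ‖spectralKernel lam φ (dyadicPiece b (N * 2 ^ j)) x y‖ₑ ∂μ
            ∂(ν.variation + μ) :=
          (lintegral_lintegral_swap (f := fun x y =>
            ‖spectralKernel lam φ (dyadicPiece b (N * 2 ^ j)) x y‖ₑ) (hkm j).enorm.aemeasurable).symm
      _ ≤ ∫⁻ _, ENNReal.ofReal (C * (N * 2 ^ j) ^ (-β)) ∂(ν.variation + μ) :=
          lintegral_mono (hpiece _ (hM j))
      _ ≤ ENNReal.ofReal (C * (N * 2 ^ j) ^ (-β)) * ENNReal.ofReal V := by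
          rw [lintegral_const]
          exact mul_le_mul' le_rfl hτ
      _ = _ := by
          rw [← ENNReal.ofReal_mul (by positivity)]
          congr 1
          ring
  -- The supremum bound exceeds the `L¹` bound by `2^{jq}`; interpolation keeps only `2^{jq/p}`, so
  -- the terms are geometric with ratio `w < 1`.
  have hAp : ∀ j, eLpNorm (A j) p.conjExponent μ ≤
      ENNReal.ofReal ((C * V * N ^ (-β)) * w ^ j) := fun j => by
    refine (eLpNorm_conjExponent_le hp (fun y => (hAle j y).trans (hsup j y)) (hA1 j)).trans_eq ?_
    rw [ENNReal.ofReal_rpow_of_nonneg (by positivity) ENNReal.toReal_nonneg,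
      ← ENNReal.ofReal_mul (by positivity), ← hθ]
    congr 1
    have e1 : w ^ j = ((2 : ℝ) ^ j) ^ (q * θ - β) := by
      rw [hw, ← Real.rpow_natCast, ← Real.rpow_natCast, ← Real.rpow_mul zero_le_two,
        ← Real.rpow_mul zero_le_two, mul_comm]
    have e2 : (((2 : ℝ) ^ j) ^ q) ^ θ = ((2 : ℝ) ^ j) ^ (q * θ) :=
      (Real.rpow_mul (by positivity) _ _).symm
    rw [e1, e2, Real.mul_rpow hN0.le (by positivity), sub_eq_add_neg,
      Real.rpow_add (by positivity)]
    ring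
  set u : ℕ → X → ℝ := fun L y =>
    quadError μ ν fun x => spectralKernel lam φ (lowPass b (N * 2 ^ L)) x y with hu
  have hlowz : ∀ L : ℕ, ∀ l, N * 2 ^ L ≤ l → lowPass b (N * 2 ^ L) l = 0 := fun L l hl =>
    lowPass_eq_zero (by positivity) hl
  have huA : ∀ L, u L = ∑ j ∈ Finset.range L, A j := fun L => by
    ext y
    rw [Finset.sum_apply]
    exact h.quadError_lowPass hN0 hν L y
  have hum : ∀ L, AEStronglyMeasurable (u L) μ := fun L => by
    rw [huA]
    exact Finset.aestronglyMeasurable_sum _ fun j _ => hAm j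
  have hup : ∀ L, eLpNorm (u L) p.conjExponent μ ≤
      ENNReal.ofReal (C * V * (1 - w)⁻¹ * N ^ (-β)) := fun L => by
    have hconj := ENNReal.HolderConjugate.conjExponent hp
    rw [huA]
    calc _ ≤ ∑ j ∈ Finset.range L, eLpNorm (A j) p.conjExponent μ :=
          eLpNorm_sum_le (fun j _ => hAm j) (ENNReal.HolderConjugate.one_le p.conjExponent p)
      _ ≤ ∑ j ∈ Finset.range L, ENNReal.ofReal ((C * V * N ^ (-β)) * w ^ j) :=
          Finset.sum_le_sum fun j _ => hAp j
      _ ≤ ∑' j : ℕ, ENNReal.ofReal ((C * V * N ^ (-β)) * w ^ j) := ENNReal.sum_le_tsum _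
      _ = _ := by
          rw [tsum_ofReal_geometric (by positivity) hw0.le hw1]
          congr 1
          ring
  obtain ⟨C', hC', hGC⟩ := h.exists_lintegral_kernel_le hG hC hβ0 hpiece
  have hGi := h.integrable_kernel_prod hG hGC ν
  have hv1 : (2 : ℝ) ^ (-β) < 1 := Real.rpow_lt_one_of_one_lt_of_neg one_lt_two (by linarith)
  have hv0 : 0 < 1 - (2 : ℝ) ^ (-β) := by linarith
  -- The partial sums approach the error of `G` in `L¹` only. Convergence in measure suffices to
  -- pass the uniform `L^{p'}` bound to the limit, by lower semicontinuity of the norm.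
  have hlim : TendstoInMeasure μ u atTop (fun y => quadError μ ν fun x => G x y) := by
    refine tendstoInMeasure_of_tendsto_eLpNorm one_ne_zero hum
      (aestronglyMeasurable_quadError hGi) ?_
    have hbound : ∀ L : ℕ, eLpNorm (u L - fun y => quadError μ ν fun x => G x y) 1 μ ≤
        ENNReal.ofReal (C * (1 - 2 ^ (-β))⁻¹ * (N * 2 ^ L) ^ (-β) * V) := fun L => by
      rw [eLpNorm_one_eq_lintegral_enorm]
      have hDm : Measurable (Function.uncurry fun x y =>
          G x y - spectralKernel lam φ (lowPass b (N * 2 ^ L)) x y) :=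
        hG.measurable.sub (h.measurable_spectralKernel (hlowz L))
      calc _ ≤ ∫⁻ y, ∫⁻ x, ‖G x y - spectralKernel lam φ (lowPass b (N * 2 ^ L)) x y‖ₑ
              ∂(ν.variation + μ) ∂μ := by
            refine lintegral_mono_ae ?_
            filter_upwards [hGi.prod_left_ae] with y hy'
            have hy : Integrable (fun x => G x y) (ν.variation + μ) := hy'
            have hl := h.integrable_spectralKernel_left (hlowz L) (ν.variation + μ) y
            rw [Pi.sub_apply, enorm_sub_rev]
            simp only [hu]
            rw [← quadError_sub hy hl]
            exact enorm_quadError_le (hy.sub hl)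
        _ = ∫⁻ x, ∫⁻ y, ‖G x y - spectralKernel lam φ (lowPass b (N * 2 ^ L)) x y‖ₑ ∂μ
              ∂(ν.variation + μ) :=
            (lintegral_lintegral_swap (f := fun x y =>
              ‖G x y - spectralKernel lam φ (lowPass b (N * 2 ^ L)) x y‖ₑ)
              hDm.enorm.aemeasurable).symm
        _ ≤ ∫⁻ _, ENNReal.ofReal (C * (1 - 2 ^ (-β))⁻¹ * (N * 2 ^ L) ^ (-β)) ∂(ν.variation + μ) :=
            lintegral_mono (h.lintegral_sub_lowPass_le hG hC hβ0 hpiece (hM L))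
        _ ≤ ENNReal.ofReal (C * (1 - 2 ^ (-β))⁻¹ * (N * 2 ^ L) ^ (-β)) * ENNReal.ofReal V := by
            rw [lintegral_const]
            exact mul_le_mul' le_rfl hτ
        _ = _ := by rw [← ENNReal.ofReal_mul (by positivity)]
    refine tendsto_of_tendsto_of_tendsto_of_le_of_le tendsto_const_nhds ?_
      (fun L => zero_le) hbound
    rw [← ENNReal.ofReal_zero]
    refine ENNReal.tendsto_ofReal ?_
    have hg := (tendsto_pow_atTop_nhds_zero_of_lt_one (by positivity) hv1).const_mul
      (C * (1 - 2 ^ (-β))⁻¹ * N ^ (-β) * V)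
    rw [mul_zero] at hg
    refine hg.congr fun L => ?_
    rw [Real.mul_rpow hN0.le (by positivity), ← Real.rpow_natCast, ← Real.rpow_natCast,
      ← Real.rpow_mul zero_le_two, ← Real.rpow_mul zero_le_two, mul_comm (L : ℝ)]
    ring
  exact eLpNorm_le_of_tendstoInMeasure (Eventually.of_forall hup) hlim hum

end IsDataDefinedSpace

/-! ### Multiplier operators and the K-functional. -/

/-- The operator with spectral multiplier `m`. -/
def multiplierOp {𝕜 X : Type*} [RCLike 𝕜] [MeasurableSpace X] (μ : Measure X) (lam : ℕ → ℝ)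
    (φ : ℕ → X → ℝ) (m : ℝ → ℝ) (f : X → 𝕜) (x : X) : 𝕜 :=
  ∫ y, (spectralKernel lam φ m x y : 𝕜) * f y ∂μ

lemma omega_le_hNorm_mul {𝕜 X : Type*} [RCLike 𝕜] [MeasurableSpace X] {μ : Measure X}
    {lam : ℕ → ℝ} {φ : ℕ → X → ℝ} {γ r : ℝ} {p : ℝ≥0∞} {f : X → 𝕜} {δ : ℝ} (hδ : 0 < δ)
    (hδ1 : δ ≤ 1) :
    omega μ lam φ r p f δ ≤ hNorm μ lam φ γ r p f * ENNReal.ofReal (δ ^ γ) := by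
  have h0 : ENNReal.ofReal (δ ^ γ) ≠ 0 := by
    rw [Ne, ENNReal.ofReal_eq_zero, not_le]
    positivity
  rw [← ENNReal.div_le_iff h0 ENNReal.ofReal_ne_top]
  refine le_trans ?_ le_add_self
  exact le_iSup₂_of_le δ ⟨hδ, hδ1⟩ le_rfl

namespace IsDataDefinedSpace

variable {X : Type*} [TopologicalSpace X] [MeasurableSpace X] [BorelSpace X]
  {ρ : X → X → ℝ} {μ : Measure X} {lam : ℕ → ℝ} {φ : ℕ → X → ℝ} {q κ₁ κ₂ κ₃ κ₄ : ℝ}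
  {𝕜 : Type*} [RCLike 𝕜]

lemma eLpNorm_multiplierOp_le (h : IsDataDefinedSpace ρ μ lam φ q κ₁ κ₂ κ₃ κ₄) {m : ℝ → ℝ} {N : ℝ}
    (hm : ∀ l, N ≤ l → m l = 0) {C : ℝ}
    (hC : ∀ x, ∫⁻ y, ‖spectralKernel lam φ m x y‖ₑ ∂μ ≤ ENNReal.ofReal C) {p : ℝ≥0∞} (hp : 1 ≤ p)
    {f : X → 𝕜} (hf : AEStronglyMeasurable f μ) :
    eLpNorm (multiplierOp μ lam φ m f) p μ ≤ ENNReal.ofReal C * eLpNorm f p μ := by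
  have := h.prob
  refine eLpNorm_le_of_kernel (k := fun x y => ‖spectralKernel lam φ m x y‖ₑ)
    (h.measurable_spectralKernel hm).enorm ENNReal.ofReal_ne_top hC (fun y => ?_) hp hf fun x => ?_
  · simp only [spectralKernel_comm lam φ m _ y]
    exact hC y
  · refine (enorm_integral_le_lintegral_enorm _).trans_eq (lintegral_congr fun y => ?_)
    rw [enorm_mul]
    simp [← ofReal_norm]

lemma multiplierOp_eq_expansion (h : IsDataDefinedSpace ρ μ lam φ q κ₁ κ₂ κ₃ κ₄) {m : ℝ → ℝ}
    {N : ℝ} (hm : ∀ l, N ≤ l → m l = 0) {f : X → 𝕜} (hf : Integrable f μ) :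
    multiplierOp μ lam φ m f =
      expansion φ (h.indices N) fun k => (m (lam k) : 𝕜) * fourierCoef μ φ f k := by
  ext x
  rw [multiplierOp, h.integral_spectralKernel_mul hm hf, expansion]
  refine Finset.sum_congr rfl fun k _ => ?_
  push_cast
  ring

/-- For a competitor `f₁` with `g = Δ^r f₁`, the operator acts on `P - f₁` with norm `C M^β`. On
`f₁` it equals the operator with multiplier `(1+t)^{-r} m` applied to `g`, of norm `C M^{β-r}`; the
gain `M^{-r}` is the weight `δ^r` at `δ = 1/M`. -/
lemma eLpNorm_multiplierOp_le_omega (h : IsDataDefinedSpace ρ μ lam φ q κ₁ κ₂ κ₃ κ₄)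
    {m : ℝ → ℝ} {C M β r : ℝ} (hC : 0 < C) (hM : 1 ≤ M)
    (h1 : ∀ x, ∫⁻ y, ‖spectralKernel lam φ (dyadicPiece m M) x y‖ₑ ∂μ ≤ ENNReal.ofReal (C * M ^ β))
    (h2 : ∀ x, ∫⁻ y, ‖spectralKernel lam φ (dyadicPiece (fun t => (1 + t) ^ (-r) * m t) M) x y‖ₑ ∂μ ≤
      ENNReal.ofReal (C * M ^ (β - r))) {p : ℝ≥0∞} (hp : 1 ≤ p) {P : X → 𝕜} (hP : MemLp P p μ) :
    eLpNorm (multiplierOp μ lam φ (dyadicPiece m M) P) p μ ≤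
      ENNReal.ofReal (C * M ^ β) * omega μ lam φ r p P (1 / M) := by
  have := h.prob
  have hM0 : 0 < M := by linarith
  have hc0 : ENNReal.ofReal (C * M ^ β) ≠ 0 := by
    rw [Ne, ENNReal.ofReal_eq_zero, not_le]
    positivity
  have hz : ∀ m : ℝ → ℝ, ∀ l, 2 * M ≤ l → dyadicPiece m M l = 0 := fun m l hl =>
    dyadicPiece_eq_zero hM0 hl
  -- Dividing by the positive finite constant isolates the infimum, so a single competitor can be
  -- fixed.
  rw [mul_comm, ← ENNReal.div_le_iff hc0 ENNReal.ofReal_ne_top]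
  refine le_iInf fun f₁ => le_iInf fun g => le_iInf fun hfg => ?_
  rw [ENNReal.div_le_iff hc0 ENNReal.ofReal_ne_top, mul_comm]
  have hf₁ := hfg.mem_left.1
  have hg := hfg.mem_right.1
  have hPi := hP.integrable hp
  have hfi := hf₁.integrable hp
  have hgi := hg.integrable hp
  have hcoef : ∀ k, fourierCoef μ φ (P - f₁) k = fourierCoef μ φ P k - fourierCoef μ φ f₁ k := by
    intro k
    simp only [fourierCoef, Pi.sub_apply, sub_mul]
    exact integral_sub (h.integrable_mul_phi hPi k) (h.integrable_mul_phi hfi k)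
  have hsplit : multiplierOp μ lam φ (dyadicPiece m M) P =
      multiplierOp μ lam φ (dyadicPiece m M) (P - f₁) +
        multiplierOp μ lam φ (dyadicPiece (fun t => (1 + t) ^ (-r) * m t) M) g := by
    rw [h.multiplierOp_eq_expansion (hz _) hPi, h.multiplierOp_eq_expansion (hz _) (hPi.sub hfi),
      h.multiplierOp_eq_expansion (hz _) hgi]
    ext x
    simp only [Pi.add_apply, expansion]
    rw [← Finset.sum_add_distrib]
    refine Finset.sum_congr rfl fun k _ => ?_
    have hl : 0 < 1 + lam k := by linarith [h.lam_nonneg k]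
    have e1 : (((1 + lam k) ^ (-r) : ℝ) : 𝕜) * (((lam k + 1) ^ r : ℝ) : 𝕜) = 1 := by
      rw [← RCLike.ofReal_mul, add_comm (lam k), ← Real.rpow_add hl]
      simp
    rw [hcoef, hfg.coef]
    simp only [dyadicPiece]
    push_cast
    linear_combination (-(bump (lam k / M) : 𝕜) * (m (lam k) : 𝕜) * fourierCoef μ φ f₁ k *
      (φ k x : 𝕜)) * e1
  have hop : ∀ (m : ℝ → ℝ) {f : X → 𝕜}, Integrable f μ →
      AEStronglyMeasurable (multiplierOp μ lam φ (dyadicPiece m M) f) μ := fun m f hf => by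
    rw [h.multiplierOp_eq_expansion (hz _) hf]
    exact (h.measurable_expansion _ _).aestronglyMeasurable
  rw [hsplit]
  refine (eLpNorm_add_le (hop _ (hPi.sub hfi)) (hop _ hgi) hp).trans ?_
  rw [mul_add]
  refine add_le_add (h.eLpNorm_multiplierOp_le (hz _) h1 hp (hP.1.sub hf₁.1)) ?_
  refine (h.eLpNorm_multiplierOp_le (hz _) h2 hp hg.1).trans_eq ?_
  rw [← mul_assoc, ← ENNReal.ofReal_mul (by positivity)]
  congr 2
  rw [one_div, Real.inv_rpow hM0.le, sub_eq_add_neg, Real.rpow_add hM0, Real.rpow_neg hM0.le r,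
    mul_assoc]

/-- The `L^p` norm of the polynomial obtained by dividing the coefficients of `P` by a mask. -/
lemma eLpNorm_expansion_le_hNorm (h : IsDataDefinedSpace ρ μ lam φ q κ₁ κ₂ κ₃ κ₄)
    {m : ℝ → ℝ} {C β γ r : ℝ} (hC : 0 < C) (hγβ : γ < β)
    (h1 : ∀ M, 1 ≤ M → ∀ x, ∫⁻ y, ‖spectralKernel lam φ (dyadicPiece m M) x y‖ₑ ∂μ ≤
      ENNReal.ofReal (C * M ^ β))
    (h2 : ∀ M, 1 ≤ M → ∀ x, ∫⁻ y,
      ‖spectralKernel lam φ (dyadicPiece (fun t => (1 + t) ^ (-r) * m t) M) x y‖ₑ ∂μ ≤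
        ENNReal.ofReal (C * M ^ (β - r)))
    (h3 : ∀ M, 1 ≤ M → M < 2 → ∀ x, ∫⁻ y, ‖spectralKernel lam φ (lowPass m (2 * M)) x y‖ₑ ∂μ ≤
      ENNReal.ofReal C) {p : ℝ≥0∞} (hp : 1 ≤ p) {N : ℝ} (hN : 1 ≤ N) {P : X → 𝕜}
    (hP : P ∈ diffusionPoly 𝕜 lam φ N) :
    eLpNorm (expansion φ (h.indices N) fun k => (m (lam k) : 𝕜) * fourierCoef μ φ P k) p μ ≤
      ENNReal.ofReal (C * ((1 - 2 ^ (γ - β))⁻¹ + 1) * N ^ (β - γ)) * hNorm μ lam φ γ r p P := by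
  have := h.prob
  have hN0 : 0 < N := by linarith
  obtain ⟨hPe, hPz⟩ := h.eq_expansion_fourierCoef hP
  have hPm : MemLp P p μ := by
    obtain ⟨D, _, hD⟩ := h.exists_norm_expansion_le (h.indices N) (fourierCoef μ φ P)
    rw [← hPe] at hD
    refine MemLp.of_bound ?_ D (Eventually.of_forall hD)
    rw [hPe]
    exact (h.measurable_expansion _ _).aestronglyMeasurable
  have hPi := hPm.integrable hp
  -- The descent from `N` stops at `N / 2 ^ J` in `[1, 2)`, so every dyadic frequency is at least
  -- `1` and the remaining low part ranges over a bounded set of frequencies.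
  obtain ⟨J, hJ1, hJ2⟩ := exists_nat_pow_near hN one_lt_two
  have hJM : 1 ≤ N / 2 ^ J := by rw [le_div_iff₀ (by positivity), one_mul]; exact hJ1
  have hJM2 : N / 2 ^ J < 2 := by
    rw [div_lt_iff₀ (by positivity), ← pow_succ']
    exact hJ2
  have hMj : ∀ j, N / 2 ^ j ≤ N := fun j => div_le_self hN0.le (one_le_pow₀ one_le_two)
  have hMj1 : ∀ j, j ≤ J → 1 ≤ N / 2 ^ j := fun j hj => hJM.trans (by
    gcongr
    exact one_le_two)
  set O : ℕ → X → 𝕜 := fun j => multiplierOp μ lam φ (dyadicPiece m (N / 2 ^ j)) P with hO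
  set Q : X → 𝕜 := multiplierOp μ lam φ (lowPass m (2 * (N / 2 ^ J))) P with hQ
  have hzO : ∀ j : ℕ, ∀ l, 2 * N ≤ l → dyadicPiece m (N / 2 ^ j) l = 0 := fun j l hl =>
    dyadicPiece_eq_zero (by positivity) (by linarith [hMj j])
  have hzQ : ∀ l, 2 * N ≤ l → lowPass m (2 * (N / 2 ^ J)) l = 0 := fun l hl =>
    lowPass_eq_zero (by positivity) (by linarith [hMj J])
  have hOe := fun j => h.multiplierOp_eq_expansion (hzO j) hPi
  have hQe := h.multiplierOp_eq_expansion hzQ hPi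
  have hsplit : (expansion φ (h.indices N) fun k => (m (lam k) : 𝕜) * fourierCoef μ φ P k) =
      ∑ j ∈ Finset.range J, O j + Q := by
    ext x
    simp only [hO, hQ, hOe, hQe, Pi.add_apply, Finset.sum_apply, expansion]
    rw [Finset.sum_comm, ← Finset.sum_add_distrib]
    have hsub : h.indices N ⊆ h.indices (2 * N) := fun k hk => by
      rw [h.mem_indices] at hk ⊢
      linarith
    rw [← Finset.sum_subset hsub]
    · refine Finset.sum_congr rfl fun k hk => ?_
      rw [← Finset.sum_mul, ← Finset.sum_mul, ← add_mul, ← add_mul]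
      congr 2
      simp only [dyadicPiece, lowPass]
      have e1 := telescope_bump_low (lam k) (N := N) J
      rw [cutoff_eq_one ((div_le_one hN0).2 (h.mem_indices.1 hk).le)] at e1
      rw [mul_div_mul_left _ _ two_ne_zero]
      have e2 : m (lam k) = ∑ j ∈ Finset.range J, bump (lam k / (N / 2 ^ j)) * m (lam k) +
          cutoff (lam k / (N / 2 ^ J)) * m (lam k) := by
        rw [← Finset.sum_mul, ← add_mul, ← e1, one_mul]
      conv_lhs => rw [e2]
      push_cast
      rfl
    · intro k _ hk
      rw [hPz k (by rw [h.mem_indices] at hk; exact not_lt.1 hk)]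
      simp
  have hOm : ∀ j, AEStronglyMeasurable (O j) μ := fun j => by
    simp only [hO, hOe]
    exact (h.measurable_expansion _ _).aestronglyMeasurable
  have hQm : AEStronglyMeasurable Q μ := by
    rw [hQ, hQe]
    exact (h.measurable_expansion _ _).aestronglyMeasurable
  set H := hNorm μ lam φ γ r p P with hH
  set w : ℝ := 2 ^ (γ - β) with hw
  have hw0 : 0 < w := by positivity
  have hw1 : w < 1 := Real.rpow_lt_one_of_one_lt_of_neg one_lt_two (by linarith)
  have hOle : ∀ j ∈ Finset.range J, eLpNorm (O j) p μ ≤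
      ENNReal.ofReal (C * N ^ (β - γ) * w ^ j) * H := fun j hj => by
    have hM := hMj1 j (Finset.mem_range.1 hj).le
    set M := N / 2 ^ j with hMdef
    have hM0 : 0 < M := by linarith
    refine (h.eLpNorm_multiplierOp_le_omega hC hM (h1 M hM) (h2 M hM) hp hPm).trans ?_
    refine (mul_le_mul' le_rfl (omega_le_hNorm_mul (γ := γ) (by positivity)
      ((div_le_one hM0).2 hM))).trans_eq ?_
    rw [mul_comm _ (ENNReal.ofReal ((1 / M) ^ γ)), ← mul_assoc,
      ← ENNReal.ofReal_mul (by positivity)]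
    congr 2
    have e1 : M ^ β * (1 / M) ^ γ = M ^ (β - γ) := by
      rw [one_div, Real.inv_rpow hM0.le, Real.rpow_sub hM0]
      rfl
    have e2 : w ^ j = (((2 : ℝ) ^ j) ^ (β - γ))⁻¹ := by
      rw [hw, ← Real.rpow_natCast, ← Real.rpow_natCast, ← Real.rpow_mul zero_le_two,
        ← Real.rpow_mul zero_le_two, ← Real.rpow_neg zero_le_two]
      congr 1
      ring
    rw [mul_assoc, e1, e2, hMdef, Real.div_rpow hN0.le (by positivity)]
    ring
  have hQle : eLpNorm Q p μ ≤ ENNReal.ofReal (C * N ^ (β - γ)) * H := by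
    refine (h.eLpNorm_multiplierOp_le hzQ (h3 _ hJM hJM2) hp hPm.1).trans ?_
    refine mul_le_mul' (ENNReal.ofReal_le_ofReal ?_) le_self_add
    exact le_mul_of_one_le_right hC.le (Real.one_le_rpow hN (by linarith))
  rw [hsplit]
  calc eLpNorm (∑ j ∈ Finset.range J, O j + Q) p μ
      ≤ eLpNorm (∑ j ∈ Finset.range J, O j) p μ + eLpNorm Q p μ :=
        eLpNorm_add_le (Finset.aestronglyMeasurable_sum _ fun j _ => hOm j) hQm hp
    _ ≤ ∑ j ∈ Finset.range J, eLpNorm (O j) p μ + eLpNorm Q p μ := by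
        gcongr
        exact eLpNorm_sum_le (fun j _ => hOm j) hp
    _ ≤ ∑ j ∈ Finset.range J, ENNReal.ofReal (C * N ^ (β - γ) * w ^ j) * H +
          ENNReal.ofReal (C * N ^ (β - γ)) * H :=
        add_le_add (Finset.sum_le_sum hOle) hQle
    _ ≤ ENNReal.ofReal (C * N ^ (β - γ) * (1 - w)⁻¹) * H + ENNReal.ofReal (C * N ^ (β - γ)) * H := by
        gcongr
        rw [← Finset.sum_mul, ← tsum_ofReal_geometric (by positivity) hw0.le hw1]
        exact mul_le_mul' (ENNReal.sum_le_tsum _) le_rfl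
    _ = _ := by
        have : 0 < 1 - w := by linarith
        rw [← add_mul, ← ENNReal.ofReal_add (by positivity) (by positivity)]
        congr 2
        ring

end IsDataDefinedSpace

/-! ### The two main estimates with uniform constants. -/

namespace IsDataDefinedSpace

variable {X : Type*} [TopologicalSpace X] [MeasurableSpace X]
  {ρ : X → X → ℝ} {μ : Measure X} {lam : ℕ → ℝ} {φ : ℕ → X → ℝ} {q κ₁ κ₂ κ₃ κ₄ : ℝ}

/-- Multipliers supported on low frequencies have bounded kernels. -/
lemma lintegral_lowPass_le (h : IsDataDefinedSpace ρ μ lam φ q κ₁ κ₂ κ₃ κ₄) {m : ℝ → ℝ} {C M : ℝ}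
    (hC : 0 ≤ C) (hm : ∀ t, 0 ≤ t → t ≤ 4 → |m t| ≤ C) (hM1 : 1 ≤ M) (hM : M < 2) (x : X) :
    ∫⁻ y, ‖spectralKernel lam φ (lowPass m (2 * M)) x y‖ₑ ∂μ ≤
      ENNReal.ofReal (C * Real.exp 16 * κ₃) := by
  have := h.prob
  -- The cutoff vanishes beyond `2M < 4`, and `exp(16 - λ²) ≥ 1` for `0 ≤ λ ≤ 4`; comparison with
  -- the heat kernel at time `1` then needs no smoothness of `m`.
  have ha : ∀ k, |lowPass m (2 * M) (lam k)| ≤ C * Real.exp 16 * Real.exp (-(lam k) ^ 2 * 1) := by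
    intro k
    have hl := h.lam_nonneg k
    by_cases hk : lam k ≤ 4
    · rw [lowPass, abs_mul, abs_of_nonneg (cutoff_nonneg _), mul_assoc, ← Real.exp_add]
      calc cutoff (2 * lam k / (2 * M)) * |m (lam k)| ≤ 1 * C :=
            mul_le_mul (cutoff_le_one _) (hm _ hl hk) (abs_nonneg _) zero_le_one
        _ ≤ C * Real.exp (16 + -(lam k) ^ 2 * 1) := by
            rw [one_mul]
            exact le_mul_of_one_le_right hC (Real.one_le_exp (by nlinarith))
    · rw [lowPass_eq_zero (by linarith) (by linarith), abs_zero]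
      positivity
  calc _ ≤ ∫⁻ _, ENNReal.ofReal (C * Real.exp 16 * κ₃) ∂μ := by
        refine lintegral_mono fun y => ?_
        obtain ⟨hs, hb⟩ := h.summable_abs_of_le one_pos le_rfl (by positivity) ha x y
        rw [Real.one_rpow, mul_one] at hb
        rw [Real.enorm_eq_ofReal_abs]
        have h1 : |spectralKernel lam φ (lowPass m (2 * M)) x y| ≤
            ∑' k, |lowPass m (2 * M) (lam k) * φ k x * φ k y| :=
          norm_tsum_le_tsum_norm (f := fun k => lowPass m (2 * M) (lam k) * φ k x * φ k y) hs
        exact ENNReal.ofReal_le_ofReal (h1.trans hb)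
    _ = _ := by simp

end IsDataDefinedSpace

lemma lintegral_enorm_le_of_abs_le {X : Type*} [MeasurableSpace X] {τ : Measure X} {f d : X → ℝ}
    {a : ℝ} {D : ℝ≥0∞} (ha : 0 ≤ a) (hf : ∀ y, |f y| ≤ a * d y)
    (hd : ∫⁻ y, ENNReal.ofReal (d y) ∂τ ≤ D) : ∫⁻ y, ‖f y‖ₑ ∂τ ≤ ENNReal.ofReal a * D := by
  calc ∫⁻ y, ‖f y‖ₑ ∂τ ≤ ∫⁻ y, ENNReal.ofReal a * ENNReal.ofReal (d y) ∂τ := by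
        refine lintegral_mono fun y => ?_
        rw [Real.enorm_eq_ofReal_abs, ← ENNReal.ofReal_mul ha]
        exact ENNReal.ofReal_le_ofReal (hf y)
    _ = ENNReal.ofReal a * ∫⁻ y, ENNReal.ofReal (d y) ∂τ :=
        lintegral_const_mul' _ _ ENNReal.ofReal_ne_top
    _ ≤ _ := mul_le_mul' le_rfl hd

/-- The slack in `|C| + 1` makes the inequality strict, so some admissible constant lies below it;
the absolute value covers negative `C`. -/
lemma variation_cball_le_of_regNorm_le {X : Type*} [MeasurableSpace X] {ρ : X → X → ℝ} {q δ C : ℝ}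
    {ν : SignedMeasure X} (h : regNorm ρ q ν δ ≤ ENNReal.ofReal C) (x : X) :
    ν.variation (cball ρ x δ) ≤ ENNReal.ofReal (|C| + 1) * ENNReal.ofReal (δ ^ q) := by
  have hlt : regNorm ρ q ν δ < ENNReal.ofReal (|C| + 1) := by
    refine h.trans_lt ((ENNReal.ofReal_lt_ofReal_iff (by positivity)).2 ?_)
    linarith [le_abs_self C]
  obtain ⟨c, hc, hc1⟩ := sInf_lt_iff.1 hlt
  exact (hc x).trans (mul_le_mul' hc1.le le_rfl)

namespace IsDataDefinedSpace

variable {X : Type*} [TopologicalSpace X] [MeasurableSpace X] [BorelSpace X]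
  {ρ : X → X → ℝ} {μ : Measure X} {lam : ℕ → ℝ} {φ : ℕ → X → ℝ} {q κ₁ κ₂ κ₃ κ₄ : ℝ}
  {𝕜 : Type*} [RCLike 𝕜]

/-- Kernel errors of quadrature measures, uniformly over the data-defined spaces on `(ρ, μ)`. -/
lemma exists_kernelError_le (h₀ : IsDataDefinedSpace ρ μ lam φ q κ₁ κ₂ κ₃ κ₄) (𝕜 : Type*)
    [RCLike 𝕜] {p : ℝ≥0∞} (hp : 1 ≤ p) {β : ℝ} (hβ : q * (p⁻¹).toReal < β) {S : ℕ} (hS : q < S)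
    {b : ℝ → ℝ} (hb : IsMask S β b) (Cv Cr : ℝ) :
    ∃ C : ℝ, 0 < C ∧ ∀ (lam : ℕ → ℝ) (φ : ℕ → X → ℝ),
      IsDataDefinedSpace ρ μ lam φ q κ₁ κ₂ κ₃ κ₄ → ∀ G : X → X → ℝ, IsKernel μ lam φ b G →
      (∃ C' : ℝ, 0 ≤ C' ∧ ∀ x, ∫⁻ y, ‖G x y‖ₑ ∂μ ≤ ENNReal.ofReal C') ∧
      ∀ N : ℝ, 1 ≤ N → ∀ ν : SignedMeasure X, ν.variation Set.univ ≤ ENNReal.ofReal Cv →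
        regNorm ρ q ν (1 / N) ≤ ENNReal.ofReal Cr → IsQuadrature 𝕜 μ lam φ N ν →
        kernelError μ G p ν ≤ ENNReal.ofReal (C * N ^ (-β)) := by
  have hq := h₀.q_pos
  have hκ₁ := h₀.kappa₁_pos
  have hκ₂ := h₀.kappa₂_pos
  have hS1 : 1 ≤ S := by
    have : (0 : ℝ) < S := hq.trans hS
    exact_mod_cast this
  obtain ⟨Δ, hΔ, hρΔ⟩ := h₀.exists_rho_le
  obtain ⟨c, hc, hball⟩ := exists_measure_cball_ge q κ₂ κ₃ κ₄ h₀.kappa₄_pos hq h₀.kappa₃_pos hκ₂ ρ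
  obtain ⟨F, cF, _, hcF, -, hbF, hF, -⟩ := hb.exists_profile
  obtain ⟨K, hK, hloc⟩ := exists_bump_kernel_le q h₀.kappa₄_pos hΔ h₀.kappa₃_pos S hS1 ρ hρΔ hcF
    (hF.mono (Set.subset_univ _) le_rfl) hbF
  obtain ⟨D, hD, hdecμ⟩ := exists_lintegral_decay_le hq hκ₂ hS ρ
  obtain ⟨D', hD', hdec⟩ := lintegral_decay_le (X := X) (ρ := ρ) hS hq.le
  set C := K * (D + D') with hC
  -- The regularity constant of `|ν| + μ` at all scales from `1/N` on: `|Cr| + 1` for `ν` and `κ₂`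
  -- for `μ` at scale `1/N`, times the loss in `measure_cball_le_of_scale`.
  set R := κ₂ * (2 * κ₁) ^ q / c * (|Cr| + 1 + κ₂) with hR
  have hR0 : 0 < R := by positivity
  set V := |Cv| + 1 + R with hV
  have hw1 : (2 : ℝ) ^ (q * (p⁻¹).toReal - β) < 1 :=
    Real.rpow_lt_one_of_one_lt_of_neg one_lt_two (by linarith)
  have hw2 : 0 < 1 - (2 : ℝ) ^ (q * (p⁻¹).toReal - β) := by linarith
  have hβ0 : 0 < β := lt_of_le_of_lt (mul_nonneg hq.le ENNReal.toReal_nonneg) hβ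
  refine ⟨C * V * (1 - 2 ^ (q * (p⁻¹).toReal - β))⁻¹, by positivity, fun lam φ h G hG => ?_⟩
  have hpiece : ∀ M : ℝ, 1 ≤ M → ∀ x, ∫⁻ y, ‖spectralKernel lam φ (dyadicPiece b M) x y‖ₑ ∂μ ≤
      ENNReal.ofReal (C * M ^ (-β)) := fun M hM x => by
    refine (lintegral_enorm_le_of_abs_le (by positivity) (fun y => hloc μ lam φ κ₁ κ₂ h M hM x y)
      (hdecμ μ lam φ κ₁ κ₃ κ₄ h M hM x)).trans ?_
    rw [← ENNReal.ofReal_mul (by positivity)]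
    refine ENNReal.ofReal_le_ofReal ?_
    have : 0 ≤ K * M ^ (-β) * D' := by positivity
    rw [hC]
    linarith
  refine ⟨h.exists_lintegral_kernel_le hG (by positivity) hβ0 hpiece, fun N hN ν hνV hνR hνQ => ?_⟩
  have := h.prob
  have := isFiniteMeasure_variation ν
  have hN0 : 0 < N := by linarith
  refine h.kernelError_le_of_isQuadrature hG hp (by positivity) (by positivity) hβ hpiece hN ?_ ?_
    hνQ
  · rw [Measure.add_apply, measure_univ (μ := μ), hV, add_assoc, ENNReal.ofReal_add (abs_nonneg _)
      (by positivity)]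
    refine add_le_add (hνV.trans (ENNReal.ofReal_le_ofReal (le_abs_self _))) ?_
    rw [← ENNReal.ofReal_one]
    exact ENNReal.ofReal_le_ofReal (by linarith)
  · intro j y
    have hτ : ∀ x, (ν.variation + μ) (cball ρ x (1 / N)) ≤
        ENNReal.ofReal (|Cr| + 1 + κ₂) * ENNReal.ofReal ((1 / N) ^ q) := fun x => by
      rw [Measure.add_apply, ENNReal.ofReal_add (by positivity) hκ₂.le, add_mul]
      exact add_le_add (variation_cball_le_of_regNorm_le hνR x)
        (h.measure_cball_le x (by positivity))
    have hscale : ∀ d, 1 / N ≤ d → (ν.variation + μ) (cball ρ y d) ≤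
        ENNReal.ofReal R * ENNReal.ofReal (d ^ q) := fun d hd => by
      rw [hR, ENNReal.ofReal_mul (by positivity)]
      exact h.measure_cball_le_of_scale hc (hball μ lam φ κ₁ h) (ν.variation + μ) (by positivity)
        ((div_le_one hN0).2 hN) hτ y hd
    have hM : 1 ≤ N * 2 ^ j := one_le_mul_of_one_le_of_one_le hN (one_le_pow₀ one_le_two)
    have h1 := (hdec (ν.variation + μ) y (h.quasiMetric.nonneg y) (h.continuous_rho y).measurable
      (ENNReal.ofReal R) (N * 2 ^ j) (1 / N) (by positivity) (by positivity) hscale).2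
    have e1 : N * 2 ^ j * (1 / N) = 2 ^ j := by field_simp
    rw [e1] at h1
    have h2 := lintegral_enorm_le_of_abs_le (τ := ν.variation + μ) (a := K * (N * 2 ^ j) ^ (-β))
      (by positivity) (fun x => by
        have := hloc μ lam φ κ₁ κ₂ h (N * 2 ^ j) hM x y
        rwa [h.quasiMetric.symm x y] at this) (h1 (one_le_pow₀ one_le_two))
    refine h2.trans ?_
    rw [← mul_assoc, ← ENNReal.ofReal_mul hD'.le, ← ENNReal.ofReal_mul (by positivity)]
    refine mul_le_mul' (ENNReal.ofReal_le_ofReal ?_) le_rfl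
    have e2 : D' * R ≤ (D + D') * V := by
      refine mul_le_mul (by linarith) ?_ hR0.le (by positivity)
      linarith [abs_nonneg Cv]
    calc K * (N * 2 ^ j) ^ (-β) * (D' * R) ≤ K * (N * 2 ^ j) ^ (-β) * ((D + D') * V) :=
          mul_le_mul_of_nonneg_left e2 (by positivity)
      _ = _ := by rw [hC]; ring

/-- Dividing the coefficients of a polynomial by a mask, uniformly over the data-defined spaces on
`(ρ, μ)`. -/
lemma exists_eLpNorm_expansion_le (h₀ : IsDataDefinedSpace ρ μ lam φ q κ₁ κ₂ κ₃ κ₄) (𝕜 : Type*)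
    [RCLike 𝕜] {p : ℝ≥0∞} (hp : 1 ≤ p) {β : ℝ} {S : ℕ} (hS : q < S) {b : ℝ → ℝ}
    (hb : IsMask S β b) {γ : ℝ} (hγβ : γ < β) (r : ℝ) :
    ∃ C : ℝ, 0 < C ∧ ∀ (lam : ℕ → ℝ) (φ : ℕ → X → ℝ)
      (h : IsDataDefinedSpace ρ μ lam φ q κ₁ κ₂ κ₃ κ₄) (N : ℝ), 1 ≤ N →
      ∀ P ∈ diffusionPoly 𝕜 lam φ N,
        eLpNorm (expansion φ (h.indices N) fun k =>
          (((b (lam k))⁻¹ : ℝ) : 𝕜) * fourierCoef μ φ P k) p μ ≤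
          ENNReal.ofReal (C * N ^ (β - γ)) * hNorm μ lam φ γ r p P := by
  have hq := h₀.q_pos
  have hκ₂ := h₀.kappa₂_pos
  have hκ₃ := h₀.kappa₃_pos
  have hS1 : 1 ≤ S := by
    have : (0 : ℝ) < S := hq.trans hS
    exact_mod_cast this
  obtain ⟨Δ, hΔ, hρΔ⟩ := h₀.exists_rho_le
  obtain ⟨F, cF, c₁, hcF, hc₁, hbF, hF, hF1⟩ := hb.exists_profile
  obtain ⟨cI, hcI, hFI⟩ := hF.exists_inv hc₁ hcF fun u _ => hF1 u
  have hFI' := hFI.mono (Set.subset_univ (Set.Ioi (-2))) le_rfl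
  have hbI : ∀ t, 0 < t → (b t)⁻¹ = (1 + t) ^ β * (F (Real.log t))⁻¹ := fun t ht => by
    rw [hbF t ht, mul_inv, Real.rpow_neg (by positivity), inv_inv]
  have hbr : ∀ t, 0 < t → (1 + t) ^ (-r) * (b t)⁻¹ = (1 + t) ^ (β - r) * (F (Real.log t))⁻¹ :=
    fun t ht => by
      rw [hbI t ht, ← mul_assoc, ← Real.rpow_add (by positivity)]
      congr 2
      ring
  obtain ⟨K, hK, hloc⟩ := exists_bump_kernel_le q h₀.kappa₄_pos hΔ hκ₃ S hS1 ρ hρΔ hcI hFI' hbI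
  obtain ⟨K', hK', hloc'⟩ := exists_bump_kernel_le q h₀.kappa₄_pos hΔ hκ₃ S hS1 ρ hρΔ hcI hFI' hbr
  obtain ⟨D, hD, hdecμ⟩ := exists_lintegral_decay_le hq hκ₂ hS ρ
  obtain ⟨I, hI, hbinv⟩ := hb.exists_inv_le 4
  set C := K * D + K' * D + I * Real.exp 16 * κ₃ with hC
  have hKD : 0 < K * D := by positivity
  have hKD' : 0 < K' * D := by positivity
  have hIe : 0 < I * Real.exp 16 * κ₃ := by positivity
  have hC0 : 0 < C := by positivity
  have hw1 : (2 : ℝ) ^ (γ - β) < 1 := Real.rpow_lt_one_of_one_lt_of_neg one_lt_two (by linarith)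
  have hw2 : 0 < 1 - (2 : ℝ) ^ (γ - β) := by linarith
  refine ⟨C * ((1 - 2 ^ (γ - β))⁻¹ + 1), by positivity, fun lam φ h N hN P hP => ?_⟩
  refine h.eLpNorm_expansion_le_hNorm (m := fun t => (b t)⁻¹) hC0 hγβ (fun M hM x => ?_)
    (fun M hM x => ?_) (fun M hM hM2 x => ?_) hp hN hP
  · refine (lintegral_enorm_le_of_abs_le (by positivity) (fun y => hloc μ lam φ κ₁ κ₂ h M hM x y)
      (hdecμ μ lam φ κ₁ κ₃ κ₄ h M hM x)).trans ?_
    rw [← ENNReal.ofReal_mul (by positivity), mul_right_comm]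
    refine ENNReal.ofReal_le_ofReal (mul_le_mul_of_nonneg_right ?_ (by positivity))
    linarith
  · refine (lintegral_enorm_le_of_abs_le (by positivity) (fun y => hloc' μ lam φ κ₁ κ₂ h M hM x y)
      (hdecμ μ lam φ κ₁ κ₃ κ₄ h M hM x)).trans ?_
    rw [← ENNReal.ofReal_mul (by positivity), mul_right_comm]
    refine ENNReal.ofReal_le_ofReal (mul_le_mul_of_nonneg_right ?_ (by positivity))
    linarith
  · refine (h.lintegral_lowPass_le hI.le (fun t ht ht4 => ?_) hM hM2 x).trans
      (ENNReal.ofReal_le_ofReal (by linarith))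
    rw [abs_of_pos (inv_pos.2 (hb.pos ht))]
    exact hbinv t ht ht4

end IsDataDefinedSpace

/-- The measure `μ` itself belongs to every class of approximate quadrature measures. -/
lemma approxQuadBound_toSignedMeasure {X : Type*} [MeasurableSpace X] (𝕜 : Type*) [RCLike 𝕜]
    (μ : Measure X) [IsFiniteMeasure μ] (lam : ℕ → ℝ) (φ : ℕ → X → ℝ) (γ r : ℝ) (p : ℝ≥0∞)
    (A N : ℝ) : ApproxQuadBound 𝕜 μ lam φ γ r p A N μ.toSignedMeasure := by
  intro P _
  rw [VectorMeasure.integral_toSignedMeasure, sub_self, enorm_zero]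
  exact zero_le

end DataDefined

end

theorem theorem2 {X : Type*} [TopologicalSpace X] [MeasurableSpace X] [BorelSpace X]
    (𝕜 : Type*) [RCLike 𝕜]
    (ρ : X → X → ℝ) (μ : Measure X) (q κ₁ κ₂ κ₃ κ₄ : ℝ)
    (p : ℝ≥0∞) (hp : 1 ≤ p) (β : ℝ) (hβ : q * (p⁻¹).toReal < β)
    (S : ℕ) (hS : q < S) (b : ℝ → ℝ) (hb : DataDefined.IsMask S β b)
    (γ : ℝ) (hγ : 0 < γ) (hγβ : γ < β) (r : ℝ) (hr : γ < r) (Cv Cr Cm : ℝ) :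
    ∃ V R A : ℝ, 0 < V ∧ 0 < R ∧ 0 < A ∧
      ∀ (lam : ℕ → ℝ) (φ : ℕ → X → ℝ),
        DataDefined.IsDataDefinedSpace ρ μ lam φ q κ₁ κ₂ κ₃ κ₄ →
      ∀ G : X → X → ℝ, DataDefined.IsKernel μ lam φ b G →
      ∀ n : ℝ, 0 < n → ∀ K : Set (SignedMeasure X),
        (∀ ν ∈ K, ν.variation Set.univ ≤ ENNReal.ofReal Cv) →
        (∀ ν ∈ K, DataDefined.regNorm ρ q ν ((2 : ℝ) ^ (-n)) ≤ ENNReal.ofReal Cr) →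
        (∃ νs ∈ K, DataDefined.IsQuadrature 𝕜 μ lam φ ((2 : ℝ) ^ n) νs) →
      ∀ ν ∈ K,
        DataDefined.kernelError μ G p ν ≤
          ENNReal.ofReal Cm * ⨅ ν' ∈ K, DataDefined.kernelError μ G p ν' →
        DataDefined.ApproxQuadBound 𝕜 μ lam φ γ r p A ((2 : ℝ) ^ n) ν ∧
        ∀ N : ℕ, (N : ℝ) = (2 : ℝ) ^ n →
          DataDefined.MemApproxQuad 𝕜 ρ μ lam φ q γ r p V R A N ν := by
  classical
  -- The constants precede the eigenvalues and eigenfunctions. Any one admissible system supplies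
  -- the facts about `ρ` and `μ` from which they are built; without one the claim is vacuous.
  by_cases hex : ∃ (lam₀ : ℕ → ℝ) (φ₀ : ℕ → X → ℝ),
      DataDefined.IsDataDefinedSpace ρ μ lam₀ φ₀ q κ₁ κ₂ κ₃ κ₄
  swap
  · exact ⟨1, 1, 1, one_pos, one_pos, one_pos, fun lam φ h => absurd ⟨lam, φ, h⟩ hex⟩
  obtain ⟨lam₀, φ₀, h₀⟩ := hex
  have hκ₂ := h₀.kappa₂_pos
  obtain ⟨C₁, hC₁, herr⟩ := h₀.exists_kernelError_le 𝕜 hp hβ hS hb Cv Cr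
  obtain ⟨C₂, hC₂, hpoly⟩ := h₀.exists_eLpNorm_expansion_le 𝕜 hp hS hb hγβ r
  refine ⟨|Cv| + 1, |Cr| + κ₂, |Cm| * C₁ * C₂ + 1, by positivity, by positivity, by positivity,
    fun lam φ h G hG n hn K hKV hKR hKQ ν hνK hmin => ?_⟩
  have := h.prob
  obtain ⟨νs, hνs, hquad⟩ := hKQ
  obtain ⟨⟨C', hC', hGC⟩, herr⟩ := herr lam φ h G hG
  set N : ℝ := 2 ^ n with hN
  have hN1 : 1 ≤ N := Real.one_le_rpow one_le_two hn.le
  have hN0 : 0 < N := by linarith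
  have hNn : (2 : ℝ) ^ (-n) = 1 / N := by rw [Real.rpow_neg zero_le_two, one_div]
  rw [hNn] at hKR
  have hMν : DataDefined.kernelError μ G p ν ≤ ENNReal.ofReal (|Cm| * (C₁ * N ^ (-β))) := by
    rw [ENNReal.ofReal_mul (abs_nonneg _)]
    refine hmin.trans (mul_le_mul' (ENNReal.ofReal_le_ofReal (le_abs_self _)) ?_)
    exact (iInf₂_le νs hνs).trans (herr N hN1 νs (hKV νs hνs) (hKR νs hνs) hquad)
  have hbound : DataDefined.ApproxQuadBound 𝕜 μ lam φ γ r p (|Cm| * C₁ * C₂ + 1) N ν := by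
    intro P hP
    have h1 := h.enorm_quadError_le_kernelError (fun t ht => (hb.pos ht).ne') hG hC' hGC hp
      (h.indices N) (DataDefined.fourierCoef μ φ P) ν
    rw [← (h.eq_expansion_fourierCoef hP).1] at h1
    rw [enorm_sub_rev]
    refine h1.trans ((mul_le_mul' hMν (hpoly lam φ h N hN1 P hP)).trans ?_)
    rw [ENNReal.le_div_iff_mul_le (Or.inl (by
      rw [Ne, ENNReal.ofReal_eq_zero, not_le]; positivity)) (Or.inl ENNReal.ofReal_ne_top),
      ← mul_assoc, mul_right_comm, ← ENNReal.ofReal_mul (by positivity),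
      ← ENNReal.ofReal_mul (by positivity)]
    refine mul_le_mul' (ENNReal.ofReal_le_ofReal ?_) le_rfl
    have e1 : N ^ (-β) * N ^ (β - γ) * N ^ γ = 1 := by
      rw [← Real.rpow_add hN0, ← Real.rpow_add hN0]
      ring_nf
      exact Real.rpow_zero N
    calc |Cm| * (C₁ * N ^ (-β)) * (C₂ * N ^ (β - γ)) * N ^ γ
        = |Cm| * C₁ * C₂ * (N ^ (-β) * N ^ (β - γ) * N ^ γ) := by ring
      _ ≤ _ := by rw [e1]; linarith
  refine ⟨hbound, fun N' hN' => ?_⟩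
  -- Filling the other places with `μ` itself costs nothing: it has zero error, mass one and
  -- regularity constant `κ₂`.
  refine ⟨fun m => if m = N' then ν else μ.toSignedMeasure, ⟨fun m hm => ?_, fun m hm => ?_,
    fun m hm => ?_⟩, if_pos rfl⟩
  · split_ifs
    · refine (hKV ν hνK).trans (ENNReal.ofReal_le_ofReal ?_)
      linarith [le_abs_self Cv]
    · rw [Measure.variation_toSignedMeasure, measure_univ, ← ENNReal.ofReal_one]
      exact ENNReal.ofReal_le_ofReal (by linarith [abs_nonneg Cv])
  · split_ifs with hmN
    · rw [hmN, hN']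
      refine (hKR ν hνK).trans (ENNReal.ofReal_le_ofReal ?_)
      linarith [le_abs_self Cr]
    · have hm0 : (0 : ℝ) < m := by exact_mod_cast hm
      have hmem : ∀ x, μ.toSignedMeasure.variation (DataDefined.cball ρ x (1 / m)) ≤
          ENNReal.ofReal κ₂ * ENNReal.ofReal ((1 / (m : ℝ)) ^ q) := fun x => by
        rw [Measure.variation_toSignedMeasure]
        exact h.measure_cball_le x (by positivity)
      have hreg : DataDefined.regNorm ρ q μ.toSignedMeasure (1 / m) ≤ ENNReal.ofReal κ₂ :=
        sInf_le (by rwa [Set.mem_ofPred_eq])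
      exact hreg.trans (ENNReal.ofReal_le_ofReal (by linarith [abs_nonneg Cr]))
  · split_ifs with hmN
    · rw [hmN, hN']
      exact hbound
    · exact DataDefined.approxQuadBound_toSignedMeasure 𝕜 μ lam φ γ r p _ _
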